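/- Setting. Use local coordinates $q=(q^1,\dots,q^D)$ on the configuration space, so that the velocity phase space $\mathbb P_L$ is an open set $U\subset\mathbb R^D\times\mathbb R^D$ of points $u=(q,v)$ and the canonical phase space carries coordinates $(q,p)$ and $\omega=dq^a\wedge dp_a$. Let $L\in C^\infty(U)$, $E=v^a\partial L/\partial v^a-L$, $M_{ab}=\partial^2L/\partial v^a\partial v^b$, $F_{ab}=\frac{\partial^2L}{\partial v^a\partial q^b}-\frac{\partial^2L}{\partial v^b\partial q^a}$, $\Omega_L=\tfrac12F_{ab}\,dq^a\wedge dq^b+M_{ab}\,dq^a\wedge dv^b$, and let $\mathcal L(q,v)=(q,\partial L/\partial v)$ be the fibre derivative. Suppose $L$ is almost regular: $\Omega_L$ and $M$ have constant rank, $\dim\ker M=N_0$, $\mathcal L$ is a submersion onto its image (it has smooth local sections through every point) and has connected fibres. Let $\mathcal G$ be the fields $z^a\partial/\partial v^a$ with $M_{ab}z^b=0$, and $\overline{\mathcal F}$ the functions $g\in C^\infty(U)$ with $Gg=0$ for all $G\in\mathcal G$. Let $\overline{\ker\Omega_L}$ be the fields $P\in\ker\Omega_L$ with $[G,P]$ vertical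 for all $G\in\mathcal G$, and let $P_1,\dots,P_{N_0}\in\overline{\ker\Omega_L}$ be a basis of $\overline{\ker\Omega_L}/\mathcal G$ which, together with $\mathcal G$, spans $\ker\Omega_L$ at every point (so $\dim\ker\Omega_L=2N_0$). Put $\gamma^{[1]}_n=P_n^{qa}\big(\partial E/\partial q^a+F_{ab}v^b\big)$ and $\mathbb P_L^{[1]}=\{\gamma^{[1]}_n=0\ \forall n\}$. A SOELVF is a smooth field $X$ on $U$ with $i_X\Omega_L=dE$ on $\mathbb P_L^{[1]}$ and $[G,X]$ vertical for all $G\in\mathcal G$. On an open subset $W$ of the canonical phase space let $\gamma^{[0]}_n,f_n$ ($n=1,\dots,N_0$) be smooth functions (the primary constraints and their factors) with $\mathcal L(U)=\{\gamma^{[0]}_n=0\ \forall n\}=:\mathbb P_C^{[0]}$ and $i_{\mathcal L_*P_n}\omega=f_n\,d\gamma_n^{[0]}$ along $\mathcal L(U)$. A canonical Hamiltonian is $H_C\in C^\infty(W)$ with $H_C\circ\mathcal L=E$; the total Hamiltonians are $H_T=H_C+\sum_m u^mf_m\gamma^{[0]}_m$, $u^m\in C^\infty(W)$. A field $X$ projects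 to a field $Y$ along a set $A\subset U$ if $T_u\mathcal L\,X(u)=Y(\mathcal L(u))$ for $u\in A$; $\mathfrak X_h$ denotes the Hamiltonian vector field of $h$. Lagrangian constraint algorithm. Order 1: a SOELVF $X^{[1]}$, $P^{[1]}_m=P_m$, $\gamma^{[1]}_n$, $N_1=N_0$. Step $k\to k+1$: on $\mathbb P_L^{[k]}=\{\gamma^{[j]}_n=0,\ j\le k\}$ the matrix $\Gamma^{[k]}_{nm}=P^{[k]}_m\gamma^{[k]}_n$ has constant rank $N_k-N_{k+1}$; choose $A,B$ with entries in $\overline{\mathcal F}$ whose $N_{k+1}$ rows are there bases of the left and right kernels of $\Gamma^{[k]}$. Then $\gamma^{[k+1]}_i\in\overline{\mathcal F}$ equals $\sum_nA_{in}X^{[k]}\gamma^{[k]}_n$ on $\mathbb P_L^{[k]}$; functions $w^m\in\overline{\mathcal F}$ satisfy $\sum_m\Gamma^{[k]}_{nm}w^m=-X^{[k]}\gamma_n^{[k]}$ on $\mathbb P_L^{[k+1]}$; and, modulo $\mathcal G$, $X^{[k+1]}=X^{[k]}+\sum_mw^mP^{[k]}_m$ and $P^{[k+1]}_i=\sum_mB_{im}P^{[k]}_m$.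 It stops at order $k\ge2$ if $\mathrm{rank}\{d\gamma^{[j]}_n\}_{j\le k}=\mathrm{rank}\{d\gamma^{[j]}_n\}_{j\le k-1}$ on $\mathbb P^{[k]}_L$. Stability analysis of the total Hamiltonian. Start: $H^{[1]}$ is a total Hamiltonian, $\varphi^{[1]}_m=f_m\gamma^{[0]}_m$, and the secondary constraints are smooth functions $\gamma^{[1]}_{H,n}$ on $W$ equal to $-f_n\{\gamma^{[0]}_n,H^{[1]}\}$ on $\mathbb P_C^{[0]}$. Step $k\to k+1$: as above on $\mathbb P_C^{[k]}=\{\gamma^{[0]}_n=0,\ \gamma_{H,n}^{[j]}=0,\ 1\le j\le k\}$, with smooth functions on $W$ in place of $\overline{\mathcal F}$, the matrix $\{\gamma_{H,n}^{[k]},\varphi_m^{[k]}\}$ in place of $\Gamma^{[k]}$ and $\{\gamma_{H,n}^{[k]},H^{[k]}\}$ in place of $X^{[k]}\gamma^{[k]}_n$; $H^{[k+1]}=H^{[k]}+\sum_mw^m\varphi^{[k]}_m$, $\varphi^{[k+1]}_i=\sum_mB_{im}\varphi_m^{[k]}$. The functions $\gamma_H^{[k]}$ are the $(k+1)$-th level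 constraints. It stops at $k\ge2$ if adding the $\gamma_H^{[k]}$ does not increase the rank of the differentials of the constraints (the primary ones included) on $\mathbb P_C^{[k]}$. Theorem. (1) A function $g$ lies in $\overline{\mathcal F}$ iff $g=h\circ\mathcal L$ for some $h\in C^\infty(W)$. $E$ and all $\gamma^{[1]}_n$ lie in $\overline{\mathcal F}$ (in particular canonical Hamiltonians exist), and for every SOELVF $X$ and $g\in\overline{\mathcal F}$ the function $Xg$ coincides on $\mathbb P^{[1]}_L$ with an element of $\overline{\mathcal F}$. (2) $\{\gamma^{[0]}_n,\gamma^{[0]}_m\}=0$ on $\mathbb P_C^{[0]}$. Now fix any canonical Hamiltonian. (3) For every total Hamiltonian, $f_n\,d\gamma^{[0]}_n/dt=f_n\{\gamma^{[0]}_n,H_T\}=-\gamma^{[1]}_n$, that is, $\big(f_n\{\gamma^{[0]}_n,H_T\}\big)\circ\mathcal L=-\gamma^{[1]}_n$ on $U$. (4) Every SOELVF projects along $\mathbb P_L^{[1]}$ to $\mathfrak X_{H_T}$ for some total Hamiltonian $H_T$, and for every total Hamiltonian $H_T$ there is a SOELVF projecting along $\mathbb P_L^{[1]}$ to $\mathfrak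 X_{H_T}$. (5) For every run of the Lagrangian algorithm up to order $K$ there is a run of the stability analysis up to level $K+1$, and conversely, such that for all $1\le k\le K$: $\gamma_H^{[k]}\circ\mathcal L=\gamma^{[k]}$ on $U$ (the $k$-th order Lagrangian constraints project to the $(k+1)$-th level Hamiltonian constraints), $P^{[k]}_m$ projects to $\mathfrak X_{\varphi^{[k]}_m}$ along $U$, and $X^{[k]}$ projects to $\mathfrak X_{H^{[k]}}$ along $\mathbb P^{[1]}_L$. (6) For any two runs so related and every $1\le k\le K$: $\mathcal L(\mathbb P^{[k]}_L)=\mathbb P_C^{[k]}$; one stops at $k$ iff the other does; and for all $c^m\in C^\infty(W)$ the field $X=X^{[k]}+\sum_m(c^m\circ\mathcal L)P^{[k]}_m$ is a SOELVF, $H_T=H^{[k]}+\sum_mc^m\varphi_m^{[k]}$ is a total Hamiltonian, $X$ projects to $\mathfrak X_{H_T}$ along $\mathbb P_L^{[1]}$, and $\{\gamma^{[0]}_n,H_T\}=\{\gamma_{H,n}^{[j]},H_T\}=0$ on $\mathbb P_C^{[k]}$ for $1\le j<k$. If the algorithm stops at $k$, then also $\{\gamma_{H,n}^{[k]},H_T\}=0$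 on $\mathbb P_C^{[k]}$, so $\mathfrak X_{H_T}$ annihilates all constraints there; and if moreover $\mathrm{rank}\{d\gamma^{[j]}_n\}_{j\le k}$ is constant near each point of $\mathbb P_L^{[k]}$, then every integral curve of $\mathfrak X_{H_T}$ in $W$ that meets $\mathbb P_C^{[k]}$ stays in $\mathbb P_C^{[k]}$. -/

import Mathlib

open scoped ContDiff Topology

namespace ConstrainedDynamics

/-- Points `(q, v)` of the velocity phase space, or `(q, p)` of the canonical phase space, in local
coordinates of a `D`-dimensional configuration space. Tangent vectors are pairs of the same kind. -/
abbrev Phase (D : ℕ) : Type := (Fin D → ℝ) × (Fin D → ℝ)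

/-- `∂f/∂q^a`. -/
noncomputable def dFst {D : ℕ} (f : Phase D → ℝ) (a : Fin D) (x : Phase D) : ℝ :=
  fderiv ℝ f x (Pi.single a 1, 0)

/-- `∂f/∂v^a` (or `∂f/∂p_a` on the canonical phase space). -/
noncomputable def dSnd {D : ℕ} (f : Phase D → ℝ) (a : Fin D) (x : Phase D) : ℝ :=
  fderiv ℝ f x (0, Pi.single a 1)

/-! ### The geometry of a Lagrangian -/

/-- The fibre derivative `(q, v) ↦ (q, p)`, `p_a = ∂L/∂v^a`. -/
noncomputable def legendre {D : ℕ} (L : Phase D → ℝ) (u : Phase D) : Phase D :=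
  (u.1, fun a => dSnd L a u)

/-- The energy `E = v^a ∂L/∂v^a - L`. -/
noncomputable def energy {D : ℕ} (L : Phase D → ℝ) (u : Phase D) : ℝ :=
  ∑ a, u.2 a * dSnd L a u - L u

/-- The Hessian `M_ab = ∂²L/∂v^a∂v^b`. -/
noncomputable def hessian {D : ℕ} (L : Phase D → ℝ) (u : Phase D) : Matrix (Fin D) (Fin D) ℝ :=
  Matrix.of fun a b => dSnd (dSnd L b) a u

/-- `F_ab = ∂²L/∂v^a∂q^b - ∂²L/∂v^b∂q^a`. -/
noncomputable def curvature {D : ℕ} (L : Phase D → ℝ) (u : Phase D) :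
    Matrix (Fin D) (Fin D) ℝ :=
  Matrix.of fun a b => dFst (dSnd L a) b u - dFst (dSnd L b) a u

/-- The Lagrange two-form `Ω_L = ½ F_ab dq^a ∧ dq^b + M_ab dq^a ∧ dv^b`, that is
`-d (∂L/∂v^a dq^a)`, evaluated on two tangent vectors. -/
noncomputable def lagrangeForm {D : ℕ} (L : Phase D → ℝ) (u X Y : Phase D) : ℝ :=
  (∑ a, ∑ b, curvature L u a b * (X.1 a * Y.1 b)) +
    ∑ a, ∑ b, hessian L u a b * (X.1 a * Y.2 b - Y.1 a * X.2 b)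

/-- `ker Ω_L(u)`. -/
def formKernel {D : ℕ} (L : Phase D → ℝ) (u : Phase D) : Set (Phase D) :=
  {K | ∀ Y, lagrangeForm L u K Y = 0}

/-- The space `𝒢(u)` of vertical tangent vectors `z^a ∂/∂v^a` with `M_ab z^b = 0`. -/
def vertKernel {D : ℕ} (L : Phase D → ℝ) (u : Phase D) : Set (Phase D) :=
  {G | G.1 = 0 ∧ (hessian L u).mulVec G.2 = 0}

/-- Almost regular Lagrangians on the open set `U` of the velocity phase space, the Hessian having
an `N₀`-dimensional kernel. The field `submersive` says that the fibre derivative is a submersion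
onto its image: it has smooth local sections through every point. -/
structure AlmostRegular {D : ℕ} (L : Phase D → ℝ) (U : Set (Phase D)) (N₀ : ℕ) : Prop where
  isOpen : IsOpen U
  smooth : ContDiffOn ℝ ∞ L U
  form_rank : ∃ r : ℕ, ∀ u ∈ U, Module.finrank ℝ (Submodule.span ℝ (formKernel L u)) = r
  hessian_rank : ∀ u ∈ U, (hessian L u).rank + N₀ = D
  submersive : ∀ u ∈ U, ∃ V : Set (Phase D), IsOpen V ∧ legendre L u ∈ V ∧
    ∃ σ : Phase D → Phase D, ContDiffOn ℝ ∞ σ V ∧ Set.MapsTo σ V U ∧ σ (legendre L u) = u ∧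
      ∀ s ∈ V ∩ legendre L '' U, legendre L (σ s) = s
  fibre_connected : ∀ u ∈ U, IsConnected {x | x ∈ U ∧ legendre L x = legendre L u}

/-- Smooth vector fields on `U` with values in `𝒢`. -/
def VertField {D : ℕ} (L : Phase D → ℝ) (U : Set (Phase D)) (G : Phase D → Phase D) : Prop :=
  ContDiffOn ℝ ∞ G U ∧ ∀ u ∈ U, G u ∈ vertKernel L u

/-- Smooth vector fields `X` on `U` such that `[G, X]` is vertical for every field `G` in `𝒢`. -/
def BracketVertical {D : ℕ} (L : Phase D → ℝ) (U : Set (Phase D)) (X : Phase D → Phase D) :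
    Prop :=
  ContDiffOn ℝ ∞ X U ∧
    ∀ G, VertField L U G → ∀ u ∈ U, (VectorField.lieBracket ℝ G X u).1 = 0

/-- The functions `f` in the algebra `ℱ`: smooth on `U`, with `G f = 0` for all `G` in `𝒢`. -/
def InFbar {D : ℕ} (L : Phase D → ℝ) (U : Set (Phase D)) (f : Phase D → ℝ) : Prop :=
  ContDiffOn ℝ ∞ f U ∧ ∀ u ∈ U, ∀ G ∈ vertKernel L u, fderiv ℝ f u G = 0

/-- The fields `P_n` lie in the subspace of `ker Ω_L` of fields whose brackets with `𝒢` are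
vertical, and their classes are a basis of that space modulo `𝒢`: at every point they are linearly
independent modulo `𝒢` and span `ker Ω_L` modulo `𝒢`. -/
structure IsKernelBasis {D N₀ : ℕ} (L : Phase D → ℝ) (U : Set (Phase D))
    (P : Fin N₀ → Phase D → Phase D) : Prop where
  mem_kernel : ∀ n, ∀ u ∈ U, P n u ∈ formKernel L u
  bracket : ∀ n, BracketVertical L U (P n)
  spans : ∀ u ∈ U, ∀ K ∈ formKernel L u, ∃ c : Fin N₀ → ℝ, K - ∑ n, c n • P n u ∈ vertKernel L u
  indep : ∀ u ∈ U, ∀ c : Fin N₀ → ℝ, ∑ n, c n • P n u ∈ vertKernel L u → c = 0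

/-- The first-order Lagrangian constraint function `P^{qa} (∂E/∂q^a + F_ab v^b)` defined by the
horizontal part of a field `P`. -/
noncomputable def firstOrder {D : ℕ} (L : Phase D → ℝ) (P : Phase D → Phase D) (u : Phase D) : ℝ :=
  ∑ a, (P u).1 a * (dFst (energy L) a u + ∑ b, curvature L u a b * u.2 b)

/-- The first-order Lagrangian constraint submanifold. -/
def firstSurface {D N₀ : ℕ} (L : Phase D → ℝ) (U : Set (Phase D))
    (P : Fin N₀ → Phase D → Phase D) : Set (Phase D) :=
  {u | u ∈ U ∧ ∀ n, firstOrder L (P n) u = 0}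

/-- Second-order Euler-Lagrange vector fields: smooth fields solving the energy equation
`i_X Ω_L = dE` on the first-order constraint submanifold, whose brackets with `𝒢` are vertical. -/
def IsSOELVF {D N₀ : ℕ} (L : Phase D → ℝ) (U : Set (Phase D))
    (P : Fin N₀ → Phase D → Phase D) (X : Phase D → Phase D) : Prop :=
  BracketVertical L U X ∧
    ∀ u ∈ firstSurface L U P, ∀ Y, lagrangeForm L u (X u) Y = fderiv ℝ (energy L) u Y

/-! ### The constraint algorithm for SOELVFs

Objects of order `k` carry the index `k = 1, 2, …`; the index `0` of the families is not used. The
number of constraint functions of order `k`, which is also the number of multipliers that are still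
free at that order, is `N k`. -/

/-- Constraint functions `γ^[k]_n`, fields `P^[k]_n`, and fields `X^[k]` (the general SOELVF of
order `k` being `X^[k] + ∑ u^m P^[k]_m` with arbitrary `u^m`). -/
structure LagData (D : ℕ) (N : ℕ → ℕ) where
  γ : (k : ℕ) → Fin (N k) → Phase D → ℝ
  P : (k : ℕ) → Fin (N k) → Phase D → Phase D
  X : ℕ → Phase D → Phase D

/-- The Lagrangian constraint submanifold of order `k`. -/
def LagData.surface {D : ℕ} {N : ℕ → ℕ} (R : LagData D N) (U : Set (Phase D)) (k : ℕ) :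
    Set (Phase D) :=
  {u | u ∈ U ∧ ∀ j, 1 ≤ j → j ≤ k → ∀ n, R.γ j n u = 0}

/-- The matrix `Γ^[k]_nm = ⟨dγ^[k]_n | P^[k]_m⟩`. -/
noncomputable def LagData.Γ {D : ℕ} {N : ℕ → ℕ} (R : LagData D N) (k : ℕ) (u : Phase D) :
    Matrix (Fin (N k)) (Fin (N k)) ℝ :=
  Matrix.of fun n m => fderiv ℝ (R.γ k n) u (R.P k m u)

/-- The number of independent constraint functions of order at most `k`, at the point `u`. -/
noncomputable def LagData.indepRank {D : ℕ} {N : ℕ → ℕ} (R : LagData D N) (k : ℕ) (u : Phase D) :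
    ℕ :=
  Module.finrank ℝ (Submodule.span ℝ
    {α : Phase D →L[ℝ] ℝ | ∃ j, 1 ≤ j ∧ j ≤ k ∧ ∃ n, α = fderiv ℝ (R.γ j n) u})

/-- One step of the algorithm, from order `k` to order `k + 1`. The constraint condition
`X γ^[k]_n = 0` for `X = X^[k] + ∑ w^m P^[k]_m` reads `∑ Γ^[k]_nm w^m = - X^[k] γ^[k]_n`.
The components of the right-hand side along a basis `A` of the left kernel of `Γ^[k]` are the new
constraint functions, up to functions vanishing on the current constraint submanifold; on the new
one the condition is solved by `w`; the directions `B` in the kernel of `Γ^[k]` remain free. Fields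
are determined up to `𝒢`. -/
def LagData.Step {D : ℕ} {N : ℕ → ℕ} (R : LagData D N) (L : Phase D → ℝ) (U : Set (Phase D))
    (k : ℕ) : Prop :=
  (∀ i, InFbar L U (R.γ (k + 1) i)) ∧
  (∀ i, ContDiffOn ℝ ∞ (R.P (k + 1) i) U) ∧ ContDiffOn ℝ ∞ (R.X (k + 1)) U ∧
  ∃ (A B : Fin (N (k + 1)) → Fin (N k) → Phase D → ℝ) (w : Fin (N k) → Phase D → ℝ),
    (∀ i n, InFbar L U (A i n)) ∧ (∀ i n, InFbar L U (B i n)) ∧ (∀ n, InFbar L U (w n)) ∧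
    (∀ u ∈ R.surface U k,
      (R.Γ k u).rank + N (k + 1) = N k ∧
      LinearIndependent ℝ (fun i => fun n => A i n u) ∧
      LinearIndependent ℝ (fun i => fun m => B i m u) ∧
      (∀ i m, ∑ n, A i n u * R.Γ k u n m = 0) ∧
      (∀ i n, ∑ m, R.Γ k u n m * B i m u = 0) ∧
      ∀ i, R.γ (k + 1) i u = ∑ n, A i n u * fderiv ℝ (R.γ k n) u (R.X k u)) ∧
    (∀ u ∈ R.surface U (k + 1), ∀ n,
      ∑ m, R.Γ k u n m * w m u = -fderiv ℝ (R.γ k n) u (R.X k u)) ∧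
    (∀ u ∈ U, R.X (k + 1) u - (R.X k u + ∑ m, w m u • R.P k m u) ∈ vertKernel L u) ∧
    ∀ i, ∀ u ∈ U, R.P (k + 1) i u - ∑ m, B i m u • R.P k m u ∈ vertKernel L u

/-- `R` is a run, up to order `K`, of the constraint algorithm with initial basis `P`. -/
structure LagData.IsRun {D : ℕ} {N : ℕ → ℕ} (R : LagData D N) (L : Phase D → ℝ)
    (U : Set (Phase D)) (P : Fin (N 1) → Phase D → Phase D) (K : ℕ) : Prop where
  one_le : 1 ≤ K
  P_one : ∀ n, ∀ u ∈ U, R.P 1 n u = P n u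
  X_one : IsSOELVF L U P (R.X 1)
  γ_one : ∀ n, ∀ u ∈ U, R.γ 1 n u = firstOrder L (P n) u
  step : ∀ k, 1 ≤ k → k < K → R.Step L U k

/-- The algorithm stops at order `k`: there are no new independent constraint functions. -/
def LagData.Stops {D : ℕ} {N : ℕ → ℕ} (R : LagData D N) (U : Set (Phase D)) (k : ℕ) : Prop :=
  2 ≤ k ∧ ∀ u ∈ R.surface U k, R.indepRank k u = R.indepRank (k - 1) u

/-! ### The canonical phase space -/

/-- The canonical two-form `ω = dq^a ∧ dp_a`. -/
def canonicalForm {D : ℕ} (X Y : Phase D) : ℝ :=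
  ∑ a, (X.1 a * Y.2 a - Y.1 a * X.2 a)

/-- The Hamiltonian vector field of `h`, the solution of `i_X ω = dh`. -/
noncomputable def hamField {D : ℕ} (h : Phase D → ℝ) (s : Phase D) : Phase D :=
  (fun a => dSnd h a s, fun a => -dFst h a s)

/-- The Poisson bracket `{g, h}`, the derivative of `g` along the Hamiltonian flow of `h`. -/
noncomputable def poisson {D : ℕ} (g h : Phase D → ℝ) (s : Phase D) : ℝ :=
  ∑ a, (dFst g a s * dSnd h a s - dSnd g a s * dFst h a s)

/-- `γ₀ n`, on the open set `W` of the canonical phase space, are the primary Hamiltonian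
constraints belonging to the basis `P`: the one-forms `π_n = i_{𝔓_n} ω`, where `𝔓_n` is the
push-forward of `P_n` by the fibre derivative, are `π_n = f_n dγ₀_n`, and the primary constraint
submanifold `γ₀ = 0` is the image of the fibre derivative. -/
structure IsPrimary {D N₀ : ℕ} (L : Phase D → ℝ) (U : Set (Phase D))
    (P : Fin N₀ → Phase D → Phase D) (W : Set (Phase D)) (γ₀ f : Fin N₀ → Phase D → ℝ) : Prop where
  isOpen : IsOpen W
  smooth : ∀ n, ContDiffOn ℝ ∞ (γ₀ n) W
  smooth_factor : ∀ n, ContDiffOn ℝ ∞ (f n) W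
  image : legendre L '' U = {s | s ∈ W ∧ ∀ n, γ₀ n s = 0}
  pfaff : ∀ n, ∀ u ∈ U, ∀ Y, canonicalForm (fderiv ℝ (legendre L) u (P n u)) Y =
    f n (legendre L u) * fderiv ℝ (γ₀ n) (legendre L u) Y

/-- `H` is a canonical Hamiltonian: a smooth function on `W` whose restriction to the image of the
fibre derivative is the projection of the energy. -/
def IsCanonicalHam {D : ℕ} (L : Phase D → ℝ) (U W : Set (Phase D)) (H : Phase D → ℝ) : Prop :=
  ContDiffOn ℝ ∞ H W ∧ ∀ u ∈ U, H (legendre L u) = energy L u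

/-- The total Hamiltonian `H_C + ∑ u^m f_m γ₀_m`. -/
noncomputable def totalHam {D N₀ : ℕ} (H : Phase D → ℝ) (γ₀ f u : Fin N₀ → Phase D → ℝ)
    (s : Phase D) : ℝ :=
  H s + ∑ m, u m s * (f m s * γ₀ m s)

/-! ### The stability analysis of the total Hamiltonian -/

/-- Constraint functions `γ^[k]_n` of level `k + 1` (for `k ≥ 1`; level one are the primary
constraints), the combinations `φ^[k]_n` of primary constraints whose multipliers are still free,
and functions `H^[k]` (the total Hamiltonian at this stage being `H^[k] + ∑ u^m φ^[k]_m` with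
arbitrary `u^m`). -/
structure HamData (D : ℕ) (N : ℕ → ℕ) where
  γ : (k : ℕ) → Fin (N k) → Phase D → ℝ
  φ : (k : ℕ) → Fin (N k) → Phase D → ℝ
  H : ℕ → Phase D → ℝ

/-- The Hamiltonian constraint submanifold on which all constraints up to level `k + 1` hold. -/
def HamData.surface {D N₀ : ℕ} {N : ℕ → ℕ} (S : HamData D N) (W : Set (Phase D))
    (γ₀ : Fin N₀ → Phase D → ℝ) (k : ℕ) : Set (Phase D) :=
  {s | s ∈ W ∧ (∀ n, γ₀ n s = 0) ∧ ∀ j, 1 ≤ j → j ≤ k → ∀ n, S.γ j n s = 0}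

/-- The matrix `{γ^[k]_n, φ^[k]_m}`. -/
noncomputable def HamData.C {D : ℕ} {N : ℕ → ℕ} (S : HamData D N) (k : ℕ) (s : Phase D) :
    Matrix (Fin (N k)) (Fin (N k)) ℝ :=
  Matrix.of fun n m => poisson (S.γ k n) (S.φ k m) s

/-- The number of independent constraint functions of level at most `k + 1`, at the point `s`. -/
noncomputable def HamData.indepRank {D N₀ : ℕ} {N : ℕ → ℕ} (S : HamData D N)
    (γ₀ : Fin N₀ → Phase D → ℝ) (k : ℕ) (s : Phase D) : ℕ :=
  Module.finrank ℝ (Submodule.span ℝ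
    {α : Phase D →L[ℝ] ℝ | (∃ n, α = fderiv ℝ (γ₀ n) s) ∨
      ∃ j, 1 ≤ j ∧ j ≤ k ∧ ∃ n, α = fderiv ℝ (S.γ j n) s})

/-- One step of the stability analysis: the condition `{γ^[k]_n, H^[k] + ∑ w^m φ^[k]_m} = 0` on the
constraint submanifold. Its components along a basis `A` of the left kernel of the matrix
`{γ^[k]_n, φ^[k]_m}` are the constraints of the next level, as functions on the current constraint
submanifold; on the new one the condition is solved by `w`; the combinations `B` in the kernel of
the matrix remain free. -/
def HamData.Step {D N₀ : ℕ} {N : ℕ → ℕ} (S : HamData D N) (W : Set (Phase D))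
    (γ₀ : Fin N₀ → Phase D → ℝ) (k : ℕ) : Prop :=
  (∀ i, ContDiffOn ℝ ∞ (S.γ (k + 1) i) W) ∧
  ∃ (A B : Fin (N (k + 1)) → Fin (N k) → Phase D → ℝ) (w : Fin (N k) → Phase D → ℝ),
    (∀ i n, ContDiffOn ℝ ∞ (A i n) W) ∧ (∀ i n, ContDiffOn ℝ ∞ (B i n) W) ∧
    (∀ n, ContDiffOn ℝ ∞ (w n) W) ∧
    (∀ s ∈ S.surface W γ₀ k,
      (S.C k s).rank + N (k + 1) = N k ∧
      LinearIndependent ℝ (fun i => fun n => A i n s) ∧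
      LinearIndependent ℝ (fun i => fun m => B i m s) ∧
      (∀ i m, ∑ n, A i n s * S.C k s n m = 0) ∧
      (∀ i n, ∑ m, S.C k s n m * B i m s = 0) ∧
      ∀ i, S.γ (k + 1) i s = ∑ n, A i n s * poisson (S.γ k n) (S.H k) s) ∧
    (∀ s ∈ S.surface W γ₀ (k + 1), ∀ n,
      ∑ m, S.C k s n m * w m s = -poisson (S.γ k n) (S.H k) s) ∧
    (∀ s ∈ W, S.H (k + 1) s = S.H k s + ∑ m, w m s * S.φ k m s) ∧
    ∀ i, ∀ s ∈ W, S.φ (k + 1) i s = ∑ m, B i m s * S.φ k m s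

/-- `S` is a run, up to level `K + 1`, of the stability analysis of the total Hamiltonian, for the
canonical Hamiltonian `H`. It starts with the stability of the primary constraints under a total
Hamiltonian: the secondary constraint functions are, on the primary constraint submanifold,
the time derivatives of the primary ones up to the factors `-f_n`. -/
structure HamData.IsRun {D : ℕ} {N : ℕ → ℕ} (S : HamData D N) (W : Set (Phase D))
    (γ₀ f : Fin (N 1) → Phase D → ℝ) (H : Phase D → ℝ) (K : ℕ) : Prop where
  one_le : 1 ≤ K
  φ_one : ∀ n, ∀ s ∈ W, S.φ 1 n s = f n s * γ₀ n s
  H_one : ∃ w : Fin (N 1) → Phase D → ℝ, (∀ n, ContDiffOn ℝ ∞ (w n) W) ∧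
    ∀ s ∈ W, S.H 1 s = totalHam H γ₀ f w s
  γ_smooth : ∀ n, ContDiffOn ℝ ∞ (S.γ 1 n) W
  γ_one : ∀ n, ∀ s ∈ S.surface W γ₀ 0, S.γ 1 n s = -(f n s * poisson (γ₀ n) (S.H 1) s)
  step : ∀ k, 1 ≤ k → k < K → S.Step W γ₀ k

/-- The analysis stops: there are no new independent constraint functions. -/
def HamData.Stops {D N₀ : ℕ} {N : ℕ → ℕ} (S : HamData D N) (W : Set (Phase D))
    (γ₀ : Fin N₀ → Phase D → ℝ) (k : ℕ) : Prop :=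
  2 ≤ k ∧ ∀ s ∈ S.surface W γ₀ k, S.indepRank γ₀ k s = S.indepRank γ₀ (k - 1) s

/-! ### Projection of one algorithm to the other -/

/-- The field `X` projects, along the set `A`, to the Hamiltonian vector field of `h`. -/
def ProjectsTo {D : ℕ} (L : Phase D → ℝ) (A : Set (Phase D)) (X : Phase D → Phase D)
    (h : Phase D → ℝ) : Prop :=
  ∀ u ∈ A, fderiv ℝ (legendre L) u (X u) = hamField h (legendre L u)

/-- At every step `1 ≤ k ≤ K` the data `R` project to the data `S`: the Lagrangian constraints of
order `k` to the Hamiltonian constraints of level `k + 1`, the free directions to the Hamiltonian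
vector fields of the free combinations of primary constraints, and `X^[k]` to the Hamiltonian vector
field of `H^[k]` along the first-order constraint submanifold. -/
def RunProjects {D : ℕ} {N : ℕ → ℕ} (L : Phase D → ℝ) (U : Set (Phase D)) (R : LagData D N)
    (S : HamData D N) (K : ℕ) : Prop :=
  ∀ k, 1 ≤ k → k ≤ K →
    (∀ n, ∀ u ∈ U, S.γ k n (legendre L u) = R.γ k n u) ∧
    (∀ m, ProjectsTo L U (R.P k m) (S.φ k m)) ∧
    ProjectsTo L (R.surface U 1) (R.X k) (S.H k)

end ConstrainedDynamics

/-! Everything rests on the tangent map $T\mathcal L$ of the fibre derivative. The Lagrange form is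
the pull-back of $\omega$ (`lagrangeForm_eq`), and $\mathcal G$ is the kernel of $T\mathcal L$
(`mem_vertKernel_iff`), so $\mathcal L$ has constant rank $2D-N_0$. A function killed by $\mathcal
G$ is therefore constant on the connected fibres; it descends through the local sections and extends
to $W$ by a partition of unity (`IsPrimary.inFbar_iff`).

Nondegeneracy of $\omega$ gives $T\mathcal L\,P_n=f_n\mathfrak X_{\gamma^{[0]}_n}$
(`IsPrimary.push_eq`). Independence of the $P_n$ modulo $\mathcal G$ then makes every $f_n$ nonzero
on the image and the $N_0$ differentials $d\gamma^{[0]}_n$ independent. By dimension they span the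
annihilator of the range of $T\mathcal L$ (`IsPrimary.mem_span_of_comp_eq_zero`). Involution of the
primary constraints and the formula for their time derivatives follow by the chain rule.

The equation $i_X\Omega_L=dE$ at $u$ says that $i_{T\mathcal L X-\mathfrak X_{H_C}}\omega$
annihilates the range of $T\mathcal L$, hence that $T\mathcal L X-\mathfrak X_{H_C}$ is a
combination of the $f_m\mathfrak X_{\gamma^{[0]}_m}$. The bracket condition means that the
horizontal components of $X$ project, and these alone determine the coefficients, which are thus
smooth functions on $W$ (`IsPrimary.exists_projectsTo_totalHam`). Conversely, over $\mathbb
P_L^{[1]}$ the field $\mathfrak X_{H_T}$ is tangent to the image and is lifted with a smooth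
generalized inverse of the Hessian (`IsPrimary.exists_isSOELVF`).

For data that project to each other, derivatives along the fields are Poisson brackets. The
matrices, right-hand sides and surfaces of the two algorithms agree through $\mathcal L$, and so do
the conditions of each step (`RunProjects.step_conditions_iff`). Coefficients are carried across by
pull-back or by projection. The $\varphi^{[k]}_m$ vanish on the primary surface, so differentials of
multipliers never contribute there.

Pull-back of covectors kills exactly the span of the $d\gamma^{[0]}_n$, so the two ranks differ by
$N_0$ and the algorithms stop together (`RunProjects.indepRank_eq`). Invariance of the final surface
is a Gronwall estimate for a maximal independent set of constraints
(`integralCurve_mem_of_tangent`). -/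

namespace ConstrainedDynamics

/-! ### Smooth selections, and functions near level sets of submersions. -/

section Analysis

variable {E F : Type*} [NormedAddCommGroup E] [NormedSpace ℝ E] [FiniteDimensional ℝ E]
  [NormedAddCommGroup F] [NormedSpace ℝ F]

open scoped Manifold in
/-- On an open set, smooth local selections of a convex-valued map glue to a global one. -/
theorem exists_contDiffOn_selection {W : Set E} (hW : IsOpen W) (t : E → Set F)
    (ht : ∀ x ∈ W, Convex ℝ (t x))
    (hloc : ∀ x ∈ W, ∃ V ∈ 𝓝 x, ∃ g : E → F, ContDiffOn ℝ ∞ g V ∧ ∀ y ∈ V, y ∈ W → g y ∈ t y) :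
    ∃ g : E → F, ContDiffOn ℝ ∞ g W ∧ ∀ y ∈ W, g y ∈ t y := by
  classical
  -- With `W` regarded as a manifold, a partition of unity averages the local selections, and
  -- convexity keeps the average in `t x`.
  let O : TopologicalSpace.Opens E := ⟨W, hW⟩
  have : LocallyCompactSpace O := hW.isOpenEmbedding_subtypeVal.locallyCompactSpace
  obtain ⟨g, hg⟩ := exists_contMDiffMap_forall_mem_convex_of_local (n := ⊤) 𝓘(ℝ, E) (M := O)
    (F := F) (t := fun x => t x.1) (fun x => ht x.1 x.2) (by
      rintro ⟨x, hx⟩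
      obtain ⟨V, hV, g, hg, hgt⟩ := hloc x hx
      obtain ⟨V', hV'V, hV'o, hxV'⟩ := mem_nhds_iff.1 hV
      refine ⟨Subtype.val ⁻¹' V', ?_, fun y => g y.1, ?_, fun y hy => hgt y.1 (hV'V hy) y.2⟩
      · exact continuous_subtype_val.continuousAt.preimage_mem_nhds (hV'o.mem_nhds hxV')
      · intro y hy
        have h1 : ContMDiffAt 𝓘(ℝ, E) 𝓘(ℝ, F) ∞ g y.1 :=
          ((hg.mono hV'V).contDiffAt (hV'o.mem_nhds hy)).contMDiffAt
        exact (contMDiffAt_subtype_iff.2 h1).contMDiffWithinAt)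
  let f : E → F := fun x => if h : x ∈ W then g ⟨x, h⟩ else 0
  refine ⟨f, fun x hx => ?_, fun y hy => ?_⟩
  · have h1 : ContMDiffAt 𝓘(ℝ, E) 𝓘(ℝ, F) ∞ (fun y : O => f y.1) ⟨x, hx⟩ := by
      refine (g.contMDiff ⟨x, hx⟩).congr_of_eventuallyEq (Filter.Eventually.of_forall fun y => ?_)
      have hy : (y : E) ∈ W := y.2
      simp [f, hy]
    exact ((contMDiffAt_subtype_iff (U := O) (f := f)).1 h1).contDiffAt.contDiffWithinAt
  · simpa [f, hy] using hg ⟨y, hy⟩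

/-- Straightening of a map with surjective derivative. -/
theorem exists_straightening {G : E → F} {s₀ : E} (hG : ContDiffAt ℝ 1 G s₀)
    (hsurj : Function.Surjective (fderiv ℝ G s₀)) :
    ∃ (K : Submodule ℝ E) (ψ : F × K → E) (κ : E → K), ContDiffAt ℝ 1 ψ (G s₀, 0) ∧
      ContinuousAt κ s₀ ∧ κ s₀ = 0 ∧ ψ (G s₀, 0) = s₀ ∧
      (∀ᶠ z in 𝓝 (G s₀, (0 : K)), G (ψ z) = z.1) ∧ ∀ᶠ x in 𝓝 s₀, ψ (G x, κ x) = x := by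
  set A := fderiv ℝ G s₀ with hA
  obtain ⟨p, hp⟩ := A.ker_closedComplemented_of_finiteDimensional_range
  have hbij : Function.Bijective (A.prod p) := by
    refine ⟨(injective_iff_map_eq_zero _).2 fun x hx => ?_, fun z => ?_⟩
    · obtain ⟨h1, h2⟩ := Prod.ext_iff.1 (show (A x, p x) = (0, 0) from hx)
      have h3 := hp ⟨x, h1⟩
      simpa using congrArg Subtype.val (h3.symm.trans h2)
    · obtain ⟨x, hx⟩ := hsurj z.1
      have hk : ∀ y : A.ker, A y = 0 := fun y => y.2
      refine ⟨x - p x + z.2, Prod.ext ?_ ?_⟩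
      · simp [hk, hx]
      · simp [hp]
  let e : E ≃L[ℝ] F × A.ker :=
    (LinearEquiv.ofBijective (A.prod p : E →ₗ[ℝ] F × A.ker) hbij).toContinuousLinearEquiv
  have he : (e : E →L[ℝ] F × A.ker) = A.prod p := by ext x <;> rfl
  -- `G` is completed by the projection to the kernel of its derivative. The derivative of `Φ` at
  -- `s₀` is the bijection `e`, so the inverse function theorem applies.
  let Φ : E → F × A.ker := fun x => (G x, p (x - s₀))
  have hΦ : ContDiffAt ℝ 1 Φ s₀ := by
    refine hG.prodMk ?_
    fun_prop
  have hΦ' : HasFDerivAt Φ (e : E →L[ℝ] F × A.ker) s₀ := by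
    rw [he]
    refine (hG.differentiableAt one_ne_zero).hasFDerivAt.prodMk ?_
    exact p.hasFDerivAt.comp s₀ ((hasFDerivAt_id s₀).sub_const s₀)
  have h0 : Φ s₀ = (G s₀, 0) := by simp [Φ]
  let Ψ := hΦ.toOpenPartialHomeomorph Φ hΦ' one_ne_zero
  have hsrc : s₀ ∈ Ψ.source := hΦ.mem_toOpenPartialHomeomorph_source hΦ' one_ne_zero
  have htgt : (G s₀, 0) ∈ Ψ.target := by
    rw [← h0]; exact hΦ.image_mem_toOpenPartialHomeomorph_target hΦ' one_ne_zero
  have hl : ∀ x ∈ Ψ.source, Ψ.symm (Φ x) = x := fun x hx => Ψ.left_inv hx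
  refine ⟨A.ker, Ψ.symm, fun x => p (x - s₀), ?_, by fun_prop, by simp, ?_, ?_, ?_⟩
  · rw [← h0]; exact hΦ.to_localInverse hΦ' one_ne_zero
  · rw [← h0]; exact hl _ hsrc
  · filter_upwards [Ψ.open_target.mem_nhds htgt] with z hz
    exact congrArg Prod.fst (Ψ.right_inv hz)
  · filter_upwards [Ψ.open_source.mem_nhds hsrc] with x hx using hl x hx

/-- A function whose differential vanishes on the kernel of `DG` along a level set of the
submersion `G` is locally constant on this level set. -/
theorem eventually_eq_of_ker_le {G : E → F} {s₀ : E} (hG : ContDiffAt ℝ 1 G s₀)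
    (hsurj : Function.Surjective (fderiv ℝ G s₀)) {γ : E → ℝ}
    (hγ : ∀ᶠ x in 𝓝 s₀, DifferentiableAt ℝ γ x)
    (hker : ∀ᶠ x in 𝓝 s₀, G x = G s₀ → ∀ Y, fderiv ℝ G x Y = 0 → fderiv ℝ γ x Y = 0) :
    ∀ᶠ x in 𝓝 s₀, G x = G s₀ → γ x = γ s₀ := by
  obtain ⟨K, ψ, κ, hψ, hκ, hκ0, hψ0, hGψ, hψG⟩ := exists_straightening hG hsurj
  -- `j` parametrizes the level set. `G ∘ j` is constant, so its derivative takes values in the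
  -- kernel of `DG`, and `γ ∘ j` has zero derivative.
  let j : K → E := fun y => ψ (G s₀, y)
  have hins : ContinuousAt (fun y : K => (G s₀, y)) 0 := by fun_prop
  have hj : ContinuousAt j 0 := ContinuousAt.comp (g := ψ) hψ.continuousAt hins
  have hj0 : j 0 = s₀ := hψ0
  have hjt : Filter.Tendsto j (𝓝 0) (𝓝 s₀) := by simpa [ContinuousAt, hj0] using hj
  have h1 : ∀ᶠ y in 𝓝 (0 : K), DifferentiableAt ℝ (γ ∘ j) y ∧ fderiv ℝ (γ ∘ j) y = 0 := by
    have hGd : ∀ᶠ x in 𝓝 s₀, DifferentiableAt ℝ G x :=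
      (hG.eventually (by simp)).mono fun x hx => hx.differentiableAt one_ne_zero
    have hψd : ∀ᶠ z in 𝓝 (G s₀, (0 : K)), DifferentiableAt ℝ ψ z :=
      (hψ.eventually (by simp)).mono fun x hx => hx.differentiableAt one_ne_zero
    filter_upwards [hjt.eventually hγ, hjt.eventually hker, hjt.eventually hGd,
      hins.eventually hψd, (hins.eventually hGψ).eventually_nhds] with y h1 h2 h3 h4 h5
    have hjd : DifferentiableAt ℝ j y :=
      DifferentiableAt.comp (g := ψ) y h4 (by fun_prop)
    refine ⟨h1.comp y hjd, ?_⟩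
    have hconst : fderiv ℝ (G ∘ j) y = 0 := by
      have : G ∘ j =ᶠ[𝓝 y] fun _ => G s₀ := h5
      rw [this.fderiv_eq]; simp
    rw [fderiv_comp y h3 hjd] at hconst
    rw [fderiv_comp y h1 hjd]
    ext Y
    exact h2 h5.self_of_nhds _ (by simpa using congrArg (fun T => T Y) hconst)
  obtain ⟨ε, hε, hball⟩ := Metric.eventually_nhds_iff_ball.1 h1
  have hκt : ∀ᶠ x in 𝓝 s₀, κ x ∈ Metric.ball (0 : K) ε := by
    refine hκ.eventually ?_
    rw [hκ0]; exact Metric.ball_mem_nhds _ hε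
  filter_upwards [hκt, hψG] with x hx1 hx2 hGx
  have := Metric.isOpen_ball.is_const_of_fderiv_eq_zero
    (convex_ball (0 : K) ε).isPreconnected
    (fun y hy => (hball y hy).1.differentiableWithinAt) (fun y hy => (hball y hy).2) hx1
    (Metric.mem_ball_self hε)
  simp only [Function.comp, j, hψ0] at this
  rwa [← hGx, hx2] at this

/-- A `C¹` function that vanishes on a level set of a submersion `G` is bounded by a multiple of
the distance of `G` to the level. -/
theorem exists_norm_le_of_vanishing {G : E → F} {s₀ : E} (hG : ContDiffAt ℝ 1 G s₀)
    (hsurj : Function.Surjective (fderiv ℝ G s₀)) {H : Type*} [NormedAddCommGroup H]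
    [NormedSpace ℝ H] {f : E → H} (hf : ContDiffAt ℝ 1 f s₀)
    (hvan : ∀ᶠ x in 𝓝 s₀, G x = G s₀ → f x = 0) :
    ∃ C : ℝ, ∀ᶠ x in 𝓝 s₀, ‖f x‖ ≤ C * ‖G x - G s₀‖ := by
  obtain ⟨K, ψ, κ, hψ, hκ, hκ0, hψ0, hGψ, hψG⟩ := exists_straightening hG hsurj
  have hfψ : ContDiffAt ℝ 1 (f ∘ ψ) (G s₀, (0 : K)) :=
    ContDiffAt.comp (g := f) _ (by rwa [hψ0]) hψ
  obtain ⟨C, t, ht, hC⟩ := hfψ.exists_lipschitzOnWith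
  have hψt : Filter.Tendsto ψ (𝓝 (G s₀, (0 : K))) (𝓝 s₀) := by
    simpa [ContinuousAt, hψ0] using hψ.continuousAt
  have hl1 : Filter.Tendsto (fun x => (G x, κ x)) (𝓝 s₀) (𝓝 (G s₀, (0 : K))) := by
    rw [← hκ0]; exact hG.continuousAt.prodMk hκ
  have hl2 : Filter.Tendsto (fun x => (G s₀, κ x)) (𝓝 s₀) (𝓝 (G s₀, (0 : K))) := by
    rw [← hκ0]; exact continuousAt_const.prodMk hκ
  refine ⟨C, ?_⟩
  filter_upwards [hl1.eventually ht, hl2.eventually ht, hψG, hl2.eventually hGψ,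
    (hψt.comp hl2).eventually hvan] with x h1 h2 h3 h4 h5
  -- In straightened coordinates, `x` is compared with the point on the level set having the same
  -- kernel coordinate `κ x`; `f` vanishes there.
  have h6 := hC.dist_le_mul _ h1 _ h2
  have h7 : f (ψ (G s₀, κ x)) = 0 := h5 h4
  simp only [Function.comp_apply, h3, h7, dist_zero_right] at h6
  refine h6.trans (mul_le_mul_of_nonneg_left ?_ C.2)
  rw [Prod.dist_eq, dist_self, dist_eq_norm]
  simp

end Analysis

/-! ### Maps of constant rank and generalized inverses. -/

section ConstantRank

variable {E F : Type*} [NormedAddCommGroup E] [NormedSpace ℝ E]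
  [NormedAddCommGroup F] [NormedSpace ℝ F]

/-- Surjective linear maps onto a finite-dimensional space form an open set. -/
theorem eventually_surjective [FiniteDimensional ℝ F] {A : E →L[ℝ] F} (hA : Function.Surjective A) :
    ∀ᶠ B : E →L[ℝ] F in 𝓝 A, Function.Surjective B := by
  obtain ⟨S, hS⟩ := (A : E →ₗ[ℝ] F).exists_rightInverse_of_surjective (LinearMap.range_eq_top.2 hA)
  -- `A ∘ S'` is the identity, so `B ∘ S'` is invertible for `B` near `A`, which makes `B`
  -- surjective.
  let S' : F →L[ℝ] E := LinearMap.toContinuousLinearMap S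
  have hAS : A.comp S' = ContinuousLinearMap.id ℝ F := by
    ext y; exact congrArg (fun T => T y) hS
  have hc : Filter.Tendsto (fun B : E →L[ℝ] F => B.comp S') (𝓝 A)
      (𝓝 ((ContinuousLinearEquiv.refl ℝ F : F ≃L[ℝ] F) : F →L[ℝ] F)) := by
    have : ContinuousAt (fun B : E →L[ℝ] F => B.comp S') A := by fun_prop
    rw [ContinuousAt, hAS] at this
    exact this
  filter_upwards [hc.eventually (ContinuousLinearEquiv.nhds _)] with B hB y
  obtain ⟨e, he⟩ := hB
  obtain ⟨z, hz⟩ := e.surjective y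
  exact ⟨S' z, by rw [← hz]; exact (congrArg (fun T => T z) he).symm⟩

/-- A function whose differential vanishes on the kernel of the differential of a map of constant
rank is locally constant on the fibres of this map. -/
theorem eventually_eq_of_constant_rank [FiniteDimensional ℝ E] {f : E → F} {U : Set E} (hU : IsOpen U)
    (hf : ContDiffOn ℝ 1 f U) {d : ℕ}
    (hd : ∀ x ∈ U, Module.finrank ℝ (fderiv ℝ f x).ker = d) {g : E → ℝ}
    (hg : DifferentiableOn ℝ g U)
    (hk : ∀ x ∈ U, ∀ Y, fderiv ℝ f x Y = 0 → fderiv ℝ g x Y = 0) {u : E} (hu : u ∈ U) :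
    ∀ᶠ x in 𝓝 u, f x = f u → g x = g u := by
  obtain ⟨p, hp⟩ :=
    Submodule.ClosedComplemented.of_finiteDimensional (fderiv ℝ f u).range
  have hfu : ∀ x ∈ U, ContDiffAt ℝ 1 f x := fun x hx => hf.contDiffAt (hU.mem_nhds hx)
  -- Projecting to the range of the derivative at `u` turns `f` into a submersion near `u`. Constant
  -- rank ensures that no kernel is gained at nearby points.
  have hG : ContDiffAt ℝ 1 (p ∘ f) u := p.contDiff.contDiffAt.comp u (hfu u hu)
  have hDG : ∀ x ∈ U, fderiv ℝ (p ∘ f) x = p.comp (fderiv ℝ f x) := fun x hx => by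
    rw [fderiv_comp x p.differentiableAt ((hfu x hx).differentiableAt one_ne_zero), p.fderiv]
  have hsurj : Function.Surjective (fderiv ℝ (p ∘ f) u) := by
    rw [hDG u hu]
    rintro ⟨_, y, rfl⟩
    exact ⟨y, hp ⟨_, y, rfl⟩⟩
  have hker : ∀ᶠ x in 𝓝 u, (p ∘ f) x = (p ∘ f) u →
      ∀ Y, fderiv ℝ (p ∘ f) x Y = 0 → fderiv ℝ g x Y = 0 := by
    have hc : ContinuousAt (fderiv ℝ (p ∘ f)) u :=
      (hG.fderiv_right (m := 0) (by simp)).continuousAt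
    filter_upwards [hU.mem_nhds hu, hc.eventually (eventually_surjective hsurj)] with x hx hs _ Y hY
    apply hk x hx
    have hle : (fderiv ℝ f x).ker ≤ (fderiv ℝ (p ∘ f) x).ker := by
      intro Z hZ
      rw [hDG x hx]
      have : fderiv ℝ f x Z = 0 := hZ
      simp [this]
    have h1 := (fderiv ℝ (p ∘ f) x).toLinearMap.finrank_range_add_finrank_ker
    have h2 := (fderiv ℝ f u : E →ₗ[ℝ] F).finrank_range_add_finrank_ker
    rw [LinearMap.range_eq_top.2 hs, finrank_top] at h1
    have h3 := hd x hx
    have h4 := hd u hu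
    have heq := Submodule.eq_of_le_of_finrank_eq hle (by
      change Module.finrank ℝ (fderiv ℝ f x : E →ₗ[ℝ] F).ker = _ at h3
      change Module.finrank ℝ (fderiv ℝ f u : E →ₗ[ℝ] F).ker = _ at h4
      omega)
    have : Y ∈ (fderiv ℝ f x).ker := by rw [heq]; exact hY
    exact this
  filter_upwards [eventually_eq_of_ker_le hG hsurj
    ((hU.eventually_mem hu).mono fun x hx => hg.differentiableAt (hU.mem_nhds hx)) hker] with x hx h
  exact hx (by simp [h])

/-- An endomorphism becomes injective after adding a map whose rank is the dimension of the
kernel. -/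
theorem exists_injective_add [FiniteDimensional ℝ F] (A : F →L[ℝ] F) :
    ∃ K : F →L[ℝ] F, Function.Injective (A + K) ∧
      Module.finrank ℝ K.range = Module.finrank ℝ A.ker := by
  obtain ⟨p, hp⟩ := (A : F →ₗ[ℝ] F).ker.subtype.exists_leftInverse_of_injective (by simp)
  obtain ⟨C, hC⟩ := Submodule.exists_isCompl (A : F →ₗ[ℝ] F).range
  have hdim : Module.finrank ℝ (A : F →ₗ[ℝ] F).ker = Module.finrank ℝ C := by
    have h1 := (A : F →ₗ[ℝ] F).finrank_range_add_finrank_ker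
    have h2 := Submodule.finrank_add_eq_of_isCompl hC
    omega
  -- `K` carries the kernel of `A` isomorphically to a complement of the range of `A`, so `A x + K x
  -- = 0` forces both terms to vanish.
  let e := LinearEquiv.ofFinrankEq _ _ hdim
  let K : F →ₗ[ℝ] F := C.subtype ∘ₗ (e : _ →ₗ[ℝ] C) ∘ₗ p
  have hp' : ∀ x : (A : F →ₗ[ℝ] F).ker, p x = x := fun x => congrArg (fun T => T x) hp
  refine ⟨LinearMap.toContinuousLinearMap K, (injective_iff_map_eq_zero _).2 fun x hx => ?_, ?_⟩
  · have hx' : A x + (e (p x) : F) = 0 := hx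
    have h0 : A x = 0 := by
      have hm : A x ∈ (A : F →ₗ[ℝ] F).range ⊓ C :=
        ⟨⟨x, rfl⟩, by rw [eq_neg_of_add_eq_zero_left hx']; exact C.neg_mem (e (p x)).2⟩
      rw [hC.inf_eq_bot] at hm
      simpa using hm
    rw [h0, zero_add] at hx'
    have h1 : p x = 0 := by simpa using hx'
    have h2 := hp' ⟨x, h0⟩
    rw [h1] at h2
    exact (congrArg Subtype.val h2).symm
  · change Module.finrank ℝ K.range = Module.finrank ℝ (A : F →ₗ[ℝ] F).ker
    have hps : Function.Surjective p := fun x => ⟨x, hp' x⟩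
    have : K.range = C := by
      rw [LinearMap.range_comp_of_range_eq_top, Submodule.range_subtype]
      rw [LinearMap.range_eq_top]
      exact e.surjective.comp hps
    rw [this, hdim]

/-- If `K` has the rank `dim ker A`, then the inverse of `A + K` maps the range of `K` to the kernel
of `A`. -/
theorem apply_inverse_apply_eq_zero [FiniteDimensional ℝ F] {A K : F →L[ℝ] F} (hinv : (A + K).IsInvertible)
    (hK : Module.finrank ℝ K.range = Module.finrank ℝ A.ker) (z : F) :
    A ((A + K).inverse (K z)) = 0 := by
  -- Injectivity of `A + K` makes `K` injective on the kernel of `A`. By dimension it is then onto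
  -- the range of `K`, so `K z = K n = (A + K) n` for some `n` in this kernel.
  let k : A.ker →ₗ[ℝ] K.range :=
    (K : F →ₗ[ℝ] F).rangeRestrict ∘ₗ A.ker.subtype
  have hk : Function.Injective k := (injective_iff_map_eq_zero _).2 fun x hx => by
    have h1 : K x = 0 := congrArg Subtype.val hx
    have h2 : A x = 0 := x.2
    have h3 : (A + K) x = 0 := by simp [h1, h2]
    exact Subtype.ext (hinv.injective (by simpa using h3))
  obtain ⟨n, hn⟩ := (LinearMap.injective_iff_surjective_of_finrank_eq_finrank hK.symm).1 hk
    ⟨K z, z, rfl⟩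
  have hn' : K n = K z := congrArg Subtype.val hn
  have h2 : A n = 0 := n.2
  have : (A + K) n = K z := by simp [h2, hn']
  rw [← this, hinv.inverse_apply_self, h2]

/-- If `K` has the rank `dim ker A`, then the inverse of `A + K` is a generalized inverse
of `A`. -/
theorem apply_inverse_apply_self [FiniteDimensional ℝ F] {A K : F →L[ℝ] F} (hinv : (A + K).IsInvertible)
    (hK : Module.finrank ℝ K.range = Module.finrank ℝ A.ker) (y : F) :
    A ((A + K).inverse (A y)) = A y := by
  have h1 := apply_inverse_apply_eq_zero hinv hK y
  have h2 : A y = (A + K) y - K y := by simp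
  conv_lhs => rw [h2, map_sub, hinv.inverse_apply_self, map_sub, h1, sub_zero]

end ConstantRank

/-! ### Invariance of constraint sets under flows. -/

section Invariance

variable {E : Type*} [NormedAddCommGroup E] [NormedSpace ℝ E]

/-- Linearly independent linear forms define a surjective map. -/
theorem surjective_pi_of_linearIndependent {κ : Type*} [Fintype κ] {a : κ → E →L[ℝ] ℝ}
    (ha : LinearIndependent ℝ a) :
    Function.Surjective (ContinuousLinearMap.pi a) := by
  classical
  change Function.Surjective (ContinuousLinearMap.pi a).toLinearMap
  rw [← LinearMap.dualMap_injective_iff]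
  refine (injective_iff_map_eq_zero _).2 fun c hc => ?_
  have hsum : ∑ j, c (Pi.single j 1) • a j = 0 := by
    ext x
    have h1 : c (fun j => a j x) = 0 := congrArg (fun T => T x) hc
    rw [pi_eq_sum_univ' (fun j => a j x), map_sum] at h1
    simpa [mul_comm] using h1
  refine LinearMap.pi_ext' fun j => LinearMap.ext_ring ?_
  simpa using Fintype.linearIndependent_iff.1 ha _ hsum j

/-- A function with `‖f'‖ ≤ C ‖f‖` near a zero vanishes near this zero. -/
theorem eventually_eq_zero_of_norm_deriv_le {f f' : ℝ → E} {t₀ C : ℝ} (h0 : f t₀ = 0)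
    (hf : ∀ᶠ t in 𝓝 t₀, HasDerivAt f (f' t) t ∧ ‖f' t‖ ≤ C * ‖f t‖) : ∀ᶠ t in 𝓝 t₀, f t = 0 := by
  obtain ⟨ε, hε, hb⟩ := Metric.eventually_nhds_iff_ball.1 hf
  -- The sign `σ` runs the one-sided Gronwall estimate both forward and backward in time.
  have key : ∀ σ : ℝ, |σ| = 1 → ∀ s ∈ Set.Icc 0 (ε / 2), f (t₀ + σ * s) = 0 := by
    intro σ hσ
    have hmem : ∀ s ∈ Set.Icc 0 (ε / 2), t₀ + σ * s ∈ Metric.ball t₀ ε := by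
      intro s hs
      rw [Metric.mem_ball, Real.dist_eq, add_sub_cancel_left, abs_mul, hσ, one_mul,
        abs_of_nonneg hs.1]
      linarith [hs.2]
    have hd : ∀ s ∈ Set.Icc 0 (ε / 2), HasDerivAt (fun s => f (t₀ + σ * s))
        (σ • f' (t₀ + σ * s)) s := by
      intro s hs
      have h1 : HasDerivAt (fun s => t₀ + σ * s) σ s := by
        simpa using ((hasDerivAt_id s).const_mul σ).const_add t₀
      exact HasDerivAt.scomp s (hb _ (hmem s hs)).1 h1
    refine eq_zero_of_abs_deriv_le_mul_abs_self_of_eq_zero_right (K := C)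
      (f' := fun s => σ • f' (t₀ + σ * s))
      (fun s hs => (hd s hs).continuousAt.continuousWithinAt)
      (fun s hs => (hd s ⟨hs.1, hs.2.le⟩).hasDerivWithinAt) (by simp [h0]) fun s hs => ?_
    rw [norm_smul, Real.norm_eq_abs, hσ, one_mul]
    exact (hb _ (hmem s ⟨hs.1, hs.2.le⟩)).2
  filter_upwards [Metric.ball_mem_nhds t₀ (half_pos hε)] with t ht
  rw [Metric.mem_ball, Real.dist_eq] at ht
  rcases le_total t₀ t with h | h
  · have := key 1 (by simp) (t - t₀) ⟨by linarith, by linarith [le_abs_self (t - t₀)]⟩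
    simpa using this
  · have := key (-1) (by simp) (t₀ - t) ⟨by linarith, by linarith [neg_abs_le (t - t₀)]⟩
    simpa using this

/-- Let `g i` be constraint functions, those with index in `ι₀` having linearly independent
differentials, and suppose that the rank of all differentials is locally constant on the zero set
of the latter. An integral curve of a smooth field that annihilates all constraints on their common
zero set stays there. -/
theorem integralCurve_mem_of_tangent [FiniteDimensional ℝ E] {ι : Type*} [Finite ι] {W : Set E}
    (hW : IsOpen W) {g : ι → E → ℝ} (hg : ∀ i, ContDiffOn ℝ ∞ (g i) W) {Y : E → E}
    (hY : ContDiffOn ℝ ∞ Y W) (ι₀ : Set ι)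
    (hind : ∀ s ∈ W, (∀ i, g i s = 0) → LinearIndepOn ℝ (fun i => fderiv ℝ (g i) s) ι₀)
    (hrank : ∀ s ∈ W, (∀ i, g i s = 0) → ∀ᶠ x in 𝓝 s, (∀ i ∈ ι₀, g i x = 0) →
      Module.finrank ℝ (Submodule.span ℝ (Set.range fun i => fderiv ℝ (g i) x)) =
        Module.finrank ℝ (Submodule.span ℝ (Set.range fun i => fderiv ℝ (g i) s)))
    (htan : ∀ s ∈ W, (∀ i, g i s = 0) → ∀ i, fderiv ℝ (g i) s (Y s) = 0)
    {a b : ℝ} {x : ℝ → E} (hx : ∀ t ∈ Set.Ioo a b, x t ∈ W ∧ HasDerivAt x (Y (x t)) t)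
    (h0 : ∃ t ∈ Set.Ioo a b, ∀ i, g i (x t) = 0) :
    ∀ t ∈ Set.Ioo a b, ∀ i, g i (x t) = 0 := by
  classical
  have hι : Fintype ι := Fintype.ofFinite ι
  have hgd : ∀ i, ∀ s ∈ W, ContDiffAt ℝ ∞ (g i) s := fun i s hs =>
    (hg i).contDiffAt (hW.mem_nhds hs)
  have hstep : ∀ s ∈ W, (∀ i, g i s = 0) → ∃ (J : Set ι) (C : ℝ), ∀ᶠ y in 𝓝 s,
      ((∀ j ∈ J, g j y = 0) → ∀ i, g i y = 0) ∧
      ‖fun j : J => fderiv ℝ (g j) y (Y y)‖ ≤ C * ‖fun j : J => g j y‖ := by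
    intro s hs hz
    -- `J` is a maximal independent set of constraints at `s`. It must contain `ι₀`, because the
    -- rank is controlled only where the constraints in `ι₀` vanish.
    obtain ⟨J, -, hJ₀, hJspan, hJ⟩ := exists_linearIndepOn_extension (hind s hs hz)
      (Set.subset_univ ι₀)
    let G : E → J → ℝ := fun y j => g j y
    have hGd : ∀ y ∈ W, ContDiffAt ℝ ∞ G y := fun y hy =>
      contDiffAt_pi.2 fun j => hgd j y hy
    have hDG : ∀ y ∈ W, fderiv ℝ G y = ContinuousLinearMap.pi fun j : J => fderiv ℝ (g j) y :=
      fun y hy => fderiv_pi fun j => (hgd j y hy).differentiableAt (by simp)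
    have hG1 : ContDiffAt ℝ 1 G s := (hGd s hs).of_le (by simp)
    have hG0 : G s = 0 := funext fun j => hz j
    have hsurj : Function.Surjective (fderiv ℝ G s) := by
      rw [hDG s hs]; exact surjective_pi_of_linearIndependent hJ
    have hcard : Module.finrank ℝ (Submodule.span ℝ (Set.range fun i => fderiv ℝ (g i) s)) =
        Fintype.card J := by
      have h1 : Submodule.span ℝ (Set.range fun i => fderiv ℝ (g i) s) =
          Submodule.span ℝ (Set.range fun j : J => fderiv ℝ (g j) s) := by
        apply le_antisymm
        · rw [Submodule.span_le]
          rintro _ ⟨i, rfl⟩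
          have := hJspan ⟨i, Set.mem_univ i, rfl⟩
          rwa [Set.image_eq_range] at this
        · exact Submodule.span_mono (by rintro _ ⟨j, rfl⟩; exact ⟨j, rfl⟩)
      rw [h1]
      exact finrank_span_eq_card hJ
    have hJev : ∀ᶠ y in 𝓝 s, LinearIndependent ℝ fun j : J => fderiv ℝ (g j) y := by
      have hc : ContinuousAt (fun y => fun j : J => fderiv ℝ (g j) y) s :=
        continuousAt_pi.2 fun j =>
          ((hgd j s hs).fderiv_right (m := 0) (by simp)).continuousAt
      exact hc.eventually (LinearIndependent.eventually hJ)
    have hker : ∀ i, ∀ᶠ y in 𝓝 s, G y = G s → ∀ Z, fderiv ℝ G y Z = 0 →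
        fderiv ℝ (g i) y Z = 0 := by
      intro i
      filter_upwards [hW.mem_nhds hs, hrank s hs hz, hJev] with y hy h1 h2 h3 Z hZ
      have h4 := h1 fun j hj => by
        have := congrFun (h3.trans hG0) ⟨j, hJ₀ hj⟩
        exact this
      have h5 : Submodule.span ℝ (Set.range fun j : J => fderiv ℝ (g j) y) =
          Submodule.span ℝ (Set.range fun i => fderiv ℝ (g i) y) := by
        apply Submodule.eq_of_le_of_finrank_eq
        · exact Submodule.span_mono (by rintro _ ⟨j, rfl⟩; exact ⟨j, rfl⟩)
        · rw [h4, hcard]; exact finrank_span_eq_card h2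
      have h6 : fderiv ℝ (g i) y ∈ Submodule.span ℝ (Set.range fun j : J => fderiv ℝ (g j) y) := by
        rw [h5]; exact Submodule.subset_span ⟨i, rfl⟩
      rw [hDG y hy] at hZ
      refine Submodule.span_induction (p := fun α _ => α Z = 0) ?_ (by simp) ?_ ?_ h6
      · rintro _ ⟨j, rfl⟩; exact congrFun hZ j
      · intro α β _ _ hα hβ; simp [hα, hβ]
      · intro c α _ hα; simp [hα]
    -- On the zero set of `G` near `s` the differentials indexed by `J` still span all of them, so
    -- the remaining constraints are constant there, with the value zero they have at `s`.
    have hvan : ∀ i, ∀ᶠ y in 𝓝 s, G y = G s → g i y = 0 := by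
      intro i
      have := eventually_eq_of_ker_le hG1 hsurj
        ((hW.eventually_mem hs).mono fun y hy => (hgd i y hy).differentiableAt (by simp)) (hker i)
      simpa [hz i] using this
    have hvan' := Filter.eventually_all.2 hvan
    -- `f` is the rate of change of `G` along `Y`. Tangency makes it vanish on the zero set of `G`,
    -- hence `‖f‖ ≤ C ‖G‖`, which is the input for Gronwall.
    let f : E → J → ℝ := fun y => fderiv ℝ G y (Y y)
    have hf : ContDiffAt ℝ 1 f s :=
      (((hGd s hs).fderiv_right (m := ∞) (by simp)).of_le (by simp)).clm_apply
        ((hY.contDiffAt (hW.mem_nhds hs)).of_le (by simp))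
    obtain ⟨C, hC⟩ := exists_norm_le_of_vanishing hG1 hsurj hf (by
      filter_upwards [hvan', hW.mem_nhds hs] with y h1 hy h2
      have h3 := htan y hy (fun i => h1 i h2)
      ext j
      change fderiv ℝ G y (Y y) j = 0
      rw [hDG y hy]
      exact h3 j)
    refine ⟨J, C, ?_⟩
    filter_upwards [hvan', hC, hW.mem_nhds hs] with y h1 h2 hy
    refine ⟨fun h3 i => h1 i (by rw [hG0]; exact funext fun j => h3 j j.2), ?_⟩
    have h4 : f y = fun j : J => fderiv ℝ (g j) y (Y y) := by
      change fderiv ℝ G y (Y y) = _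
      rw [hDG y hy]; rfl
    rwa [h4, hG0, sub_zero] at h2
  -- The set of good times is open by Gronwall and relatively closed by continuity, so by
  -- connectedness it is the whole interval.
  let T : Set ℝ := {t | t ∈ Set.Ioo a b ∧ ∀ i, g i (x t) = 0}
  have hTo : IsOpen T := by
    rw [isOpen_iff_mem_nhds]
    rintro t ⟨ht, hzt⟩
    obtain ⟨J, C, hJ⟩ := hstep _ (hx t ht).1 hzt
    have hev := (hx t ht).2.continuousAt.eventually hJ
    have hz := eventually_eq_zero_of_norm_deriv_le (f := fun r => fun j : J => g j (x r))
      (f' := fun r => fun j : J => fderiv ℝ (g j) (x r) (Y (x r))) (t₀ := t) (C := C)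
      (funext fun j => hzt j) (by
        filter_upwards [isOpen_Ioo.mem_nhds ht, hev] with r hr h2
        refine ⟨hasDerivAt_pi.2 fun j => ?_, h2.2⟩
        exact ((hgd j _ (hx r hr).1).differentiableAt (by simp)).hasFDerivAt.comp_hasDerivAt r
          (hx r hr).2)
    filter_upwards [isOpen_Ioo.mem_nhds ht, hev, hz] with r hr h2 h3
    exact ⟨hr, h2.1 fun j hj => congrFun h3 ⟨j, hj⟩⟩
  have hsub : Set.Ioo a b ⊆ T := by
    apply isPreconnected_Ioo.subset_of_closure_inter_subset hTo
    · obtain ⟨t, ht, h⟩ := h0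
      exact ⟨t, ht, ht, h⟩
    · rintro t ⟨htT, ht⟩
      refine ⟨ht, fun i => ?_⟩
      have hc : ContinuousAt (fun r => g i (x r)) t :=
        ContinuousAt.comp (g := g i) (hgd i _ (hx t ht).1).continuousAt (hx t ht).2.continuousAt
      have : g i (x t) ∈ closure ((fun r => g i (x r)) '' T) := mem_closure_image hc htT
      have h2 : (fun r => g i (x r)) '' T ⊆ {0} := by
        rintro _ ⟨r, hr, rfl⟩; exact hr.2 i
      simpa using closure_mono h2 this
  exact fun t ht => (hsub ht).2

end Invariance

/-! ### Coordinates on the canonical phase space -/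

section Canonical

variable {D : ℕ}

theorem fderiv_apply_eq_sum (h : Phase D → ℝ) (x Y : Phase D) :
    fderiv ℝ h x Y = ∑ a, Y.1 a * dFst h a x + ∑ a, Y.2 a * dSnd h a x := by
  have h1 : Y = ∑ a, Y.1 a • ((Pi.single a 1, 0) : Phase D) +
      ∑ a, Y.2 a • ((0, Pi.single a 1) : Phase D) := by
    refine Prod.ext ?_ ?_
    · simp only [Prod.fst_add, Prod.fst_sum, Prod.smul_fst, smul_zero, Finset.sum_const_zero,
        add_zero]
      exact pi_eq_sum_univ' Y.1
    · simp only [Prod.snd_add, Prod.snd_sum, Prod.smul_snd, smul_zero, Finset.sum_const_zero,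
        zero_add]
      exact pi_eq_sum_univ' Y.2
  conv_lhs => rw [h1]
  simp only [map_add, map_sum, map_smul, smul_eq_mul, dFst, dSnd]

theorem canonicalForm_hamField (h : Phase D → ℝ) (s Y : Phase D) :
    canonicalForm (hamField h s) Y = fderiv ℝ h s Y := by
  rw [fderiv_apply_eq_sum, canonicalForm, ← Finset.sum_add_distrib]
  exact Finset.sum_congr rfl fun a _ => by simp only [hamField]; ring

theorem poisson_eq_fderiv (g h : Phase D → ℝ) (s : Phase D) :
    poisson g h s = fderiv ℝ g s (hamField h s) := by
  rw [fderiv_apply_eq_sum, poisson, ← Finset.sum_add_distrib]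
  exact Finset.sum_congr rfl fun a _ => by simp only [hamField]; ring

theorem poisson_antisymm (g h : Phase D → ℝ) (s : Phase D) :
    poisson g h s = -poisson h g s := by
  simp only [poisson, ← Finset.sum_neg_distrib]
  exact Finset.sum_congr rfl fun a _ => by ring

theorem hamField_zero (s : Phase D) : hamField (fun _ => (0 : ℝ)) s = 0 := by
  refine Prod.ext (funext fun a => ?_) (funext fun a => ?_) <;> simp [hamField, dFst, dSnd]

theorem canonicalForm_antisymm (X Y : Phase D) : canonicalForm X Y = -canonicalForm Y X := by
  simp only [canonicalForm, ← Finset.sum_neg_distrib]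
  exact Finset.sum_congr rfl fun a _ => by ring

theorem canonicalForm_sub (X X' Y : Phase D) :
    canonicalForm (X - X') Y = canonicalForm X Y - canonicalForm X' Y := by
  simp only [canonicalForm, ← Finset.sum_sub_distrib]
  exact Finset.sum_congr rfl fun a _ => by simp; ring

/-- The one-form `i_X ω`. -/
noncomputable def contraction (X : Phase D) : Phase D →L[ℝ] ℝ :=
  LinearMap.toContinuousLinearMap
    { toFun := canonicalForm X
      map_add' := fun Y Z => by
        simp only [canonicalForm, ← Finset.sum_add_distrib]
        exact Finset.sum_congr rfl fun a _ => by simp; ring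
      map_smul' := fun c Y => by
        simp only [canonicalForm, Finset.mul_sum, smul_eq_mul, RingHom.id_apply]
        exact Finset.sum_congr rfl fun a _ => by simp; ring }

@[simp]
theorem contraction_apply (X Y : Phase D) : contraction X Y = canonicalForm X Y := rfl

/-- The canonical form is nondegenerate. -/
theorem eq_of_canonicalForm_eq {X X' : Phase D}
    (h : ∀ Y, canonicalForm X Y = canonicalForm X' Y) : X = X' := by
  refine Prod.ext (funext fun a => ?_) (funext fun a => ?_)
  · simpa [canonicalForm, Pi.single_apply] using h (0, Pi.single a 1)
  · simpa [canonicalForm, Pi.single_apply] using h (Pi.single a 1, 0)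

/-- The Hamiltonian vector at a point depends linearly on the differential at that point and on
nothing else. -/
theorem hamField_eq_of_fderiv_eq {κ : Type*} [Fintype κ] {h k : Phase D → ℝ}
    {φ : κ → Phase D → ℝ} {c : κ → ℝ} {s : Phase D}
    (H : fderiv ℝ h s = fderiv ℝ k s + ∑ m, c m • fderiv ℝ (φ m) s) :
    hamField h s = hamField k s + ∑ m, c m • hamField (φ m) s := by
  refine Prod.ext (funext fun a => ?_) (funext fun a => ?_)
  · simp [hamField, dSnd, H, Prod.fst_sum]
  · simp [hamField, dFst, H, Prod.snd_sum, add_comm]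

/-- The differential of `k + ∑ u^m φ_m` at a common zero of the `φ_m`. -/
theorem fderiv_add_sum_mul {κ : Type*} [Fintype κ] {h k : Phase D → ℝ}
    {u φ : κ → Phase D → ℝ} {W : Set (Phase D)} (hW : IsOpen W) {s : Phase D} (hs : s ∈ W)
    (hh : ∀ x ∈ W, h x = k x + ∑ m, u m x * φ m x) (hk : DifferentiableAt ℝ k s)
    (hu : ∀ m, DifferentiableAt ℝ (u m) s) (hφ : ∀ m, DifferentiableAt ℝ (φ m) s)
    (h0 : ∀ m, φ m s = 0) :
    fderiv ℝ h s = fderiv ℝ k s + ∑ m, u m s • fderiv ℝ (φ m) s := by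
  have h1 : h =ᶠ[𝓝 s] fun x => k x + ∑ m, u m x * φ m x :=
    (hW.eventually_mem hs).mono hh
  rw [h1.fderiv_eq]
  have h2 : HasFDerivAt (fun x => k x + ∑ m, u m x * φ m x)
      (fderiv ℝ k s + ∑ m, (u m s • fderiv ℝ (φ m) s + φ m s • fderiv ℝ (u m) s)) s :=
    hk.hasFDerivAt.add
      (HasFDerivAt.fun_sum fun m _ => (hu m).hasFDerivAt.mul (hφ m).hasFDerivAt)
  rw [h2.fderiv]
  simp [h0]

theorem hamField_add_sum_mul {κ : Type*} [Fintype κ] {h k : Phase D → ℝ}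
    {u φ : κ → Phase D → ℝ} {W : Set (Phase D)} (hW : IsOpen W) {s : Phase D} (hs : s ∈ W)
    (hh : ∀ x ∈ W, h x = k x + ∑ m, u m x * φ m x) (hk : DifferentiableAt ℝ k s)
    (hu : ∀ m, DifferentiableAt ℝ (u m) s) (hφ : ∀ m, DifferentiableAt ℝ (φ m) s)
    (h0 : ∀ m, φ m s = 0) :
    hamField h s = hamField k s + ∑ m, u m s • hamField (φ m) s :=
  hamField_eq_of_fderiv_eq (fderiv_add_sum_mul hW hs hh hk hu hφ h0)

theorem contDiffOn_dFst {f : Phase D → ℝ} {W : Set (Phase D)} (hW : IsOpen W)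
    (hf : ContDiffOn ℝ ∞ f W) (a : Fin D) : ContDiffOn ℝ ∞ (dFst f a) W :=
  (hf.fderiv_of_isOpen hW (m := ∞) (by simp)).clm_apply contDiffOn_const

theorem contDiffOn_dSnd {f : Phase D → ℝ} {W : Set (Phase D)} (hW : IsOpen W)
    (hf : ContDiffOn ℝ ∞ f W) (a : Fin D) : ContDiffOn ℝ ∞ (dSnd f a) W :=
  (hf.fderiv_of_isOpen hW (m := ∞) (by simp)).clm_apply contDiffOn_const

theorem contDiffOn_hamField {f : Phase D → ℝ} {W : Set (Phase D)} (hW : IsOpen W)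
    (hf : ContDiffOn ℝ ∞ f W) : ContDiffOn ℝ ∞ (hamField f) W :=
  (contDiffOn_pi.2 fun a => contDiffOn_dSnd hW hf a).prodMk
    (contDiffOn_pi.2 fun a => (contDiffOn_dFst hW hf a).neg)

theorem contDiffOn_poisson {f g : Phase D → ℝ} {W : Set (Phase D)} (hW : IsOpen W)
    (hf : ContDiffOn ℝ ∞ f W) (hg : ContDiffOn ℝ ∞ g W) : ContDiffOn ℝ ∞ (poisson f g) W := by
  have : poisson f g = fun s => fderiv ℝ f s (hamField g s) :=
    funext fun s => poisson_eq_fderiv f g s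
  rw [this]
  exact (hf.fderiv_of_isOpen hW (m := ∞) (by simp)).clm_apply (contDiffOn_hamField hW hg)

theorem differentiableAt_of_contDiffOn {F : Type*} [NormedAddCommGroup F] [NormedSpace ℝ F]
    {f : Phase D → F} {W : Set (Phase D)} (hW : IsOpen W) (hf : ContDiffOn ℝ ∞ f W) {s : Phase D}
    (hs : s ∈ W) : DifferentiableAt ℝ f s :=
  (hf.contDiffAt (hW.mem_nhds hs)).differentiableAt (by simp)

end Canonical

/-! ### The fibre derivative -/

section FibreDerivative

variable {D : ℕ} {L : Phase D → ℝ} {U : Set (Phase D)}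

theorem contDiffOn_legendre (hU : IsOpen U) (hL : ContDiffOn ℝ ∞ L U) :
    ContDiffOn ℝ ∞ (legendre L) U :=
  contDiffOn_fst.prodMk (contDiffOn_pi.2 fun a => contDiffOn_dSnd hU hL a)

theorem fderiv_legendre (hU : IsOpen U) (hL : ContDiffOn ℝ ∞ L U) {u : Phase D} (hu : u ∈ U)
    (Y : Phase D) : fderiv ℝ (legendre L) u Y = (Y.1, fun a => fderiv ℝ (dSnd L a) u Y) := by
  have h : HasFDerivAt (legendre L) ((ContinuousLinearMap.fst ℝ (Fin D → ℝ) (Fin D → ℝ)).prod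
      (ContinuousLinearMap.pi fun a => fderiv ℝ (dSnd L a) u)) u :=
    hasFDerivAt_fst.prodMk (hasFDerivAt_pi.2 fun a =>
      (differentiableAt_of_contDiffOn hU (contDiffOn_dSnd hU hL a) hu).hasFDerivAt)
  rw [h.fderiv]
  rfl

theorem fderiv_comp_legendre (hU : IsOpen U) (hL : ContDiffOn ℝ ∞ L U) {u : Phase D} (hu : u ∈ U)
    {g h : Phase D → ℝ} (hg : ∀ x ∈ U, h (legendre L x) = g x)
    (hh : DifferentiableAt ℝ h (legendre L u)) (Y : Phase D) :
    fderiv ℝ g u Y = fderiv ℝ h (legendre L u) (fderiv ℝ (legendre L) u Y) := by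
  have h1 : g =ᶠ[𝓝 u] h ∘ legendre L := (hU.eventually_mem hu).mono fun x hx => (hg x hx).symm
  rw [h1.fderiv_eq, fderiv_comp u hh
    (differentiableAt_of_contDiffOn hU (contDiffOn_legendre hU hL) hu)]
  rfl

theorem dSnd_dSnd_comm (hU : IsOpen U) (hL : ContDiffOn ℝ ∞ L U) {u : Phase D} (hu : u ∈ U)
    (a b : Fin D) : dSnd (dSnd L b) a u = dSnd (dSnd L a) b u := by
  have hd : DifferentiableAt ℝ (fderiv ℝ L) u :=
    differentiableAt_of_contDiffOn hU (hL.fderiv_of_isOpen hU (m := ∞) (by simp)) hu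
  have key : ∀ a b, dSnd (dSnd L b) a u =
      fderiv ℝ (fderiv ℝ L) u (0, Pi.single a 1) (0, Pi.single b 1) := by
    intro a b
    have h1 : HasFDerivAt (dSnd L b)
        ((fderiv ℝ (fderiv ℝ L) u).flip ((0, Pi.single b 1) : Phase D)) u := by
      have := hd.hasFDerivAt.clm_apply (hasFDerivAt_const ((0, Pi.single b 1) : Phase D) u)
      simp only [ContinuousLinearMap.comp_zero, zero_add] at this
      exact this
    rw [dSnd, h1.fderiv]
    rfl
  rw [key, key]
  exact ((hL.contDiffAt (hU.mem_nhds hu)).isSymmSndFDerivAt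
    (by rw [minSmoothness_of_isRCLikeNormedField]; exact WithTop.coe_le_coe.2 le_top)).eq _ _

theorem fderiv_dSnd_apply (hU : IsOpen U) (hL : ContDiffOn ℝ ∞ L U) {u : Phase D} (hu : u ∈ U)
    (a : Fin D) (Y : Phase D) : fderiv ℝ (dSnd L a) u Y =
      ∑ b, Y.1 b * dFst (dSnd L a) b u + ∑ b, hessian L u a b * Y.2 b := by
  rw [fderiv_apply_eq_sum]
  congr 1
  refine Finset.sum_congr rfl fun b _ => ?_
  rw [hessian, Matrix.of_apply, dSnd_dSnd_comm hU hL hu, mul_comm]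

/-- The Lagrange two-form is the pull-back of the canonical form by the fibre derivative. -/
theorem lagrangeForm_eq (hU : IsOpen U) (hL : ContDiffOn ℝ ∞ L U) {u : Phase D} (hu : u ∈ U)
    (X Y : Phase D) : lagrangeForm L u X Y =
      canonicalForm (fderiv ℝ (legendre L) u X) (fderiv ℝ (legendre L) u Y) := by
  simp only [fderiv_legendre hU hL hu, canonicalForm, lagrangeForm, fderiv_dSnd_apply hU hL hu,
    curvature, Matrix.of_apply, sub_mul, mul_add, mul_sub, Finset.sum_add_distrib,
    Finset.sum_sub_distrib, Finset.mul_sum]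
  -- Exchanging the two indices matches the second half of the curvature with the terms of $\omega$
  -- in which `X` is differentiated into $p$.
  have h1 : ∑ a, ∑ b, dFst (dSnd L b) a u * (X.1 a * Y.1 b) =
      ∑ a, ∑ b, Y.1 a * (X.1 b * dFst (dSnd L a) b u) := by
    rw [Finset.sum_comm]
    exact Finset.sum_congr rfl fun a _ => Finset.sum_congr rfl fun b _ => by ring
  have h2 : ∑ a, ∑ b, dFst (dSnd L a) b u * (X.1 a * Y.1 b) =
      ∑ a, ∑ b, X.1 a * (Y.1 b * dFst (dSnd L a) b u) :=
    Finset.sum_congr rfl fun a _ => Finset.sum_congr rfl fun b _ => by ring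
  have h3 : ∑ a, ∑ b, hessian L u a b * (X.1 a * Y.2 b) =
      ∑ a, ∑ b, X.1 a * (hessian L u a b * Y.2 b) :=
    Finset.sum_congr rfl fun a _ => Finset.sum_congr rfl fun b _ => by ring
  have h4 : ∑ a, ∑ b, hessian L u a b * (Y.1 a * X.2 b) =
      ∑ a, ∑ b, Y.1 a * (hessian L u a b * X.2 b) :=
    Finset.sum_congr rfl fun a _ => Finset.sum_congr rfl fun b _ => by ring
  rw [h1, h2, h3, h4]
  ring

/-- The Hessian as an endomorphism: the vertical part of the tangent map of the fibre
derivative. -/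
noncomputable def vertHessian (L : Phase D → ℝ) (u : Phase D) :
    (Fin D → ℝ) →L[ℝ] (Fin D → ℝ) :=
  (ContinuousLinearMap.snd ℝ (Fin D → ℝ) (Fin D → ℝ)).comp
    ((fderiv ℝ (legendre L) u).comp (ContinuousLinearMap.inr ℝ (Fin D → ℝ) (Fin D → ℝ)))

theorem contDiffOn_vertHessian (hU : IsOpen U) (hL : ContDiffOn ℝ ∞ L U) :
    ContDiffOn ℝ ∞ (vertHessian L) U :=
  contDiffOn_const.clm_comp
    (((contDiffOn_legendre hU hL).fderiv_of_isOpen hU (m := ∞) (by simp)).clm_comp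
      contDiffOn_const)

theorem vertHessian_apply (hU : IsOpen U) (hL : ContDiffOn ℝ ∞ L U) {u : Phase D} (hu : u ∈ U)
    (z : Fin D → ℝ) : vertHessian L u z = (hessian L u).mulVec z := by
  ext a
  simp [vertHessian, fderiv_legendre hU hL hu, fderiv_dSnd_apply hU hL hu, Matrix.mulVec,
    dotProduct]

theorem fderiv_legendre_vert (hU : IsOpen U) (hL : ContDiffOn ℝ ∞ L U) {u : Phase D} (hu : u ∈ U)
    (z : Fin D → ℝ) : fderiv ℝ (legendre L) u (0, z) = (0, vertHessian L u z) := by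
  refine Prod.ext ?_ rfl
  rw [fderiv_legendre hU hL hu]

/-- The fibre derivative leaves $q$ fixed, so a vector in the kernel of its tangent map has no
horizontal part; on vertical vectors the tangent map is the Hessian. -/
theorem mem_vertKernel_iff (hU : IsOpen U) (hL : ContDiffOn ℝ ∞ L U) {u : Phase D} (hu : u ∈ U)
    (G : Phase D) : G ∈ vertKernel L u ↔ fderiv ℝ (legendre L) u G = 0 := by
  constructor
  · rintro ⟨h1, h2⟩
    have : G = (0, G.2) := Prod.ext h1 rfl
    rw [this, fderiv_legendre_vert hU hL hu, vertHessian_apply hU hL hu, h2]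
    rfl
  · intro h
    have h1 : G.1 = 0 := by
      rw [fderiv_legendre hU hL hu] at h
      exact (Prod.ext_iff.1 h).1
    have h3 : G = (0, G.2) := Prod.ext h1 rfl
    refine ⟨h1, ?_⟩
    rw [h3, fderiv_legendre_vert hU hL hu, vertHessian_apply hU hL hu] at h
    exact (Prod.ext_iff.1 h).2

variable {N₀ : ℕ}

theorem AlmostRegular.finrank_ker_vertHessian (hL : AlmostRegular L U N₀) {u : Phase D}
    (hu : u ∈ U) : Module.finrank ℝ (vertHessian L u).ker = N₀ := by
  have h1 : (vertHessian L u).toLinearMap = (hessian L u).mulVecLin :=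
    LinearMap.ext fun z => vertHessian_apply hL.isOpen hL.smooth hu z
  have h2 := (hessian L u).mulVecLin.finrank_range_add_finrank_ker
  have h3 := hL.hessian_rank u hu
  rw [Matrix.rank] at h3
  rw [h1]
  simp only [Module.finrank_fintype_fun_eq_card, Fintype.card_fin] at h2
  omega

/-- This turns constant rank of the Hessian into constant rank of the fibre derivative, as needed
for `eventually_eq_of_constant_rank`. -/
theorem AlmostRegular.finrank_ker_fderiv_legendre (hL : AlmostRegular L U N₀) {u : Phase D}
    (hu : u ∈ U) : Module.finrank ℝ (fderiv ℝ (legendre L) u).ker = N₀ := by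
  rw [← hL.finrank_ker_vertHessian hu]
  have h : (fderiv ℝ (legendre L) u).toLinearMap.ker =
      (vertHessian L u).toLinearMap.ker.map (LinearMap.inr ℝ (Fin D → ℝ) (Fin D → ℝ)) := by
    ext Y
    constructor
    · intro hY
      have hY0 : fderiv ℝ (legendre L) u Y = 0 := hY
      have h1 := (mem_vertKernel_iff hL.isOpen hL.smooth hu Y).2 hY0
      refine ⟨Y.2, ?_, Prod.ext h1.1.symm rfl⟩
      exact (vertHessian_apply hL.isOpen hL.smooth hu _).trans h1.2
    · rintro ⟨z, hz, rfl⟩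
      have hz0 : vertHessian L u z = 0 := hz
      change fderiv ℝ (legendre L) u (0, z) = 0
      rw [fderiv_legendre_vert hL.isOpen hL.smooth hu, hz0]
      rfl
  rw [h]
  exact (Submodule.equivMapOfInjective _ LinearMap.inr_injective _).finrank_eq.symm

/-- In vertical directions the terms $(\partial L/\partial v^a)\,dv^a$ cancel between the two
summands of $E$, leaving $v^a\,d(\partial L/\partial v^a)$. -/
theorem fderiv_energy_apply (hU : IsOpen U) (hL : ContDiffOn ℝ ∞ L U) {u : Phase D} (hu : u ∈ U)
    (z : Fin D → ℝ) : fderiv ℝ (energy L) u (0, z) = ∑ a, u.2 a * vertHessian L u z a := by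
  have hL' := differentiableAt_of_contDiffOn hU hL hu
  have h : HasFDerivAt (energy L) (∑ a, (u.2 a • fderiv ℝ (dSnd L a) u +
      dSnd L a u • (ContinuousLinearMap.proj a).comp
        (ContinuousLinearMap.snd ℝ (Fin D → ℝ) (Fin D → ℝ))) - fderiv ℝ L u) u := by
    refine HasFDerivAt.sub (HasFDerivAt.fun_sum fun a _ => HasFDerivAt.mul ?_ ?_)
      hL'.hasFDerivAt
    · exact ((ContinuousLinearMap.proj a : (Fin D → ℝ) →L[ℝ] ℝ).comp
        (ContinuousLinearMap.snd ℝ (Fin D → ℝ) (Fin D → ℝ))).hasFDerivAt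
    · exact (differentiableAt_of_contDiffOn hU (contDiffOn_dSnd hU hL a) hu).hasFDerivAt
  have hv : ∀ a, fderiv ℝ (dSnd L a) u (0, z) = vertHessian L u z a := fun a => by
    have := fderiv_legendre_vert hU hL hu z
    rw [fderiv_legendre hU hL hu] at this
    exact congrFun (Prod.ext_iff.1 this).2 a
  rw [h.fderiv]
  simp [hv, Finset.sum_add_distrib, fderiv_apply_eq_sum L, mul_comm]

theorem contDiffOn_energy (hU : IsOpen U) (hL : ContDiffOn ℝ ∞ L U) :
    ContDiffOn ℝ ∞ (energy L) U := by
  refine ContDiffOn.sub (ContDiffOn.sum fun a _ => ContDiffOn.mul ?_ (contDiffOn_dSnd hU hL a)) hL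
  exact (contDiff_apply ℝ ℝ a).comp_contDiffOn contDiffOn_snd

theorem inFbar_energy (hU : IsOpen U) (hL : ContDiffOn ℝ ∞ L U) : InFbar L U (energy L) := by
  refine ⟨contDiffOn_energy hU hL, fun u hu G hG => ?_⟩
  have h : G = (0, G.2) := Prod.ext hG.1 rfl
  rw [h, fderiv_energy_apply hU hL hu, vertHessian_apply hU hL hu, hG.2]
  simp

/-- The first-order constraint function of a field in the kernel of the Lagrange form is the
derivative of the energy. -/
theorem firstOrder_eq_fderiv_energy (hU : IsOpen U) (hL : ContDiffOn ℝ ∞ L U) {u : Phase D}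
    (hu : u ∈ U) {P : Phase D → Phase D} (hP : P u ∈ formKernel L u) :
    firstOrder L P u = fderiv ℝ (energy L) u (P u) := by
  -- Testing the kernel condition on the vector $(v,0)$ gives $F_{ab}P^{qa}v^b=v^aM_{ab}P^{vb}$, and
  -- the right-hand side is the vertical contribution to $P E$.
  have h1 := hP (u.2, 0)
  have h2 : P u = ((P u).1, 0) + (0, (P u).2) := by simp
  have h3 : fderiv ℝ (energy L) u (P u) =
      ∑ a, (P u).1 a * dFst (energy L) a u + ∑ a, u.2 a * vertHessian L u (P u).2 a := by
    conv_lhs => rw [h2, map_add, fderiv_energy_apply hU hL hu, fderiv_apply_eq_sum]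
    simp
  rw [h3, firstOrder]
  simp only [mul_add, Finset.sum_add_distrib, add_right_inj]
  simp only [vertHessian_apply hU hL hu, Matrix.mulVec, dotProduct, Finset.mul_sum]
  simp only [lagrangeForm, Pi.zero_apply, mul_zero, zero_sub, mul_neg, Finset.sum_neg_distrib]
    at h1
  rw [← sub_eq_add_neg, sub_eq_zero] at h1
  calc _ = ∑ a, ∑ b, curvature L u a b * ((P u).1 a * u.2 b) :=
        Finset.sum_congr rfl fun a _ => Finset.sum_congr rfl fun b _ => by ring
    _ = _ := h1
    _ = _ := Finset.sum_congr rfl fun a _ => Finset.sum_congr rfl fun b _ => by ring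

end FibreDerivative

/-! ### Generalized inverses of the Hessian, and fields with values in $\mathcal G$. -/

section Regularizer

variable {D N₀ : ℕ} {L : Phase D → ℝ} {U : Set (Phase D)}

theorem isInvertible_of_injective {A : (Fin D → ℝ) →L[ℝ] (Fin D → ℝ)}
    (hA : Function.Injective A) : A.IsInvertible :=
  ⟨(LinearEquiv.ofInjectiveEndo (A : (Fin D → ℝ) →ₗ[ℝ] (Fin D → ℝ)) hA).toContinuousLinearEquiv,
    by ext x; rfl⟩

/-- Near every point, the Hessian becomes smoothly invertible after adding a constant map whose rank
is the dimension of the kernel of the Hessian. -/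
theorem AlmostRegular.exists_regularizer (hL : AlmostRegular L U N₀) {u₀ : Phase D}
    (hu₀ : u₀ ∈ U) : ∃ (K : (Fin D → ℝ) →L[ℝ] (Fin D → ℝ)) (V : Set (Phase D)), IsOpen V ∧
      u₀ ∈ V ∧ V ⊆ U ∧ (∀ u ∈ V, (vertHessian L u + K).IsInvertible) ∧
      (∀ u ∈ V, Module.finrank ℝ K.range = Module.finrank ℝ (vertHessian L u).ker) ∧
      ContDiffOn ℝ ∞ (fun u => (vertHessian L u + K).inverse) V := by
  obtain ⟨K, hinj, hK⟩ := exists_injective_add (vertHessian L u₀)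
  have hsm : ContDiffOn ℝ ∞ (fun u => vertHessian L u + K) U :=
    (contDiffOn_vertHessian hL.isOpen hL.smooth).add contDiffOn_const
  have hat : ∀ u ∈ U, ContDiffAt ℝ ∞ (fun u => vertHessian L u + K) u := fun u hu =>
    hsm.contDiffAt (hL.isOpen.mem_nhds hu)
  obtain ⟨e, he⟩ := isInvertible_of_injective hinj
  have hnear : ∀ᶠ u in 𝓝 u₀, u ∈ U ∧ (vertHessian L u + K).IsInvertible := by
    refine (hL.isOpen.eventually_mem hu₀).and ?_
    have hc := (hat u₀ hu₀).continuousAt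
    rw [ContinuousAt, ← he] at hc
    exact hc.eventually e.nhds
  obtain ⟨V, hVsub, hV, hu₀V⟩ := eventually_nhds_iff.1 hnear
  refine ⟨K, V, hV, hu₀V, fun u hu => (hVsub u hu).1, fun u hu => (hVsub u hu).2, fun u hu => ?_,
    fun u hu => ?_⟩
  -- `K` is built from the kernel at `u₀` alone; it serves the nearby points because the kernel has
  -- the same dimension there.
  · rw [hK, hL.finrank_ker_vertHessian hu₀, hL.finrank_ker_vertHessian (hVsub u hu).1]
  · exact ((hVsub u hu).2.contDiffAt_map_inverse.comp u
      (hat u (hVsub u hu).1)).contDiffWithinAt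

theorem vertKernel_convex (u : Phase D) : Convex ℝ (vertKernel L u) := by
  rintro x ⟨hx1, hx2⟩ y ⟨hy1, hy2⟩ a b _ _ _
  refine ⟨by simp [hx1, hy1], ?_⟩
  simp [Matrix.mulVec_add, Matrix.mulVec_smul, hx2, hy2]

/-- Every vector in the vertical kernel is the value of a field in it. -/
theorem AlmostRegular.exists_vertField (hL : AlmostRegular L U N₀) {u₀ : Phase D} (hu₀ : u₀ ∈ U)
    {G : Phase D} (hG : G ∈ vertKernel L u₀) : ∃ Z, VertField L U Z ∧ Z u₀ = G := by
  have hU := hL.isOpen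
  -- The prescribed value at `u₀` is part of the convex condition. Near `u₀` the field
  -- $(M+K)^{-1}Kz$ meets it, where $z$ is the vertical part of `G`; away from `u₀` the zero field
  -- suffices.
  obtain ⟨Z, hZ, hZt⟩ := exists_contDiffOn_selection hU
    (fun u => {z : Phase D | z ∈ vertKernel L u ∧ (u = u₀ → z = G)}) (fun u _ => by
      refine (vertKernel_convex u).inter ?_
      intro x hx y hy a b _ _ hab h
      rw [hx h, hy h, ← add_smul, hab, one_smul]) (by
      intro u hu
      by_cases h : u = u₀
      · obtain ⟨K, V, hV, hu₀V, hVU, hinv, hK, hsm⟩ := hL.exists_regularizer hu₀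
        refine ⟨V, h ▸ hV.mem_nhds hu₀V, fun u => (0, (vertHessian L u + K).inverse (K G.2)),
          contDiffOn_const.prodMk (hsm.clm_apply contDiffOn_const), fun y hy _ => ⟨⟨rfl, ?_⟩, ?_⟩⟩
        · rw [← vertHessian_apply hU hL.smooth (hVU hy)]
          exact apply_inverse_apply_eq_zero (hinv y hy) (hK y hy) _
        · rintro rfl
          refine Prod.ext hG.1.symm ?_
          have h1 : vertHessian L y G.2 = 0 := by
            rw [vertHessian_apply hU hL.smooth hu₀]; exact hG.2
          have h2 : (vertHessian L y + K) G.2 = K G.2 := by simp [h1]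
          rw [← h2]
          exact (hinv y hy).inverse_apply_self _
      · refine ⟨{u₀}ᶜ, isOpen_compl_singleton.mem_nhds h, fun _ => 0, contDiffOn_const,
          fun y hy _ => ⟨⟨rfl, by simp⟩, fun h' => absurd h' hy⟩⟩)
  exact ⟨Z, ⟨hZ, fun u hu => (hZt u hu).1⟩, (hZt u₀ hu₀).2 rfl⟩

/-- The bracket of a field with all vertical kernel fields is vertical if and only if the horizontal
components of the field are constant along the vertical kernel. -/
theorem AlmostRegular.bracketVertical_iff (hL : AlmostRegular L U N₀) {X : Phase D → Phase D} :
    BracketVertical L U X ↔ ContDiffOn ℝ ∞ X U ∧ ∀ a, InFbar L U fun u => (X u).1 a := by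
  have hU := hL.isOpen
  refine and_congr_right fun hX => ?_
  have hcomp : ∀ a, ∀ u ∈ U, ∀ Y, fderiv ℝ (fun u => (X u).1 a) u Y = (fderiv ℝ X u Y).1 a := by
    intro a u hu Y
    have h := (differentiableAt_of_contDiffOn hU hX hu).hasFDerivAt
    rw [(hasFDerivAt_pi'.1 h.fst a).fderiv]
    rfl
  have hbr : ∀ G, VertField L U G → ∀ u ∈ U, (VectorField.lieBracket ℝ G X u).1 =
      (fderiv ℝ X u (G u)).1 := by
    intro G hG u hu
    have h1 := (differentiableAt_of_contDiffOn hU hG.1 hu).hasFDerivAt.fst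
    -- The horizontal part of `G` vanishes on a whole neighbourhood, so the term `DG(X)` of the
    -- bracket is vertical and only `DX(G)` matters.
    have h2 : (fun x => (G x).1) =ᶠ[𝓝 u] fun _ => 0 :=
      (hU.eventually_mem hu).mono fun x hx => (hG.2 x hx).1
    have h3 : (fderiv ℝ G u (X u)).1 = 0 := by
      have h4 := h1.fderiv
      rw [h2.fderiv_eq, fderiv_fun_const] at h4
      exact (congrArg (fun T => T (X u)) h4).symm
    rw [VectorField.lieBracket, Prod.fst_sub, h3, sub_zero]
  constructor
  · intro h a
    refine ⟨(contDiff_apply ℝ ℝ a).comp_contDiffOn hX.fst, fun u hu G hG => ?_⟩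
    obtain ⟨Z, hZ, rfl⟩ := hL.exists_vertField hu hG
    rw [hcomp a u hu, ← hbr Z hZ u hu, h Z hZ u hu]
    rfl
  · intro h G hG u hu
    rw [hbr G hG u hu]
    ext a
    rw [← hcomp a u hu]
    exact (h a).2 u hu _ (hG.2 u hu)

end Regularizer

/-! ### Primary constraints -/

section Primary

variable {D N₀ : ℕ} {L : Phase D → ℝ} {U W : Set (Phase D)} {P : Fin N₀ → Phase D → Phase D}
  {γ₀ f : Fin N₀ → Phase D → ℝ}

theorem IsPrimary.legendre_mem (hγ : IsPrimary L U P W γ₀ f) {u : Phase D} (hu : u ∈ U) :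
    legendre L u ∈ W :=
  (hγ.image.subset ⟨u, hu, rfl⟩).1

theorem IsPrimary.apply_legendre (hγ : IsPrimary L U P W γ₀ f) {u : Phase D} (hu : u ∈ U)
    (n : Fin N₀) : γ₀ n (legendre L u) = 0 :=
  (hγ.image.subset ⟨u, hu, rfl⟩).2 n

theorem IsPrimary.exists_eq_legendre (hγ : IsPrimary L U P W γ₀ f) {s : Phase D} (hs : s ∈ W)
    (h : ∀ n, γ₀ n s = 0) : ∃ u ∈ U, legendre L u = s :=
  hγ.image.superset ⟨hs, h⟩

/-- Both vectors have the same contraction with the nondegenerate form $\omega$, by `pfaff`. -/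
theorem IsPrimary.push_eq (hγ : IsPrimary L U P W γ₀ f) {u : Phase D} (hu : u ∈ U) (n : Fin N₀) :
    fderiv ℝ (legendre L) u (P n u) = f n (legendre L u) • hamField (γ₀ n) (legendre L u) := by
  refine eq_of_canonicalForm_eq fun Y => ?_
  rw [hγ.pfaff n u hu, ← canonicalForm_hamField, canonicalForm, canonicalForm, Finset.mul_sum]
  exact Finset.sum_congr rfl fun a _ => by simp; ring

/-- The composite $\gamma^{[0]}_n\circ\mathcal L$ is identically zero on `U`, and so is its
differential. -/
theorem IsPrimary.fderiv_push_eq_zero (hL : AlmostRegular L U N₀) (hγ : IsPrimary L U P W γ₀ f)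
    {u : Phase D} (hu : u ∈ U) (n : Fin N₀) (Y : Phase D) :
    fderiv ℝ (γ₀ n) (legendre L u) (fderiv ℝ (legendre L) u Y) = 0 := by
  rw [← fderiv_comp_legendre hL.isOpen hL.smooth hu (g := fun _ => 0)
    (fun x hx => hγ.apply_legendre hx n)
    (differentiableAt_of_contDiffOn hγ.isOpen (hγ.smooth n) (hγ.legendre_mem hu))]
  simp

/-- If $f_n$ vanished at $\mathcal L(u)$, then $T\mathcal L$ would kill $P_n(u)$, putting it in
$\mathcal G$ against independence modulo $\mathcal G$. -/
theorem IsPrimary.factor_ne_zero (hL : AlmostRegular L U N₀) (hP : IsKernelBasis L U P)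
    (hγ : IsPrimary L U P W γ₀ f) {u : Phase D} (hu : u ∈ U) (n : Fin N₀) :
    f n (legendre L u) ≠ 0 := by
  intro h
  have h1 := hγ.push_eq hu n
  rw [h, zero_smul] at h1
  have h2 := hP.indep u hu (Pi.single n 1) (by
    rw [mem_vertKernel_iff hL.isOpen hL.smooth hu]
    simp [Pi.single_apply, h1])
  simpa using congrFun h2 n

/-- A relation between the $d\gamma^{[0]}_n$, with coefficients divided by the nonzero $f_n$,
becomes a relation between the $P_n$ modulo $\mathcal G$. -/
theorem IsPrimary.linearIndependent (hL : AlmostRegular L U N₀) (hP : IsKernelBasis L U P)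
    (hγ : IsPrimary L U P W γ₀ f) {u : Phase D} (hu : u ∈ U) :
    LinearIndependent ℝ fun n => fderiv ℝ (γ₀ n) (legendre L u) := by
  rw [Fintype.linearIndependent_iff]
  intro c hc n
  have hf := hγ.factor_ne_zero hL hP hu
  have h1 : ∑ n, c n • hamField (γ₀ n) (legendre L u) = 0 := by
    have := hamField_eq_of_fderiv_eq (h := fun _ => 0) (k := fun _ => 0) (φ := γ₀) (c := c)
      (s := legendre L u) (by rw [hc]; simp)
    simpa using this.symm
  have h2 := hP.indep u hu (fun n => c n / f n (legendre L u)) (by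
    rw [mem_vertKernel_iff hL.isOpen hL.smooth hu, map_sum, ← h1]
    refine Finset.sum_congr rfl fun m _ => ?_
    rw [map_smul, hγ.push_eq hu m, smul_smul, div_mul_cancel₀ _ (hf m)])
  have h3 := congrFun h2 n
  simpa [hf n] using h3

/-- The one-forms annihilating the range of the tangent map of the fibre derivative are spanned by
the differentials of the primary constraints. -/
theorem IsPrimary.mem_span_of_comp_eq_zero (hL : AlmostRegular L U N₀) (hP : IsKernelBasis L U P)
    (hγ : IsPrimary L U P W γ₀ f) {u : Phase D} (hu : u ∈ U) {α : Phase D →L[ℝ] ℝ}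
    (hα : ∀ Y, α (fderiv ℝ (legendre L) u Y) = 0) :
    α ∈ Submodule.span ℝ (Set.range fun n => fderiv ℝ (γ₀ n) (legendre L u)) := by
  set T := fderiv ℝ (legendre L) u with hT
  let toD : (Phase D →L[ℝ] ℝ) ≃ₗ[ℝ] Module.Dual ℝ (Phase D) :=
    (LinearMap.toContinuousLinearMap (𝕜 := ℝ) (E := Phase D) (F' := ℝ)).symm
  let S : Submodule ℝ (Module.Dual ℝ (Phase D)) :=
    Submodule.span ℝ (Set.range fun n => toD (fderiv ℝ (γ₀ n) (legendre L u)))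
  have hind : LinearIndependent ℝ fun n => toD (fderiv ℝ (γ₀ n) (legendre L u)) :=
    (hγ.linearIndependent hL hP hu).map' toD.toLinearMap toD.ker
  have hS : Module.finrank ℝ S = N₀ := by
    simpa using finrank_span_eq_card hind
  have hle : S ≤ T.toLinearMap.range.dualAnnihilator := by
    rw [Submodule.span_le]
    rintro _ ⟨n, rfl⟩
    rw [SetLike.mem_coe, Submodule.mem_dualAnnihilator]
    rintro _ ⟨Y, rfl⟩
    exact hγ.fderiv_push_eq_zero hL hu n Y
  -- The range has codimension $N_0$ in a space of dimension $2D$, because domain and codomain have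
  -- equal dimension and the kernel has dimension $N_0$.
  have hfr : Module.finrank ℝ T.toLinearMap.range.dualAnnihilator = N₀ := by
    have h1 := Subspace.finrank_add_finrank_dualAnnihilator_eq T.toLinearMap.range
    have h2 := T.toLinearMap.finrank_range_add_finrank_ker
    have h3 : Module.finrank ℝ T.toLinearMap.ker = N₀ := hL.finrank_ker_fderiv_legendre hu
    omega
  have heq := Submodule.eq_of_le_of_finrank_eq hle (hS.trans hfr.symm)
  have hαS : toD α ∈ S := by
    rw [heq, Submodule.mem_dualAnnihilator]
    rintro _ ⟨Y, rfl⟩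
    exact hα Y
  obtain ⟨c, hc⟩ := (Submodule.mem_span_range_iff_exists_fun ℝ).1 hαS
  refine (Submodule.mem_span_range_iff_exists_fun ℝ).2 ⟨c, toD.injective ?_⟩
  simpa using hc

/-- The vectors annihilated by the differentials of the primary constraints are tangent to the image
of the fibre derivative. -/
theorem IsPrimary.exists_push_eq (hL : AlmostRegular L U N₀) (hP : IsKernelBasis L U P)
    (hγ : IsPrimary L U P W γ₀ f) {u : Phase D} (hu : u ∈ U) {Y : Phase D}
    (hY : ∀ n, fderiv ℝ (γ₀ n) (legendre L u) Y = 0) :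
    ∃ X, fderiv ℝ (legendre L) u X = Y := by
  by_contra h
  have hmem : Y ∉ (fderiv ℝ (legendre L) u).toLinearMap.range := h
  obtain ⟨α, hα, hle⟩ := Submodule.exists_le_ker_of_notMem hmem
  have h1 := hγ.mem_span_of_comp_eq_zero hL hP hu (α := LinearMap.toContinuousLinearMap α)
    fun Z => hle ⟨Z, rfl⟩
  obtain ⟨c, hc⟩ := (Submodule.mem_span_range_iff_exists_fun ℝ).1 h1
  apply hα
  have h2 := congrArg (fun T => T Y) hc
  simp only [sum_apply, smul_apply, hY, smul_zero,
    Finset.sum_const_zero] at h2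
  exact h2.symm

/-- The primary constraints are in involution on the primary constraint submanifold. -/
theorem IsPrimary.poisson_eq_zero (hL : AlmostRegular L U N₀) (hP : IsKernelBasis L U P)
    (hγ : IsPrimary L U P W γ₀ f) {s : Phase D} (hs : s ∈ W) (h : ∀ l, γ₀ l s = 0)
    (n m : Fin N₀) : poisson (γ₀ n) (γ₀ m) s = 0 := by
  obtain ⟨u, hu, rfl⟩ := hγ.exists_eq_legendre hs h
  -- The push-forward of $P_m$ is tangent to the image and equals $f_m\mathfrak X_{\gamma^{[0]}_m}$
  -- with $f_m\ne0$.
  have h1 := hγ.fderiv_push_eq_zero hL hu n (P m u)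
  rw [hγ.push_eq hu m, map_smul, ← poisson_eq_fderiv, smul_eq_mul] at h1
  exact (mul_eq_zero.1 h1).resolve_left (hγ.factor_ne_zero hL hP hu m)

/-- Functions that are constant along the vertical kernel are constant on the fibres of the fibre
derivative. -/
theorem InFbar.eq_of_legendre_eq (hL : AlmostRegular L U N₀) {g : Phase D → ℝ}
    (hg : InFbar L U g) {u u' : Phase D} (hu : u ∈ U) (hu' : u' ∈ U)
    (h : legendre L u' = legendre L u) : g u' = g u := by
  have hcon := (hL.fibre_connected u hu).isPreconnected
  -- `g` is locally constant on the fibre by the constant rank lemma, and the fibre is connected.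
  refine (hcon.induction₂ (fun x y => g x = g y) (fun x hx => ?_) (fun x y z _ _ _ => Eq.trans)
    (fun x y _ _ => Eq.symm) ⟨hu, rfl⟩ ⟨hu', h⟩).symm
  have h1 := eventually_eq_of_constant_rank hL.isOpen
    ((contDiffOn_legendre hL.isOpen hL.smooth).of_le (by simp))
    (fun x hx => hL.finrank_ker_fderiv_legendre hx)
    (fun x hx => (differentiableAt_of_contDiffOn hL.isOpen hg.1 hx).differentiableWithinAt)
    (fun x hx Y hY => hg.2 x hx Y ((mem_vertKernel_iff hL.isOpen hL.smooth hx Y).2 hY)) hx.1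
  filter_upwards [nhdsWithin_le_nhds h1, self_mem_nhdsWithin] with y hy hys
  exact (hy (hys.2.trans hx.2.symm)).symm

/-- Pull-backs of smooth functions by the fibre derivative are constant along the vertical
kernel. -/
theorem IsPrimary.inFbar_of_comp (hL : AlmostRegular L U N₀) (hγ : IsPrimary L U P W γ₀ f)
    {g h : Phase D → ℝ} (hh : ContDiffOn ℝ ∞ h W) (hg : ∀ u ∈ U, h (legendre L u) = g u) :
    InFbar L U g := by
  refine ⟨?_, fun u hu G hG => ?_⟩
  · exact (hh.comp (contDiffOn_legendre hL.isOpen hL.smooth) fun u hu =>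
      hγ.legendre_mem hu).congr fun u hu => (hg u hu).symm
  · rw [fderiv_comp_legendre hL.isOpen hL.smooth hu hg
      (differentiableAt_of_contDiffOn hγ.isOpen hh (hγ.legendre_mem hu)),
      (mem_vertKernel_iff hL.isOpen hL.smooth hu G).1 hG, map_zero]

/-- The image is the zero set of the primary constraints, hence relatively closed in `W`. This makes
room for trivial local choices away from it when gluing. -/
theorem IsPrimary.exists_ne_zero_nhds (hγ : IsPrimary L U P W γ₀ f) {s : Phase D} (hs : s ∈ W)
    (h : ¬∃ u ∈ U, legendre L u = s) :
    ∃ V ∈ 𝓝 s, ∀ y ∈ V, ¬∃ u ∈ U, legendre L u = y := by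
  have h1 : ∃ n, γ₀ n s ≠ 0 := by
    by_contra! h2
    exact h (hγ.exists_eq_legendre hs h2)
  obtain ⟨n, hn⟩ := h1
  have hc : ContinuousAt (γ₀ n) s :=
    (differentiableAt_of_contDiffOn hγ.isOpen (hγ.smooth n) hs).continuousAt
  refine ⟨_, hc.eventually_ne hn, ?_⟩
  rintro _ hy ⟨u, hu, rfl⟩
  exact hy (hγ.apply_legendre hu n)

/-- Near a point of the image `g` is composed with a local section; constancy on fibres makes the
result correct at every nearby image point. Elsewhere zero is allowed. The values are prescribed by
an affine condition, so the pieces glue. -/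
theorem IsPrimary.inFbar_iff (hL : AlmostRegular L U N₀) (hγ : IsPrimary L U P W γ₀ f)
    (g : Phase D → ℝ) : InFbar L U g ↔
      ∃ h : Phase D → ℝ, ContDiffOn ℝ ∞ h W ∧ ∀ u ∈ U, h (legendre L u) = g u := by
  refine ⟨fun hg => ?_, fun ⟨h, hh, hhg⟩ => hγ.inFbar_of_comp hL hh hhg⟩
  obtain ⟨h, hh, ht⟩ := exists_contDiffOn_selection hγ.isOpen
    (fun s => {y : ℝ | ∀ u ∈ U, legendre L u = s → y = g u}) (fun s _ => by
      intro x hx y hy a b _ _ hab u hu hus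
      rw [hx u hu hus, hy u hu hus, ← add_smul, hab, one_smul]) (by
      intro s hs
      by_cases hsu : ∃ u ∈ U, legendre L u = s
      · obtain ⟨u, hu, rfl⟩ := hsu
        obtain ⟨V, hV, huV, σ, hσ, hσU, -, hσL⟩ := hL.submersive u hu
        refine ⟨V, hV.mem_nhds huV, g ∘ σ, hg.1.comp hσ hσU, ?_⟩
        rintro _ hy _ u' hu' rfl
        exact hg.eq_of_legendre_eq hL hu' (hσU hy) (hσL _ ⟨hy, u', hu', rfl⟩)
      · obtain ⟨V, hV, hVU⟩ := hγ.exists_ne_zero_nhds hs hsu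
        exact ⟨V, hV, fun _ => 0, contDiffOn_const, fun y hy _ u hu huy =>
          absurd ⟨u, hu, huy⟩ (hVU y hy)⟩)
  exact ⟨h, hh, fun u hu => ht _ (hγ.legendre_mem hu) u hu rfl⟩

end Primary

/-! ### Total Hamiltonians and second-order Euler-Lagrange vector fields -/

section TotalHamiltonian

variable {D N₀ : ℕ} {L : Phase D → ℝ} {U W : Set (Phase D)} {P : Fin N₀ → Phase D → Phase D}
  {γ₀ f : Fin N₀ → Phase D → ℝ} {H : Phase D → ℝ}

theorem IsPrimary.hamField_factor_mul (hγ : IsPrimary L U P W γ₀ f) {u : Phase D} (hu : u ∈ U)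
    (n : Fin N₀) : hamField (fun s => f n s * γ₀ n s) (legendre L u) =
      f n (legendre L u) • hamField (γ₀ n) (legendre L u) := by
  have hW := hγ.legendre_mem hu
  have h := hamField_add_sum_mul (κ := Unit) (h := fun s => f n s * γ₀ n s) (k := fun _ => 0)
    (u := fun _ => f n) (φ := fun _ => γ₀ n) hγ.isOpen hW (fun x _ => by simp) (by simp)
    (fun _ => differentiableAt_of_contDiffOn hγ.isOpen (hγ.smooth_factor n) hW)
    (fun _ => differentiableAt_of_contDiffOn hγ.isOpen (hγ.smooth n) hW)
    (fun _ => hγ.apply_legendre hu n)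
  rw [h, hamField_zero]
  simp

/-- Total Hamiltonians are canonical Hamiltonians themselves, so every statement proved for an
arbitrary canonical Hamiltonian applies to them at once. -/
theorem IsPrimary.isCanonicalHam_totalHam (hγ : IsPrimary L U P W γ₀ f)
    (hH : IsCanonicalHam L U W H) {w : Fin N₀ → Phase D → ℝ}
    (hw : ∀ m, ContDiffOn ℝ ∞ (w m) W) : IsCanonicalHam L U W (totalHam H γ₀ f w) := by
  refine ⟨hH.1.add (ContDiffOn.sum fun m _ =>
    (hw m).mul ((hγ.smooth_factor m).mul (hγ.smooth m))), fun u hu => ?_⟩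
  simp [totalHam, hγ.apply_legendre hu, hH.2 u hu]

theorem IsPrimary.hamField_totalHam (hγ : IsPrimary L U P W γ₀ f)
    (hH : IsCanonicalHam L U W H) {w : Fin N₀ → Phase D → ℝ}
    (hw : ∀ m, ContDiffOn ℝ ∞ (w m) W) {u : Phase D} (hu : u ∈ U) :
    hamField (totalHam H γ₀ f w) (legendre L u) = hamField H (legendre L u) +
      ∑ m, w m (legendre L u) • f m (legendre L u) • hamField (γ₀ m) (legendre L u) := by
  have hW := hγ.legendre_mem hu
  rw [hamField_add_sum_mul (h := totalHam H γ₀ f w) (φ := fun m s => f m s * γ₀ m s) hγ.isOpen hW (fun x _ => rfl)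
    (differentiableAt_of_contDiffOn hγ.isOpen hH.1 hW)
    (fun m => differentiableAt_of_contDiffOn hγ.isOpen (hw m) hW)
    (fun m => differentiableAt_of_contDiffOn hγ.isOpen ((hγ.smooth_factor m).mul (hγ.smooth m)) hW)
    (fun m => by simp [hγ.apply_legendre hu m])]
  simp only [hγ.hamField_factor_mul hu]

/-- The time derivatives of the primary constraints are the first-order Lagrangian constraints. -/
theorem IsPrimary.factor_mul_poisson (hL : AlmostRegular L U N₀) (hP : IsKernelBasis L U P)
    (hγ : IsPrimary L U P W γ₀ f) (hH : IsCanonicalHam L U W H) {u : Phase D} (hu : u ∈ U)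
    (n : Fin N₀) : f n (legendre L u) * poisson (γ₀ n) H (legendre L u) =
      -firstOrder L (P n) u := by
  rw [firstOrder_eq_fderiv_energy hL.isOpen hL.smooth hu (hP.mem_kernel n u hu),
    fderiv_comp_legendre hL.isOpen hL.smooth hu hH.2
      (differentiableAt_of_contDiffOn hγ.isOpen hH.1 (hγ.legendre_mem hu)),
    hγ.push_eq hu, map_smul, ← poisson_eq_fderiv, poisson_antisymm, smul_eq_mul, mul_neg]

theorem IsPrimary.inFbar_firstOrder (hL : AlmostRegular L U N₀) (hP : IsKernelBasis L U P)
    (hγ : IsPrimary L U P W γ₀ f) (hH : IsCanonicalHam L U W H) (n : Fin N₀) :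
    InFbar L U (firstOrder L (P n)) :=
  hγ.inFbar_of_comp hL (h := fun s => -(f n s * poisson (γ₀ n) H s))
    ((hγ.smooth_factor n).mul (contDiffOn_poisson hγ.isOpen (hγ.smooth n) hH.1)).neg
    fun u hu => by rw [hγ.factor_mul_poisson hL hP hH hu, neg_neg]

/-- Over the first-order surface $\mathfrak X_H$ is therefore tangent to the image and can be
lifted. -/
theorem IsPrimary.poisson_eq_zero_of_mem_firstSurface (hL : AlmostRegular L U N₀)
    (hP : IsKernelBasis L U P) (hγ : IsPrimary L U P W γ₀ f) (hH : IsCanonicalHam L U W H)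
    {u : Phase D} (hu : u ∈ firstSurface L U P) (n : Fin N₀) :
    poisson (γ₀ n) H (legendre L u) = 0 := by
  have h := hγ.factor_mul_poisson hL hP hH hu.1 n
  rw [hu.2 n, neg_zero] at h
  exact (mul_eq_zero.1 h).resolve_left (hγ.factor_ne_zero hL hP hu.1 n)

/-- A field that projects to a Hamiltonian vector field solves the energy equation. -/
theorem IsPrimary.lagrangeForm_eq_of_projectsTo (hL : AlmostRegular L U N₀)
    (hγ : IsPrimary L U P W γ₀ f) (hH : IsCanonicalHam L U W H) {A : Set (Phase D)} (hA : A ⊆ U)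
    {X : Phase D → Phase D} (hX : ProjectsTo L A X H) {u : Phase D} (hu : u ∈ A) (Y : Phase D) :
    lagrangeForm L u (X u) Y = fderiv ℝ (energy L) u Y := by
  rw [lagrangeForm_eq hL.isOpen hL.smooth (hA hu), hX u hu, canonicalForm_hamField,
    fderiv_comp_legendre hL.isOpen hL.smooth (hA hu) hH.2
      (differentiableAt_of_contDiffOn hγ.isOpen hH.1 (hγ.legendre_mem (hA hu)))]

/-- For every Hamiltonian there is a second-order Euler-Lagrange field that projects to it. -/
theorem IsPrimary.exists_isSOELVF (hL : AlmostRegular L U N₀)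
    (hP : IsKernelBasis L U P) (hγ : IsPrimary L U P W γ₀ f) (hH : IsCanonicalHam L U W H) :
    ∃ X, IsSOELVF L U P X ∧ ProjectsTo L (firstSurface L U P) X H := by
  have hU := hL.isOpen
  have hLs := contDiffOn_legendre hU hL.smooth
  let Y : Phase D → Phase D := fun u => hamField H (legendre L u)
  have hY : ContDiffOn ℝ ∞ Y U := (contDiffOn_hamField hγ.isOpen hH.1).comp hLs
    fun u hu => hγ.legendre_mem hu
  -- The horizontal part of the lift is forced to be that of $\mathfrak X_H$. The vertical part `z`
  -- solves an affine equation, imposed only on the first-order surface, where it is solvable.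
  obtain ⟨z, hz, hzt⟩ := exists_contDiffOn_selection hU
    (fun u => {z : Fin D → ℝ | u ∈ firstSurface L U P →
      fderiv ℝ (legendre L) u ((Y u).1, z) = Y u}) (fun u _ => by
      intro x hx y hy a b _ _ hab hu
      have h1 : (((Y u).1, a • x + b • y) : Phase D) = a • ((Y u).1, x) + b • ((Y u).1, y) := by
        refine Prod.ext ?_ rfl
        change _ = a • (Y u).1 + b • (Y u).1
        rw [← add_smul, hab, one_smul]
      rw [h1, map_add, map_smul, map_smul, hx hu, hy hu, ← add_smul, hab, one_smul]) (by
      intro u₀ hu₀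
      obtain ⟨K, V, hV, hu₀V, hVU, hinv, hK, hsm⟩ := hL.exists_regularizer hu₀
      -- The formula is smooth on all of `V`. Where the right-hand side lies in the range of the
      -- Hessian, the generalized inverse gives an actual solution.
      refine ⟨V, hV.mem_nhds hu₀V, fun u => (vertHessian L u + K).inverse
        ((Y u).2 - (fderiv ℝ (legendre L) u ((Y u).1, 0)).2), hsm.clm_apply ?_, ?_⟩
      · refine (hY.snd.mono hVU).sub (ContDiffOn.snd (ContDiffOn.clm_apply ?_ ?_))
        · exact (hLs.fderiv_of_isOpen hU (m := ∞) (by simp)).mono hVU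
        · exact (hY.fst.mono hVU).prodMk contDiffOn_const
      · intro u huV hu hus
        obtain ⟨Z, hZ⟩ := hγ.exists_push_eq hL hP hu (Y := Y u) fun n => by
          rw [← poisson_eq_fderiv]
          exact hγ.poisson_eq_zero_of_mem_firstSurface hL hP hH hus n
        have hZ1 : Z.1 = (Y u).1 := by
          rw [← hZ, fderiv_legendre hU hL.smooth hu]
        have hsplit : ∀ y : Fin D → ℝ, fderiv ℝ (legendre L) u ((Y u).1, y) =
            fderiv ℝ (legendre L) u ((Y u).1, 0) + (0, vertHessian L u y) := fun y => by
          rw [← fderiv_legendre_vert hU hL.smooth hu, ← map_add]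
          simp
        have hZ2 : Y u = fderiv ℝ (legendre L) u ((Y u).1, 0) + (0, vertHessian L u Z.2) := by
          rw [← hsplit, ← hZ1]; exact hZ.symm
        have hr : (Y u).2 - (fderiv ℝ (legendre L) u ((Y u).1, 0)).2 = vertHessian L u Z.2 := by
          conv_lhs => rw [hZ2]
          have h3 : (fderiv ℝ (legendre L) u ((Y u).1, 0) + (0, vertHessian L u Z.2)).1 =
            (Y u).1 := by rw [← hZ2]
          rw [h3, Prod.snd_add, add_sub_cancel_left]
        beta_reduce
        rw [hr, hsplit, apply_inverse_apply_self (hinv u huV) (hK u huV), ← hZ2])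
  have hXs : ContDiffOn ℝ ∞ (fun u => (((Y u).1, z u) : Phase D)) U := hY.fst.prodMk hz
  have hproj : ProjectsTo L (firstSurface L U P) (fun u => ((Y u).1, z u)) H :=
    fun u hu => hzt u hu.1 hu
  refine ⟨_, ⟨hL.bracketVertical_iff.2 ⟨hXs, fun a => ?_⟩, fun u hu Z =>
    hγ.lagrangeForm_eq_of_projectsTo hL hH (fun u hu => hu.1) hproj hu Z⟩, hproj⟩
  exact hγ.inFbar_of_comp hL (contDiffOn_dSnd hγ.isOpen hH.1 a) fun u hu => rfl

/-- A vertical vector in $\ker\Omega_L$ lies in $\mathcal G$: pairing it with the horizontal basis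
vectors gives the entries of $Mz$ up to sign. Hence the horizontal parts of the $P_n$ are already
independent. -/
theorem IsKernelBasis.eq_zero_of_horizontal (hL : AlmostRegular L U N₀)
    (hP : IsKernelBasis L U P) {u : Phase D} (hu : u ∈ U) {c : Fin N₀ → ℝ}
    (hc : (∑ n, c n • P n u).1 = 0) : c = 0 := by
  have hU := hL.isOpen
  apply hP.indep u hu
  set K := ∑ n, c n • P n u with hKdef
  have hker : ∀ Y, canonicalForm (fderiv ℝ (legendre L) u K) (fderiv ℝ (legendre L) u Y) = 0 := by
    intro Y
    have h1 : ∀ n, canonicalForm (fderiv ℝ (legendre L) u Y) (fderiv ℝ (legendre L) u (P n u)) =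
        0 := fun n => by
      have h := hP.mem_kernel n u hu Y
      rw [lagrangeForm_eq hU hL.smooth hu] at h
      rw [canonicalForm_antisymm, h, neg_zero]
    rw [canonicalForm_antisymm, hKdef, map_sum, ← contraction_apply, map_sum]
    simp [h1]
  have hK : K = (0, K.2) := Prod.ext hc rfl
  refine ⟨hc, ?_⟩
  rw [← vertHessian_apply hU hL.smooth hu]
  ext a
  have h3 := hker (Pi.single a 1, 0)
  rw [hK, fderiv_legendre_vert hU hL.smooth hu] at h3
  simpa [canonicalForm, fderiv_legendre hU hL.smooth hu, Pi.single_apply] using h3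

/-- The components of a linear combination of independent smooth vectors are determined smoothly by
the combination. -/
theorem exists_local_coefficients {E : Type*} [NormedAddCommGroup E] [NormedSpace ℝ E]
    {W : Set E} (hW : IsOpen W) {p : Fin N₀ → E → Fin D → ℝ}
    (hp : ∀ m, ContDiffOn ℝ ∞ (p m) W) {y : E → Fin D → ℝ} (hy : ContDiffOn ℝ ∞ y W)
    {s₀ : E} (hs₀ : s₀ ∈ W) (hind : ∀ c : Fin N₀ → ℝ, ∑ m, c m • p m s₀ = 0 → c = 0) :
    ∃ V, IsOpen V ∧ s₀ ∈ V ∧ V ⊆ W ∧ ∃ w : E → Fin N₀ → ℝ, ContDiffOn ℝ ∞ w V ∧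
      ∀ s ∈ V, ∀ c : Fin N₀ → ℝ, y s = ∑ m, c m • p m s → w s = c := by
  let B : E → (Fin N₀ → ℝ) →L[ℝ] (Fin D → ℝ) := fun s =>
    ∑ m, (ContinuousLinearMap.proj m : (Fin N₀ → ℝ) →L[ℝ] ℝ).smulRight (p m s)
  have hB : ∀ s c, B s c = ∑ m, c m • p m s := fun s c => by simp [B]
  have hBs : ContDiffOn ℝ ∞ B W := ContDiffOn.sum fun m _ => contDiffOn_const.smulRight (hp m)
  obtain ⟨Q', hQ'⟩ := (B s₀).toLinearMap.exists_leftInverse_of_injective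
    (LinearMap.ker_eq_bot'.2 fun c hc => hind c (by rw [← hB]; exact hc))
  let Q : (Fin D → ℝ) →L[ℝ] (Fin N₀ → ℝ) := LinearMap.toContinuousLinearMap Q'
  have hQB : Q.comp (B s₀) = ContinuousLinearMap.id ℝ _ :=
    ContinuousLinearMap.ext fun c => congrArg (fun T => T c) hQ'
  -- `Q` is a left inverse of `B s₀` only, but `Q ∘ B s` stays invertible nearby. So $(QB)^{-1}Qy$
  -- is smooth and recovers the coefficients wherever they exist.
  have hat : ∀ s ∈ W, ContDiffAt ℝ ∞ (fun s => Q.comp (B s)) s := fun s hs =>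
    (contDiffOn_const.clm_comp hBs).contDiffAt (hW.mem_nhds hs)
  have hnear : ∀ᶠ s in 𝓝 s₀, s ∈ W ∧ (Q.comp (B s)).IsInvertible := by
    refine (hW.eventually_mem hs₀).and ?_
    have hc := (hat s₀ hs₀).continuousAt
    rw [ContinuousAt, hQB] at hc
    exact hc.eventually (ContinuousLinearEquiv.refl ℝ (Fin N₀ → ℝ)).nhds
  obtain ⟨V, hVsub, hV, hs₀V⟩ := eventually_nhds_iff.1 hnear
  refine ⟨V, hV, hs₀V, fun s hs => (hVsub s hs).1, fun s => (Q.comp (B s)).inverse (Q (y s)),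
    ContDiffOn.clm_apply (fun s hs => ?_) ?_, fun s hs c hc => ?_⟩
  · exact ((hVsub s hs).2.contDiffAt_map_inverse.comp s (hat s (hVsub s hs).1)).contDiffWithinAt
  · exact Q.contDiff.comp_contDiffOn (hy.mono fun s hs => (hVsub s hs).1)
  · beta_reduce
    rw [hc, ← hB]
    exact (hVsub s hs).2.inverse_apply_self c

/-- Every second-order Euler-Lagrange field projects to a total Hamiltonian. -/
theorem IsPrimary.exists_projectsTo_totalHam (hL : AlmostRegular L U N₀)
    (hP : IsKernelBasis L U P) (hγ : IsPrimary L U P W γ₀ f) (hH : IsCanonicalHam L U W H)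
    {X : Phase D → Phase D} (hX : IsSOELVF L U P X) :
    ∃ w : Fin N₀ → Phase D → ℝ, (∀ m, ContDiffOn ℝ ∞ (w m) W) ∧
      ProjectsTo L (firstSurface L U P) X (totalHam H γ₀ f w) := by
  have hU := hL.isOpen
  have hW := hγ.isOpen
  have hXF := (hL.bracketVertical_iff.1 hX.1).2
  choose x hx hxX using fun a => (hγ.inFbar_iff hL _).1 (hXF a)
  have hexp : ∀ u ∈ firstSurface L U P, ∃ c : Fin N₀ → ℝ, fderiv ℝ (legendre L) u (X u) =
      hamField H (legendre L u) +
        ∑ m, c m • f m (legendre L u) • hamField (γ₀ m) (legendre L u) := by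
    intro u hu
    -- The energy equation says that the contraction of $\omega$ with $T\mathcal L X-\mathfrak X_H$
    -- annihilates the range of $T\mathcal L$.
    have h1 := hγ.mem_span_of_comp_eq_zero hL hP hu.1
      (α := contraction (fderiv ℝ (legendre L) u (X u) - hamField H (legendre L u))) fun Y => by
        rw [contraction_apply, canonicalForm_sub, canonicalForm_hamField,
          ← lagrangeForm_eq hU hL.smooth hu.1, hX.2 u hu,
          fderiv_comp_legendre hU hL.smooth hu.1 hH.2
            (differentiableAt_of_contDiffOn hW hH.1 (hγ.legendre_mem hu.1)), sub_self]
    obtain ⟨c, hc⟩ := (Submodule.mem_span_range_iff_exists_fun ℝ).1 h1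
    refine ⟨fun m => c m / f m (legendre L u), ?_⟩
    rw [← sub_eq_iff_eq_add']
    refine eq_of_canonicalForm_eq fun Y => ?_
    have h2 : ∑ m, (c m / f m (legendre L u)) • f m (legendre L u) •
        hamField (γ₀ m) (legendre L u) = ∑ m, c m • hamField (γ₀ m) (legendre L u) :=
      Finset.sum_congr rfl fun m _ => by
        rw [smul_smul, div_mul_cancel₀ _ (hγ.factor_ne_zero hL hP hu.1 m)]
    rw [h2]
    -- This is used for the linear function $\sum_m c_m\,d\gamma^{[0]}_m$, which realizes the
    -- covector as the differential of a function.
    have h3 : ∀ (k : Phase D → ℝ), fderiv ℝ k (legendre L u) =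
        ∑ m, c m • fderiv ℝ (γ₀ m) (legendre L u) → hamField k (legendre L u) =
        ∑ m, c m • hamField (γ₀ m) (legendre L u) := fun k hk => by
      have := hamField_eq_of_fderiv_eq (h := k) (k := fun _ => 0) (φ := γ₀) (c := c)
        (s := legendre L u) (by rw [hk]; simp)
      rw [this, hamField_zero, zero_add]
    rw [← contraction_apply, ← hc, ← h3 (fun s => (∑ m, c m • fderiv ℝ (γ₀ m) (legendre L u)) s)
      (ContinuousLinearMap.fderiv _), canonicalForm_hamField, ContinuousLinearMap.fderiv]
  have hpush : ∀ u ∈ U, ∀ c : Fin N₀ → ℝ,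
      ∑ m, c m • f m (legendre L u) • hamField (γ₀ m) (legendre L u) =
        fderiv ℝ (legendre L) u (∑ m, c m • P m u) := fun u hu c => by
    rw [map_sum]
    exact Finset.sum_congr rfl fun m _ => by rw [map_smul, hγ.push_eq hu]
  obtain ⟨w, hw, hwt⟩ := exists_contDiffOn_selection hW
    (fun s => {c : Fin N₀ → ℝ | ∀ u ∈ firstSurface L U P, legendre L u = s →
      fderiv ℝ (legendre L) u (X u) = hamField H s + ∑ m, c m • f m s • hamField (γ₀ m) s})
    (fun s _ => by
      intro c hc d hd a b _ _ hab u hu hus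
      have h1 : ∑ m, (a • c + b • d) m • f m s • hamField (γ₀ m) s =
          a • ∑ m, c m • f m s • hamField (γ₀ m) s + b • ∑ m, d m • f m s • hamField (γ₀ m) s := by
        rw [Finset.smul_sum, Finset.smul_sum, ← Finset.sum_add_distrib]
        exact Finset.sum_congr rfl fun m _ => by
          simp only [Pi.add_apply, Pi.smul_apply, add_smul, smul_assoc]
      have h2 : ∀ z : Phase D, z = a • z + b • z := fun z => by rw [← add_smul, hab, one_smul]
      rw [h1, h2 (fderiv ℝ (legendre L) u (X u)), h2 (hamField H s)]
      nth_rw 1 [hc u hu hus]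
      rw [hd u hu hus]
      simp only [smul_add]
      abel) (by
      intro s hs
      by_cases hsu : ∃ u ∈ U, legendre L u = s
      · obtain ⟨u, hu, rfl⟩ := hsu
        -- Only the horizontal components `x a` of `X` are known to descend to functions on `W`.
        -- They suffice, since the horizontal parts of the $P_m$ are independent.
        obtain ⟨V, hV, huV, hVW, w, hw, hwc⟩ := exists_local_coefficients hW
          (p := fun m s => f m s • (hamField (γ₀ m) s).1)
          (y := fun s => (fun a => x a s) - (hamField H s).1)
          (fun m => (hγ.smooth_factor m).smul (contDiffOn_hamField hW (hγ.smooth m)).fst)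
          ((contDiffOn_pi.2 hx).sub (contDiffOn_hamField hW hH.1).fst) hs (fun c hc => by
            refine hP.eq_zero_of_horizontal hL hu ?_
            have h1 := congrArg Prod.fst (hpush u hu c)
            rw [fderiv_legendre hU hL.smooth hu, Prod.fst_sum] at h1
            exact h1.symm.trans hc)
        refine ⟨V, hV.mem_nhds huV, w, hw, ?_⟩
        rintro _ hy _ u' hu' rfl
        obtain ⟨c, hc⟩ := hexp u' hu'
        rw [hwc _ hy c ?_]
        · exact hc
        · have h1 := congrArg Prod.fst hc
          rw [fderiv_legendre hU hL.smooth hu'.1, Prod.fst_add, Prod.fst_sum] at h1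
          have h2 : (fun a => x a (legendre L u')) = (X u').1 := funext fun a => hxX a u' hu'.1
          rw [h2, sub_eq_iff_eq_add']
          exact h1
      · obtain ⟨V, hV, hVU⟩ := hγ.exists_ne_zero_nhds hs hsu
        exact ⟨V, hV, fun _ => 0, contDiffOn_const, fun y hy _ u hu huy =>
          absurd ⟨u, hu.1, huy⟩ (hVU y hy)⟩)
  have hwm : ∀ m, ContDiffOn ℝ ∞ (fun s => w s m) W := contDiffOn_pi.1 hw
  refine ⟨fun m s => w s m, hwm, fun u hu => ?_⟩
  rw [hγ.hamField_totalHam hH hwm hu.1]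
  exact hwt _ (hγ.legendre_mem hu.1) u hu rfl

/-- If $g=h\circ\mathcal L$ and `X` projects to $\mathfrak X_{H_T}$, then $Xg=\{h,H_T\}\circ\mathcal
L$ along the surface, and the right-hand side is projectable on all of `U`. -/
theorem IsPrimary.exists_inFbar_fderiv (hL : AlmostRegular L U N₀)
    (hP : IsKernelBasis L U P) (hγ : IsPrimary L U P W γ₀ f) (hH : IsCanonicalHam L U W H)
    {X : Phase D → Phase D} (hX : IsSOELVF L U P X) {g : Phase D → ℝ} (hg : InFbar L U g) :
    ∃ g', InFbar L U g' ∧ ∀ u ∈ firstSurface L U P, g' u = fderiv ℝ g u (X u) := by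
  obtain ⟨w, hw, hXw⟩ := hγ.exists_projectsTo_totalHam hL hP hH hX
  obtain ⟨h, hh, hhg⟩ := (hγ.inFbar_iff hL g).1 hg
  have hT := hγ.isCanonicalHam_totalHam hH hw
  refine ⟨fun u => poisson h (totalHam H γ₀ f w) (legendre L u),
    hγ.inFbar_of_comp hL (contDiffOn_poisson hγ.isOpen hh hT.1) fun u _ => rfl, fun u hu => ?_⟩
  rw [fderiv_comp_legendre hL.isOpen hL.smooth hu.1 hhg
    (differentiableAt_of_contDiffOn hγ.isOpen hh (hγ.legendre_mem hu.1)), hXw u hu,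
    ← poisson_eq_fderiv]

end TotalHamiltonian

/-! ### The recursion for the multipliers -/

section Recursion

variable {D : ℕ} {N : ℕ → ℕ} {L : Phase D → ℝ} {U W : Set (Phase D)}
  {P : Fin (N 1) → Phase D → Phase D} {γ₀ f : Fin (N 1) → Phase D → ℝ} {H : Phase D → ℝ}
  {R : LagData D N} {S : HamData D N} {K : ℕ}

/-- The part of a run of the stability analysis that concerns the Hamiltonians and the free
combinations of primary constraints. -/
structure HamData.IsRecursion (S : HamData D N) (W : Set (Phase D))
    (γ₀ f : Fin (N 1) → Phase D → ℝ) (H : Phase D → ℝ) (K : ℕ) : Prop where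
  φ_one : ∀ n, ∀ s ∈ W, S.φ 1 n s = f n s * γ₀ n s
  H_one : ∃ w : Fin (N 1) → Phase D → ℝ, (∀ n, ContDiffOn ℝ ∞ (w n) W) ∧
    ∀ s ∈ W, S.H 1 s = totalHam H γ₀ f w s
  succ : ∀ k, 1 ≤ k → k < K → ∃ (B : Fin (N (k + 1)) → Fin (N k) → Phase D → ℝ)
    (w : Fin (N k) → Phase D → ℝ), (∀ i n, ContDiffOn ℝ ∞ (B i n) W) ∧
    (∀ n, ContDiffOn ℝ ∞ (w n) W) ∧
    (∀ s ∈ W, S.H (k + 1) s = S.H k s + ∑ m, w m s * S.φ k m s) ∧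
    ∀ i, ∀ s ∈ W, S.φ (k + 1) i s = ∑ m, B i m s * S.φ k m s

theorem HamData.IsRun.isRecursion (hS : S.IsRun W γ₀ f H K) : S.IsRecursion W γ₀ f H K := by
  refine ⟨hS.φ_one, hS.H_one, fun k hk hkK => ?_⟩
  obtain ⟨-, A, B, w, -, hB, hw, -, -, hH, hφ⟩ := hS.step k hk hkK
  exact ⟨B, w, hB, hw, hH, hφ⟩

/-- Expressing $\varphi^{[k]}_m$ through the primary constraints gives both its smoothness and its
vanishing on the primary surface. -/
theorem HamData.IsRecursion.φ_eq (hS : S.IsRecursion W γ₀ f H K) {k : ℕ} (hk : 1 ≤ k)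
    (hkK : k ≤ K) : ∃ b : Fin (N k) → Fin (N 1) → Phase D → ℝ,
      (∀ m l, ContDiffOn ℝ ∞ (b m l) W) ∧
      ∀ m, ∀ s ∈ W, S.φ k m s = ∑ l, b m l s * (f l s * γ₀ l s) := by
  induction k, hk using Nat.le_induction with
  | base =>
    refine ⟨fun m l _ => if l = m then 1 else 0, fun m l => contDiffOn_const, fun m s hs => ?_⟩
    rw [hS.φ_one m s hs]
    simp
  | succ k hk ih =>
    obtain ⟨b, hb, hbφ⟩ := ih (by omega)
    obtain ⟨B, w, hB, -, -, hφ⟩ := hS.succ k hk (by omega)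
    refine ⟨fun i l s => ∑ m, B i m s * b m l s, fun i l => ContDiffOn.sum fun m _ =>
      (hB i m).mul (hb m l), fun i s hs => ?_⟩
    rw [hφ i s hs]
    simp only [hbφ _ s hs, Finset.mul_sum, Finset.sum_mul]
    rw [Finset.sum_comm]
    exact Finset.sum_congr rfl fun l _ => Finset.sum_congr rfl fun m _ => by ring

theorem HamData.IsRecursion.φ_smooth (hS : S.IsRecursion W γ₀ f H K)
    (hγ : IsPrimary L U P W γ₀ f) {k : ℕ} (hk : 1 ≤ k) (hkK : k ≤ K) (m : Fin (N k)) :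
    ContDiffOn ℝ ∞ (S.φ k m) W := by
  obtain ⟨b, hb, hbφ⟩ := hS.φ_eq hk hkK
  exact (ContDiffOn.sum fun l _ => (hb m l).mul ((hγ.smooth_factor l).mul (hγ.smooth l))).congr
    (hbφ m)

theorem HamData.IsRecursion.φ_eq_zero (hS : S.IsRecursion W γ₀ f H K) {k : ℕ} (hk : 1 ≤ k)
    (hkK : k ≤ K) (m : Fin (N k)) {s : Phase D} (hs : s ∈ W) (h : ∀ n, γ₀ n s = 0) :
    S.φ k m s = 0 := by
  obtain ⟨b, hb, hbφ⟩ := hS.φ_eq hk hkK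
  simp [hbφ m s hs, h]

/-- The general Hamiltonian of a later stage is one of the Hamiltonians of every earlier stage. -/
theorem HamData.IsRecursion.exists_eq_of_le (hS : S.IsRecursion W γ₀ f H K) {j k : ℕ}
    (hj : 1 ≤ j) (hjk : j ≤ k) (hkK : k ≤ K) (c : Fin (N k) → Phase D → ℝ)
    (hc : ∀ m, ContDiffOn ℝ ∞ (c m) W) :
    ∃ c' : Fin (N j) → Phase D → ℝ, (∀ m, ContDiffOn ℝ ∞ (c' m) W) ∧
      ∀ s ∈ W, S.H k s + ∑ m, c m s * S.φ k m s = S.H j s + ∑ m, c' m s * S.φ j m s := by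
  induction k, hjk using Nat.le_induction with
  | base => exact ⟨c, hc, fun s _ => rfl⟩
  | succ k hk ih =>
    obtain ⟨B, w, hB, hw, hH, hφ⟩ := hS.succ k (by omega) (by omega)
    -- Substituting the recursion turns multipliers `c` at order `k + 1` into multipliers $w+cB$ at
    -- order `k`.
    obtain ⟨c', hc', h⟩ := ih (by omega) (fun m s => w m s + ∑ i, c i s * B i m s) fun m =>
      (hw m).add (ContDiffOn.sum fun i _ => (hc i).mul (hB i m))
    refine ⟨c', hc', fun s hs => ?_⟩
    rw [← h s hs, hH s hs]
    simp only [hφ _ s hs, add_mul, Finset.sum_add_distrib, Finset.mul_sum, Finset.sum_mul,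
      add_assoc]
    congr 2
    rw [Finset.sum_comm]
    exact Finset.sum_congr rfl fun l _ => Finset.sum_congr rfl fun m _ => by ring

/-- The Hamiltonians of all stages are total Hamiltonians. -/
theorem HamData.IsRecursion.exists_eq_totalHam (hS : S.IsRecursion W γ₀ f H K) {k : ℕ}
    (hk : 1 ≤ k) (hkK : k ≤ K) (c : Fin (N k) → Phase D → ℝ)
    (hc : ∀ m, ContDiffOn ℝ ∞ (c m) W) :
    ∃ w : Fin (N 1) → Phase D → ℝ, (∀ m, ContDiffOn ℝ ∞ (w m) W) ∧
      ∀ s ∈ W, S.H k s + ∑ m, c m s * S.φ k m s = totalHam H γ₀ f w s := by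
  obtain ⟨c', hc', h⟩ := hS.exists_eq_of_le le_rfl hk hkK c hc
  obtain ⟨w, hw, hw'⟩ := hS.H_one
  refine ⟨fun m s => w m s + c' m s, fun m => (hw m).add (hc' m), fun s hs => ?_⟩
  rw [h s hs, hw' s hs]
  simp only [totalHam, hS.φ_one _ s hs, add_mul, Finset.sum_add_distrib, add_assoc]

theorem IsCanonicalHam.congr {h : Phase D → ℝ} (hH : IsCanonicalHam L U W H)
    (hγ : IsPrimary L U P W γ₀ f) (h' : ∀ s ∈ W, h s = H s) : IsCanonicalHam L U W h :=
  ⟨hH.1.congr h', fun u hu => by rw [h' _ (hγ.legendre_mem hu), hH.2 u hu]⟩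

theorem HamData.IsRecursion.isCanonicalHam (hS : S.IsRecursion W γ₀ f H K)
    (hγ : IsPrimary L U P W γ₀ f) (hH : IsCanonicalHam L U W H) {k : ℕ}
    (hk : 1 ≤ k) (hkK : k ≤ K) {c : Fin (N k) → Phase D → ℝ}
    (hc : ∀ m, ContDiffOn ℝ ∞ (c m) W) :
    IsCanonicalHam L U W fun s => S.H k s + ∑ m, c m s * S.φ k m s := by
  obtain ⟨w, hw, h⟩ := hS.exists_eq_totalHam hk hkK c hc
  exact (hγ.isCanonicalHam_totalHam hH hw).congr hγ h

theorem HamData.IsRecursion.H_smooth (hS : S.IsRecursion W γ₀ f H K)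
    (hγ : IsPrimary L U P W γ₀ f) (hH : IsCanonicalHam L U W H) {k : ℕ}
    (hk : 1 ≤ k) (hkK : k ≤ K) : ContDiffOn ℝ ∞ (S.H k) W := by
  simpa using (hS.isCanonicalHam hγ hH hk hkK (c := fun _ _ => 0) fun _ => contDiffOn_const).1

/-- At points of the primary constraint submanifold the multipliers need not be differentiated. -/
theorem HamData.IsRecursion.hamField_eq (hS : S.IsRecursion W γ₀ f H K)
    (hγ : IsPrimary L U P W γ₀ f) (hH : IsCanonicalHam L U W H) {k : ℕ}
    (hk : 1 ≤ k) (hkK : k ≤ K) {c : Fin (N k) → Phase D → ℝ}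
    (hc : ∀ m, ContDiffOn ℝ ∞ (c m) W) {h : Phase D → ℝ}
    (hh : ∀ s ∈ W, h s = S.H k s + ∑ m, c m s * S.φ k m s) {s : Phase D} (hs : s ∈ W)
    (h0 : ∀ n, γ₀ n s = 0) :
    hamField h s = hamField (S.H k) s + ∑ m, c m s • hamField (S.φ k m) s :=
  hamField_add_sum_mul hγ.isOpen hs hh
    (differentiableAt_of_contDiffOn hγ.isOpen (hS.H_smooth hγ hH hk hkK) hs)
    (fun m => differentiableAt_of_contDiffOn hγ.isOpen (hc m) hs)
    (fun m => differentiableAt_of_contDiffOn hγ.isOpen (hS.φ_smooth hγ hk hkK m) hs)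
    (fun m => hS.φ_eq_zero hk hkK m hs h0)

theorem HamData.IsRecursion.hamField_φ_eq (hS : S.IsRecursion W γ₀ f H K)
    (hγ : IsPrimary L U P W γ₀ f) {k : ℕ} (hk : 1 ≤ k) (hkK : k ≤ K)
    {c : Fin (N k) → Phase D → ℝ} (hc : ∀ m, ContDiffOn ℝ ∞ (c m) W) {h : Phase D → ℝ}
    (hh : ∀ s ∈ W, h s = ∑ m, c m s * S.φ k m s) {s : Phase D} (hs : s ∈ W)
    (h0 : ∀ n, γ₀ n s = 0) :
    hamField h s = ∑ m, c m s • hamField (S.φ k m) s := by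
  rw [hamField_add_sum_mul (k := fun _ => 0) hγ.isOpen hs
    (fun x hx => by rw [hh x hx, zero_add]) (by simp)
    (fun m => differentiableAt_of_contDiffOn hγ.isOpen (hc m) hs)
    (fun m => differentiableAt_of_contDiffOn hγ.isOpen (hS.φ_smooth hγ hk hkK m) hs)
    (fun m => hS.φ_eq_zero hk hkK m hs h0), hamField_zero, zero_add]

/-- Data of the two algorithms with corresponding multipliers project to each other. -/
theorem HamData.IsRecursion.runProjects (hS : S.IsRecursion W γ₀ f H K)
    (hL : AlmostRegular L U (N 1)) (hγ : IsPrimary L U P W γ₀ f) (hH : IsCanonicalHam L U W H)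
    (hP1 : ∀ n, ∀ u ∈ U, R.P 1 n u = P n u)
    (hγ1 : ∀ n, ∀ u ∈ U, R.γ 1 n u = firstOrder L (P n) u)
    (hX1 : ProjectsTo L (firstSurface L U P) (R.X 1) (S.H 1))
    (hγγ : ∀ k, 1 ≤ k → k ≤ K → ∀ n, ∀ u ∈ U, S.γ k n (legendre L u) = R.γ k n u)
    (hstep : ∀ k, 1 ≤ k → k < K → ∃ (B : Fin (N (k + 1)) → Fin (N k) → Phase D → ℝ)
      (w : Fin (N k) → Phase D → ℝ), (∀ i n, ContDiffOn ℝ ∞ (B i n) W) ∧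
      (∀ n, ContDiffOn ℝ ∞ (w n) W) ∧
      (∀ s ∈ W, S.H (k + 1) s = S.H k s + ∑ m, w m s * S.φ k m s) ∧
      (∀ i, ∀ s ∈ W, S.φ (k + 1) i s = ∑ m, B i m s * S.φ k m s) ∧
      (∀ u ∈ U, R.X (k + 1) u - (R.X k u + ∑ m, w m (legendre L u) • R.P k m u) ∈
        vertKernel L u) ∧
      ∀ i, ∀ u ∈ U, R.P (k + 1) i u - ∑ m, B i m (legendre L u) • R.P k m u ∈ vertKernel L u) :
    RunProjects L U R S K := by
  have hU := hL.isOpen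
  have hsurf : R.surface U 1 ⊆ firstSurface L U P := fun u hu =>
    ⟨hu.1, fun n => by rw [← hγ1 n u hu.1]; exact hu.2 1 le_rfl le_rfl n⟩
  intro k hk hkK
  refine ⟨hγγ k hk hkK, ?_⟩
  induction k, hk using Nat.le_induction with
  | base =>
    refine ⟨fun m u hu => ?_, fun u hu => hX1 u (hsurf hu)⟩
    have h1 := hS.hamField_φ_eq hγ le_rfl hkK (h := S.φ 1 m)
      (c := fun l _ => if l = m then 1 else 0) (fun _ => contDiffOn_const)
      (fun s _ => by simp) (hγ.legendre_mem hu) (hγ.apply_legendre hu)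
    have h2 : S.φ 1 m =ᶠ[𝓝 (legendre L u)] fun s => f m s * γ₀ m s :=
      (hγ.isOpen.eventually_mem (hγ.legendre_mem hu)).mono fun s hs => hS.φ_one m s hs
    have h3 : hamField (S.φ 1 m) (legendre L u) =
        hamField (fun s => f m s * γ₀ m s) (legendre L u) := by
      simp only [hamField, dFst, dSnd, h2.fderiv_eq]
    rw [hP1 m u hu, h3, hγ.hamField_factor_mul hu, hγ.push_eq hu]
  | succ k hk ih =>
    obtain ⟨ihP, ihX⟩ := ih (by omega)
    obtain ⟨B, w, hB, hw, hH', hφ, hX, hPk⟩ := hstep k hk (by omega)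
    constructor
    · intro i u hu
      -- The freedom modulo $\mathcal G$ in the fields is invisible after applying $T\mathcal L$.
      have h1 := (mem_vertKernel_iff hU hL.smooth hu _).1 (hPk i u hu)
      rw [map_sub, sub_eq_zero, map_sum] at h1
      rw [h1, hS.hamField_φ_eq hγ hk (by omega) (hB i) (hφ i) (hγ.legendre_mem hu)
        (hγ.apply_legendre hu)]
      exact Finset.sum_congr rfl fun m _ => by rw [map_smul, ihP m u hu]
    · intro u hu
      have h1 := (mem_vertKernel_iff hU hL.smooth hu.1 _).1 (hX u hu.1)
      rw [map_sub, sub_eq_zero, map_add, map_sum] at h1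
      rw [h1, hS.hamField_eq hγ hH hk (by omega) hw hH' (hγ.legendre_mem hu.1)
        (hγ.apply_legendre hu.1), ihX u hu]
      congr 1
      exact Finset.sum_congr rfl fun m _ => by rw [map_smul, ihP m u hu.1]

end Recursion

/-! ### Corresponding objects of runs that project to each other -/

section Correspondence

variable {D : ℕ} {N : ℕ → ℕ} {L : Phase D → ℝ} {U W : Set (Phase D)}
  {P : Fin (N 1) → Phase D → Phase D} {γ₀ f : Fin (N 1) → Phase D → ℝ}
  {R : LagData D N} {S : HamData D N} {K : ℕ}

theorem LagData.surface_anti (R : LagData D N) {j k : ℕ} (h : j ≤ k) :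
    R.surface U k ⊆ R.surface U j :=
  fun _ hu => ⟨hu.1, fun i hi hij => hu.2 i hi (hij.trans h)⟩

theorem HamData.surface_anti (S : HamData D N) {j k : ℕ} (h : j ≤ k) :
    S.surface W γ₀ k ⊆ S.surface W γ₀ j :=
  fun _ hs => ⟨hs.1, hs.2.1, fun i hi hij => hs.2.2 i hi (hij.trans h)⟩

theorem RunProjects.legendre_mem_surface_iff (hRS : RunProjects L U R S K)
    (hγ : IsPrimary L U P W γ₀ f) {k : ℕ} (hkK : k ≤ K) {u : Phase D} (hu : u ∈ U) :
    legendre L u ∈ S.surface W γ₀ k ↔ u ∈ R.surface U k := by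
  have h : ∀ j, 1 ≤ j → j ≤ k → ∀ n, (S.γ j n (legendre L u) = 0 ↔ R.γ j n u = 0) :=
    fun j hj hjk n => by rw [(hRS j hj (hjk.trans hkK)).1 n u hu]
  exact ⟨fun hs => ⟨hu, fun j hj hjk n => (h j hj hjk n).1 (hs.2.2 j hj hjk n)⟩,
    fun hs => ⟨hγ.legendre_mem hu, hγ.apply_legendre hu,
      fun j hj hjk n => (h j hj hjk n).2 (hs.2 j hj hjk n)⟩⟩

theorem RunProjects.exists_of_mem_surface (hRS : RunProjects L U R S K)
    (hγ : IsPrimary L U P W γ₀ f) {k : ℕ} (hkK : k ≤ K) {s : Phase D}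
    (hs : s ∈ S.surface W γ₀ k) : ∃ u ∈ R.surface U k, legendre L u = s := by
  obtain ⟨u, hu, rfl⟩ := hγ.exists_eq_legendre hs.1 hs.2.1
  exact ⟨u, (hRS.legendre_mem_surface_iff hγ hkK hu).1 hs, rfl⟩

theorem RunProjects.image_surface (hRS : RunProjects L U R S K)
    (hγ : IsPrimary L U P W γ₀ f) {k : ℕ} (hkK : k ≤ K) :
    legendre L '' R.surface U k = S.surface W γ₀ k := by
  ext s
  constructor
  · rintro ⟨u, hu, rfl⟩
    exact (hRS.legendre_mem_surface_iff hγ hkK hu.1).2 hu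
  · exact hRS.exists_of_mem_surface hγ hkK

theorem RunProjects.fderiv_γ (hRS : RunProjects L U R S K) (hL : AlmostRegular L U (N 1))
    (hγ : IsPrimary L U P W γ₀ f) {k : ℕ} (hk : 1 ≤ k) (hkK : k ≤ K) {n : Fin (N k)}
    (hS : ContDiffOn ℝ ∞ (S.γ k n) W) {u : Phase D} (hu : u ∈ U) (Y : Phase D) :
    fderiv ℝ (R.γ k n) u Y =
      fderiv ℝ (S.γ k n) (legendre L u) (fderiv ℝ (legendre L) u Y) :=
  fderiv_comp_legendre hL.isOpen hL.smooth hu ((hRS k hk hkK).1 n)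
    (differentiableAt_of_contDiffOn hγ.isOpen hS (hγ.legendre_mem hu)) Y

theorem RunProjects.C_eq (hRS : RunProjects L U R S K) (hL : AlmostRegular L U (N 1))
    (hγ : IsPrimary L U P W γ₀ f) {k : ℕ} (hk : 1 ≤ k) (hkK : k ≤ K)
    (hS : ∀ n, ContDiffOn ℝ ∞ (S.γ k n) W) {u : Phase D} (hu : u ∈ U) :
    S.C k (legendre L u) = R.Γ k u := by
  ext n m
  simp only [HamData.C, LagData.Γ, Matrix.of_apply]
  rw [hRS.fderiv_γ hL hγ hk hkK (hS n) hu, (hRS k hk hkK).2.1 m u hu, poisson_eq_fderiv]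

/-- Unlike the free fields, $X^{[k]}$ projects only along the first-order surface, which is why `u`
is restricted here and not in `RunProjects.C_eq`. -/
theorem RunProjects.poisson_H_eq (hRS : RunProjects L U R S K) (hL : AlmostRegular L U (N 1))
    (hγ : IsPrimary L U P W γ₀ f) {k : ℕ} (hk : 1 ≤ k) (hkK : k ≤ K) {n : Fin (N k)}
    (hS : ContDiffOn ℝ ∞ (S.γ k n) W) {u : Phase D} (hu : u ∈ R.surface U 1) :
    poisson (S.γ k n) (S.H k) (legendre L u) = fderiv ℝ (R.γ k n) u (R.X k u) := by
  rw [hRS.fderiv_γ hL hγ hk hkK hS hu.1, (hRS k hk hkK).2.2 u hu, poisson_eq_fderiv]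

/-- The ranks of corresponding families of constraints differ by the number of primary
constraints. -/
theorem RunProjects.indepRank_eq (hRS : RunProjects L U R S K) (hL : AlmostRegular L U (N 1))
    (hP : IsKernelBasis L U P) (hγ : IsPrimary L U P W γ₀ f)
    (hS : ∀ j, 1 ≤ j → j ≤ K → ∀ n, ContDiffOn ℝ ∞ (S.γ j n) W) {k : ℕ} (hkK : k ≤ K)
    {u : Phase D} (hu : u ∈ U) :
    S.indepRank γ₀ k (legendre L u) = N 1 + R.indepRank k u := by
  let T : (Phase D →L[ℝ] ℝ) →ₗ[ℝ] (Phase D →L[ℝ] ℝ) :=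
    { toFun := fun α => α.comp (fderiv ℝ (legendre L) u)
      map_add' := fun α β => ContinuousLinearMap.add_comp _ _ _
      map_smul' := fun c α => ContinuousLinearMap.smul_comp _ _ _ }
  set AS : Set (Phase D →L[ℝ] ℝ) := {α | (∃ n, α = fderiv ℝ (γ₀ n) (legendre L u)) ∨
    ∃ j, 1 ≤ j ∧ j ≤ k ∧ ∃ n, α = fderiv ℝ (S.γ j n) (legendre L u)} with hAS
  set AR : Set (Phase D →L[ℝ] ℝ) :=
    {α | ∃ j, 1 ≤ j ∧ j ≤ k ∧ ∃ n, α = fderiv ℝ (R.γ j n) u} with hAR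
  have hT0 : ∀ n, T (fderiv ℝ (γ₀ n) (legendre L u)) = 0 := fun n =>
    ContinuousLinearMap.ext fun Y => hγ.fderiv_push_eq_zero hL hu n Y
  have hT1 : ∀ j, 1 ≤ j → j ≤ k → ∀ n, T (fderiv ℝ (S.γ j n) (legendre L u)) =
      fderiv ℝ (R.γ j n) u := fun j hj hjk n =>
    ContinuousLinearMap.ext fun Y =>
      (hRS.fderiv_γ hL hγ hj (hjk.trans hkK) (hS j hj (hjk.trans hkK) n) hu Y).symm
  have hmap : (Submodule.span ℝ AS).map T = Submodule.span ℝ AR := by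
    rw [Submodule.map_span]
    apply le_antisymm
    · rw [Submodule.span_le]
      rintro _ ⟨α, ⟨n, rfl⟩ | ⟨j, hj, hjk, n, rfl⟩, rfl⟩
      · rw [hT0]; exact Submodule.zero_mem _
      · rw [hT1 j hj hjk]; exact Submodule.subset_span ⟨j, hj, hjk, n, rfl⟩
    · refine Submodule.span_mono ?_
      rintro _ ⟨j, hj, hjk, n, rfl⟩
      exact ⟨_, Or.inr ⟨j, hj, hjk, n, rfl⟩, hT1 j hj hjk n⟩
  have hker : T.ker = Submodule.span ℝ (Set.range fun n => fderiv ℝ (γ₀ n) (legendre L u)) := by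
    apply le_antisymm
    · intro α hα
      exact hγ.mem_span_of_comp_eq_zero hL hP hu fun Y => congrArg (fun T => T Y) hα
    · rw [Submodule.span_le]
      rintro _ ⟨n, rfl⟩
      exact hT0 n
  have hkerle : T.ker ≤ Submodule.span ℝ AS := by
    rw [hker]
    refine Submodule.span_mono ?_
    rintro _ ⟨n, rfl⟩
    exact Or.inl ⟨n, rfl⟩
  have hkerrank : Module.finrank ℝ T.ker = N 1 := by
    rw [hker, finrank_span_eq_card (hγ.linearIndependent hL hP hu), Fintype.card_fin]
  -- Rank-nullity for pull-back of covectors, restricted to the span of the Hamiltonian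
  -- differentials: the image is the Lagrangian span, and the kernel is the span of the primary
  -- differentials, of dimension `N 1`.
  have h1 := LinearMap.finrank_range_add_finrank_ker (K := ℝ) (V := Submodule.span ℝ AS)
    (V₂ := Phase D →L[ℝ] ℝ) (T.domRestrict (Submodule.span ℝ AS))
  rw [LinearMap.range_domRestrict, hmap, LinearMap.ker_domRestrict] at h1
  have h2 := (Submodule.comapSubtypeEquivOfLe hkerle).finrank_eq
  have h3 : S.indepRank γ₀ k (legendre L u) = Module.finrank ℝ (Submodule.span ℝ AS) := rfl
  have h4 : R.indepRank k u = Module.finrank ℝ (Submodule.span ℝ AR) := rfl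
  rw [h3, h4, ← h1, ← hkerrank, ← h2, add_comm]

/-- The shift by `N 1` is the same at orders `k` and `k - 1`, so it cancels from the comparison of
ranks. -/
theorem RunProjects.stops_iff (hRS : RunProjects L U R S K) (hL : AlmostRegular L U (N 1))
    (hP : IsKernelBasis L U P) (hγ : IsPrimary L U P W γ₀ f)
    (hS : ∀ j, 1 ≤ j → j ≤ K → ∀ n, ContDiffOn ℝ ∞ (S.γ j n) W) {k : ℕ} (hkK : k ≤ K) :
    R.Stops U k ↔ S.Stops W γ₀ k := by
  refine and_congr_right fun hk => ?_
  rw [← hRS.image_surface hγ hkK, Set.forall_mem_image]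
  refine forall₂_congr fun u hu => ?_
  rw [hRS.indepRank_eq hL hP hγ hS hkK hu.1, hRS.indepRank_eq hL hP hγ hS (by omega) hu.1,
    Nat.add_left_cancel_iff]

end Correspondence

/-! ### Construction of a run of one algorithm from a run of the other. -/

section ExistenceOfRuns

variable {D : ℕ} {N : ℕ → ℕ} {L : Phase D → ℝ} {U W : Set (Phase D)}
  {P : Fin (N 1) → Phase D → Phase D} {γ₀ f : Fin (N 1) → Phase D → ℝ} {H : Phase D → ℝ}
  {R : LagData D N} {S : HamData D N} {K : ℕ}

/-- Iterated linear combinations of a family with coefficient matrices `B k`. -/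
noncomputable def iterComb {E : Type*} [AddCommMonoid E] [Module ℝ E]
    (v : Fin (N 1) → Phase D → E) (B : (k : ℕ) → Fin (N (k + 1)) → Fin (N k) → Phase D → ℝ) :
    (k : ℕ) → Fin (N k) → Phase D → E
  -- Index zero is a dummy; the recursion starts from the given family at order one.
  | 0 => 0
  | 1 => v
  | k + 2 => fun i x => ∑ m, B (k + 1) i m x • iterComb v B (k + 1) m x

/-- Partial sums `x + ∑ w^m v^[k]_m`. -/
noncomputable def iterSum {E : Type*} [AddCommMonoid E] [Module ℝ E] (x : Phase D → E)
    (w : (k : ℕ) → Fin (N k) → Phase D → ℝ) (v : (k : ℕ) → Fin (N k) → Phase D → E) :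
    ℕ → Phase D → E
  | 0 => x
  | 1 => x
  | k + 2 => fun u => iterSum x w v (k + 1) u + ∑ m, w (k + 1) m u • v (k + 1) m u

theorem iterComb_succ {E : Type*} [AddCommMonoid E] [Module ℝ E] (v : Fin (N 1) → Phase D → E)
    (B : (k : ℕ) → Fin (N (k + 1)) → Fin (N k) → Phase D → ℝ) {k : ℕ} (hk : 1 ≤ k)
    (i : Fin (N (k + 1))) (x : Phase D) :
    iterComb v B (k + 1) i x = ∑ m, B k i m x • iterComb v B k m x := by
  obtain ⟨j, rfl⟩ := Nat.exists_eq_add_of_le' hk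
  rfl

theorem iterSum_succ {E : Type*} [AddCommMonoid E] [Module ℝ E] (x : Phase D → E)
    (w : (k : ℕ) → Fin (N k) → Phase D → ℝ) (v : (k : ℕ) → Fin (N k) → Phase D → E)
    {k : ℕ} (hk : 1 ≤ k) (u : Phase D) :
    iterSum x w v (k + 1) u = iterSum x w v k u + ∑ m, w k m u • v k m u := by
  obtain ⟨j, rfl⟩ := Nat.exists_eq_add_of_le' hk
  rfl

/-- The conditions of one step of the two algorithms correspond to each other. -/
theorem RunProjects.step_conditions_iff (hRS : RunProjects L U R S K)
    (hL : AlmostRegular L U (N 1)) (hγ : IsPrimary L U P W γ₀ f) {k : ℕ} (hk : 1 ≤ k)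
    (hkK : k < K) (hS : ∀ n, ContDiffOn ℝ ∞ (S.γ k n) W)
    {A B : Fin (N (k + 1)) → Fin (N k) → Phase D → ℝ} {w : Fin (N k) → Phase D → ℝ} :
    ((∀ s ∈ S.surface W γ₀ k,
      (S.C k s).rank + N (k + 1) = N k ∧
      LinearIndependent ℝ (fun i => fun n => A i n s) ∧
      LinearIndependent ℝ (fun i => fun m => B i m s) ∧
      (∀ i m, ∑ n, A i n s * S.C k s n m = 0) ∧
      (∀ i n, ∑ m, S.C k s n m * B i m s = 0) ∧
      ∀ i, S.γ (k + 1) i s = ∑ n, A i n s * poisson (S.γ k n) (S.H k) s) ∧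
    (∀ s ∈ S.surface W γ₀ (k + 1), ∀ n,
      ∑ m, S.C k s n m * w m s = -poisson (S.γ k n) (S.H k) s)) ↔
    ((∀ u ∈ R.surface U k,
      (R.Γ k u).rank + N (k + 1) = N k ∧
      LinearIndependent ℝ (fun i => fun n => A i n (legendre L u)) ∧
      LinearIndependent ℝ (fun i => fun m => B i m (legendre L u)) ∧
      (∀ i m, ∑ n, A i n (legendre L u) * R.Γ k u n m = 0) ∧
      (∀ i n, ∑ m, R.Γ k u n m * B i m (legendre L u) = 0) ∧
      ∀ i, R.γ (k + 1) i u = ∑ n, A i n (legendre L u) * fderiv ℝ (R.γ k n) u (R.X k u)) ∧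
    (∀ u ∈ R.surface U (k + 1), ∀ n,
      ∑ m, R.Γ k u n m * w m (legendre L u) = -fderiv ℝ (R.γ k n) u (R.X k u))) := by
  -- Each Hamiltonian surface is the image of the Lagrangian one, so its points may be written
  -- $\mathcal L(u)$, where all entries agree.
  rw [← hRS.image_surface hγ hkK.le, ← hRS.image_surface hγ (Nat.succ_le_of_lt hkK),
    Set.forall_mem_image, Set.forall_mem_image]
  refine and_congr (forall₂_congr fun u hu => ?_) (forall₂_congr fun u hu => ?_)
  · simp only [hRS.C_eq hL hγ hk hkK.le hS hu.1,
      hRS.poisson_H_eq hL hγ hk hkK.le (hS _) (R.surface_anti hk hu),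
      (hRS (k + 1) (by omega) hkK).1 _ u hu.1]
  · simp only [hRS.C_eq hL hγ hk hkK.le hS hu.1,
      hRS.poisson_H_eq hL hγ hk hkK.le (hS _) (R.surface_anti (by omega) hu)]

theorem LagData.IsRun.inFbar_γ (hR : R.IsRun L U P K) (hL : AlmostRegular L U (N 1))
    (hP : IsKernelBasis L U P) (hγ : IsPrimary L U P W γ₀ f) (hH : IsCanonicalHam L U W H)
    {k : ℕ} (hk : 1 ≤ k) (hkK : k ≤ K) (n : Fin (N k)) : InFbar L U (R.γ k n) := by
  obtain rfl | hk' := hk.eq_or_lt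
  · obtain ⟨h, hh, hhg⟩ := (hγ.inFbar_iff hL _).1 (hγ.inFbar_firstOrder hL hP hH n)
    exact hγ.inFbar_of_comp hL hh fun u hu => by rw [hhg u hu, hR.γ_one n u hu]
  · obtain ⟨j, rfl⟩ := Nat.exists_eq_add_of_le' hk
    exact (hR.step j (by omega) (by omega)).1 n

/-- Every run of the Lagrangian constraint algorithm projects to a run of the stability analysis. -/
theorem LagData.IsRun.exists_hamRun (hR : R.IsRun L U P K) (hL : AlmostRegular L U (N 1))
    (hP : IsKernelBasis L U P) (hγ : IsPrimary L U P W γ₀ f) (hH : IsCanonicalHam L U W H) :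
    ∃ S : HamData D N, S.IsRun W γ₀ f H K ∧ RunProjects L U R S K := by
  have hlift : ∀ g, InFbar L U g → ∃ h : Phase D → ℝ, ContDiffOn ℝ ∞ h W ∧
      ∀ u ∈ U, h (legendre L u) = g u := fun g => (hγ.inFbar_iff hL g).1
  have hg : ∀ k, ∀ n : Fin (N k), ∃ g : Phase D → ℝ, 1 ≤ k → k ≤ K →
      ContDiffOn ℝ ∞ g W ∧ ∀ u ∈ U, g (legendre L u) = R.γ k n u := by
    intro k n
    -- The families are indexed by all orders, while the run constrains only those up to `K`;
    -- outside this range any value serves.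
    by_cases h : 1 ≤ k ∧ k ≤ K
    · obtain ⟨g, hg⟩ := hlift _ (hR.inFbar_γ hL hP hγ hH h.1 h.2 n)
      exact ⟨g, fun _ _ => hg⟩
    · exact ⟨0, fun h1 h2 => absurd ⟨h1, h2⟩ h⟩
  choose g hg using hg
  have hcoef : ∀ k, ∃ (A B : Fin (N (k + 1)) → Fin (N k) → Phase D → ℝ)
      (w : Fin (N k) → Phase D → ℝ), 1 ≤ k → k < K →
      (∀ i n, ContDiffOn ℝ ∞ (A i n) W) ∧ (∀ i n, ContDiffOn ℝ ∞ (B i n) W) ∧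
      (∀ n, ContDiffOn ℝ ∞ (w n) W) ∧
      ((∀ u ∈ R.surface U k,
        (R.Γ k u).rank + N (k + 1) = N k ∧
        LinearIndependent ℝ (fun i => fun n => A i n (legendre L u)) ∧
        LinearIndependent ℝ (fun i => fun m => B i m (legendre L u)) ∧
        (∀ i m, ∑ n, A i n (legendre L u) * R.Γ k u n m = 0) ∧
        (∀ i n, ∑ m, R.Γ k u n m * B i m (legendre L u) = 0) ∧
        ∀ i, R.γ (k + 1) i u = ∑ n, A i n (legendre L u) * fderiv ℝ (R.γ k n) u (R.X k u)) ∧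
      (∀ u ∈ R.surface U (k + 1), ∀ n,
        ∑ m, R.Γ k u n m * w m (legendre L u) = -fderiv ℝ (R.γ k n) u (R.X k u))) ∧
      (∀ u ∈ U, R.X (k + 1) u - (R.X k u + ∑ m, w m (legendre L u) • R.P k m u) ∈
        vertKernel L u) ∧
      ∀ i, ∀ u ∈ U, R.P (k + 1) i u - ∑ m, B i m (legendre L u) • R.P k m u ∈
        vertKernel L u := by
    intro k
    by_cases h : 1 ≤ k ∧ k < K
    · obtain ⟨-, -, -, A, B, w, hA, hB, hw, h1, h2, hX, hPk⟩ := hR.step k h.1 h.2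
      choose A' hA' hA'A using fun i n => hlift _ (hA i n)
      choose B' hB' hB'B using fun i n => hlift _ (hB i n)
      choose w' hw' hw'w using fun n => hlift _ (hw n)
      refine ⟨A', B', w', fun _ _ => ⟨hA', hB', hw', ⟨fun u hu => ?_, fun u hu => ?_⟩,
        fun u hu => ?_, fun i u hu => ?_⟩⟩
      · simpa only [hA'A _ _ u hu.1, hB'B _ _ u hu.1] using h1 u hu
      · simpa only [hw'w _ u hu.1] using h2 u hu
      · simpa only [hw'w _ u hu] using hX u hu
      · simpa only [hB'B _ _ u hu] using hPk i u hu
    · exact ⟨0, 0, 0, fun h1 h2 => absurd ⟨h1, h2⟩ h⟩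
  choose A B w hcoef using hcoef
  -- The initial Hamiltonian has to be the one to which the given $X^{[1]}$ projects. The later ones
  -- follow from the projected multipliers.
  obtain ⟨w₁, hw₁, hX₁⟩ := hγ.exists_projectsTo_totalHam hL hP hH hR.X_one
  let φ := iterComb (fun n s => f n s * γ₀ n s) B
  let S : HamData D N := ⟨g, φ, iterSum (totalHam H γ₀ f w₁) w φ⟩
  have hSH : ∀ k, 1 ≤ k → ∀ s, S.H (k + 1) s = S.H k s + ∑ m, w k m s * S.φ k m s :=
    fun k hk s => iterSum_succ _ _ _ hk s
  have hSφ : ∀ k, 1 ≤ k → ∀ i s, S.φ (k + 1) i s = ∑ m, B k i m s * S.φ k m s :=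
    fun k hk i s => iterComb_succ _ _ hk i s
  have hrec : S.IsRecursion W γ₀ f H K := by
    refine ⟨fun n s _ => rfl, ⟨w₁, hw₁, fun s _ => rfl⟩, fun k hk hkK => ?_⟩
    obtain ⟨-, hB, hw, -⟩ := hcoef k hk hkK
    exact ⟨B k, w k, hB, hw, fun s _ => hSH k hk s, fun i s _ => hSφ k hk i s⟩
  have hRS : RunProjects L U R S K := by
    refine hrec.runProjects hL hγ hH hR.P_one hR.γ_one hX₁
      (fun k hk hkK n => (hg k n hk hkK).2) fun k hk hkK => ?_
    obtain ⟨-, hB, hw, -, hX, hPk⟩ := hcoef k hk hkK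
    exact ⟨B k, w k, hB, hw, fun s _ => hSH k hk s, fun i s _ => hSφ k hk i s, hX, hPk⟩
  refine ⟨S, ⟨hR.one_le, hrec.φ_one, hrec.H_one, fun n => (hg 1 n le_rfl hR.one_le).1,
    fun n s hs => ?_, fun k hk hkK => ?_⟩, hRS⟩
  · obtain ⟨u, hu, rfl⟩ := hγ.exists_eq_legendre hs.1 hs.2.1
    have h1 := hγ.factor_mul_poisson hL hP (hγ.isCanonicalHam_totalHam hH hw₁) hu n
    have h2 : S.γ 1 n (legendre L u) = R.γ 1 n u := (hg 1 n le_rfl hR.one_le).2 u hu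
    rw [h2, hR.γ_one n u hu]
    exact (neg_eq_iff_eq_neg.2 h1).symm
  · obtain ⟨hA, hB, hw, hc, -⟩ := hcoef k hk hkK
    obtain ⟨h1, h2⟩ := (hRS.step_conditions_iff hL hγ hk hkK
      fun n => (hg k n hk hkK.le).1).2 hc
    exact ⟨fun i => (hg (k + 1) i (by omega) hkK).1, A k, B k, w k, hA, hB, hw, h1, h2,
      fun s _ => hSH k hk s, fun i s _ => hSφ k hk i s⟩

theorem HamData.IsRun.contDiffOn_γ (hS : S.IsRun W γ₀ f H K) {k : ℕ} (hk : 1 ≤ k) (hkK : k ≤ K)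
    (n : Fin (N k)) : ContDiffOn ℝ ∞ (S.γ k n) W := by
  obtain rfl | hk' := hk.eq_or_lt
  · exact hS.γ_smooth n
  · obtain ⟨j, rfl⟩ := Nat.exists_eq_add_of_le' hk
    exact (hS.step j (by omega) (by omega)).1 n

/-- Every run of the stability analysis is the projection of a run of the Lagrangian constraint
algorithm. -/
theorem HamData.IsRun.exists_lagRun (hS : S.IsRun W γ₀ f H K) (hL : AlmostRegular L U (N 1))
    (hP : IsKernelBasis L U P) (hγ : IsPrimary L U P W γ₀ f) (hH : IsCanonicalHam L U W H) :
    ∃ R : LagData D N, R.IsRun L U P K ∧ RunProjects L U R S K := by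
  have hrec := hS.isRecursion
  have hpull : ∀ {h : Phase D → ℝ}, ContDiffOn ℝ ∞ h W →
      InFbar L U fun u => h (legendre L u) := fun hh =>
    hγ.inFbar_of_comp hL hh fun u _ => rfl
  have hcoef : ∀ k, ∃ (A B : Fin (N (k + 1)) → Fin (N k) → Phase D → ℝ)
      (w : Fin (N k) → Phase D → ℝ), 1 ≤ k → k < K →
      (∀ i n, ContDiffOn ℝ ∞ (A i n) W) ∧ (∀ i n, ContDiffOn ℝ ∞ (B i n) W) ∧
      (∀ n, ContDiffOn ℝ ∞ (w n) W) ∧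
      ((∀ s ∈ S.surface W γ₀ k,
        (S.C k s).rank + N (k + 1) = N k ∧
        LinearIndependent ℝ (fun i => fun n => A i n s) ∧
        LinearIndependent ℝ (fun i => fun m => B i m s) ∧
        (∀ i m, ∑ n, A i n s * S.C k s n m = 0) ∧
        (∀ i n, ∑ m, S.C k s n m * B i m s = 0) ∧
        ∀ i, S.γ (k + 1) i s = ∑ n, A i n s * poisson (S.γ k n) (S.H k) s) ∧
      (∀ s ∈ S.surface W γ₀ (k + 1), ∀ n,
        ∑ m, S.C k s n m * w m s = -poisson (S.γ k n) (S.H k) s)) ∧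
      (∀ s ∈ W, S.H (k + 1) s = S.H k s + ∑ m, w m s * S.φ k m s) ∧
      ∀ i, ∀ s ∈ W, S.φ (k + 1) i s = ∑ m, B i m s * S.φ k m s := by
    intro k
    by_cases h : 1 ≤ k ∧ k < K
    · obtain ⟨-, A, B, w, hA, hB, hw, h1, h2, hH', hφ⟩ := hS.step k h.1 h.2
      exact ⟨A, B, w, fun _ _ => ⟨hA, hB, hw, ⟨h1, h2⟩, hH', hφ⟩⟩
    · exact ⟨0, 0, 0, fun h1 h2 => absurd ⟨h1, h2⟩ h⟩
  choose A B w hcoef using hcoef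
  have hH1 : IsCanonicalHam L U W (S.H 1) := by
    obtain ⟨w₁, hw₁, h⟩ := hrec.H_one
    exact (hγ.isCanonicalHam_totalHam hH hw₁).congr hγ h
  -- The lift is taken for `S.H 1` rather than `H`, so that the initial field matches the given
  -- initial multipliers.
  obtain ⟨X₁, hX₁, hX₁S⟩ := hγ.exists_isSOELVF hL hP hH1
  let Pk := iterComb P fun k i m u => B k i m (legendre L u)
  let R : LagData D N := ⟨fun k n u => S.γ k n (legendre L u), Pk,
    iterSum X₁ (fun k m u => w k m (legendre L u)) Pk⟩
  have hRX : ∀ k, 1 ≤ k → ∀ u,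
      R.X (k + 1) u = R.X k u + ∑ m, w k m (legendre L u) • R.P k m u :=
    fun k hk u => iterSum_succ _ _ _ hk u
  have hRP : ∀ k, 1 ≤ k → ∀ i u, R.P (k + 1) i u = ∑ m, B k i m (legendre L u) • R.P k m u :=
    fun k hk i u => iterComb_succ _ _ hk i u
  have hγ1 : ∀ n, ∀ u ∈ U, R.γ 1 n u = firstOrder L (P n) u := by
    intro n u hu
    -- The secondary constraints are prescribed on the surface of index zero, which is the whole
    -- image, so the equality holds on all of `U`.
    have h1 := hS.γ_one n (legendre L u) ⟨hγ.legendre_mem hu, hγ.apply_legendre hu,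
      fun j hj hj0 => by omega⟩
    rw [hγ.factor_mul_poisson hL hP hH1 hu, neg_neg] at h1
    exact h1
  have h0 : ∀ u, (0 : Phase D) ∈ vertKernel L u := fun u => ⟨rfl, by simp⟩
  have hRS : RunProjects L U R S K := by
    refine hrec.runProjects hL hγ hH (fun n u _ => rfl) hγ1 hX₁S
      (fun k hk hkK n u _ => rfl) fun k hk hkK => ?_
    obtain ⟨-, hB, hw, -, hH', hφ⟩ := hcoef k hk hkK
    refine ⟨B k, w k, hB, hw, hH', hφ, fun u _ => ?_, fun i u _ => ?_⟩
    · rw [hRX k hk, sub_self]; exact h0 u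
    · rw [hRP k hk, sub_self]; exact h0 u
  have hPs : ∀ k, 1 ≤ k → k ≤ K → ∀ m, ContDiffOn ℝ ∞ (R.P k m) U := by
    intro k hk
    induction k, hk using Nat.le_induction with
    | base => exact fun _ m => (hP.bracket m).1
    | succ k hk ih =>
      intro hkK i
      have h : R.P (k + 1) i = fun u => ∑ m, B k i m (legendre L u) • R.P k m u :=
        funext fun u => hRP k hk i u
      rw [h]
      exact ContDiffOn.sum fun m _ =>
        (hpull ((hcoef k hk (by omega)).2.1 i m)).1.smul (ih (by omega) m)
  have hXs : ∀ k, 1 ≤ k → k ≤ K → ContDiffOn ℝ ∞ (R.X k) U := by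
    intro k hk
    induction k, hk using Nat.le_induction with
    | base => exact fun _ => hX₁.1.1
    | succ k hk ih =>
      intro hkK
      have h : R.X (k + 1) = fun u => R.X k u + ∑ m, w k m (legendre L u) • R.P k m u :=
        funext fun u => hRX k hk u
      rw [h]
      exact (ih (by omega)).add (ContDiffOn.sum fun m _ =>
        (hpull ((hcoef k hk (by omega)).2.2.1 m)).1.smul (hPs k hk (by omega) m))
  refine ⟨R, ⟨hS.one_le, fun n u _ => rfl, hX₁, hγ1, fun k hk hkK => ?_⟩, hRS⟩
  obtain ⟨hA, hB, hw, hc, -⟩ := hcoef k hk hkK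
  obtain ⟨h1, h2⟩ := (hRS.step_conditions_iff hL hγ hk hkK
    fun n => hS.contDiffOn_γ hk hkK.le n).1 hc
  refine ⟨fun i => hpull (hS.contDiffOn_γ (by omega) hkK i), hPs (k + 1) (by omega) hkK,
    hXs (k + 1) (by omega) hkK, fun i n u => A k i n (legendre L u),
    fun i n u => B k i n (legendre L u), fun n u => w k n (legendre L u),
    fun i n => hpull (hA i n), fun i n => hpull (hB i n), fun n => hpull (hw n), h1, h2,
    fun u _ => ?_, fun i u _ => ?_⟩
  · rw [hRX k hk, sub_self]; exact h0 u
  · rw [hRP k hk, sub_self]; exact h0 u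

end ExistenceOfRuns

/-! ### General fields, stability of constraints and integral curves for corresponding runs. -/

section Comparison

variable {D : ℕ} {N : ℕ → ℕ} {L : Phase D → ℝ} {U W : Set (Phase D)}
  {P : Fin (N 1) → Phase D → Phase D} {γ₀ f : Fin (N 1) → Phase D → ℝ} {H : Phase D → ℝ}
  {R : LagData D N} {S : HamData D N} {K : ℕ}

theorem LagData.IsRun.surface_one_eq (hR : R.IsRun L U P K) :
    R.surface U 1 = firstSurface L U P := by
  ext u
  refine and_congr_right fun hu => ⟨fun h n => ?_, fun h j hj hj1 n => ?_⟩
  · rw [← hR.γ_one n u hu]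
    exact h 1 le_rfl le_rfl n
  · obtain rfl : j = 1 := le_antisymm hj1 hj
    rw [hR.γ_one n u hu]
    exact h n

theorem LagData.IsRun.contDiffOn_P (hR : R.IsRun L U P K) (hP : IsKernelBasis L U P) {k : ℕ}
    (hk : 1 ≤ k) (hkK : k ≤ K) (m : Fin (N k)) : ContDiffOn ℝ ∞ (R.P k m) U := by
  obtain rfl | hk' := hk.eq_or_lt
  · exact (hP.bracket m).1.congr (hR.P_one m)
  · obtain ⟨j, rfl⟩ := Nat.exists_eq_add_of_le' hk
    exact (hR.step j (by omega) (by omega)).2.1 m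

theorem LagData.IsRun.contDiffOn_X (hR : R.IsRun L U P K) {k : ℕ}
    (hk : 1 ≤ k) (hkK : k ≤ K) : ContDiffOn ℝ ∞ (R.X k) U := by
  obtain rfl | hk' := hk.eq_or_lt
  · exact hR.X_one.1.1
  · obtain ⟨j, rfl⟩ := Nat.exists_eq_add_of_le' hk
    exact (hR.step j (by omega) (by omega)).2.2.1

/-- The horizontal components of the fields `X^[k] + ∑ c^m P^[k]_m` are projectable. -/
theorem LagData.IsRun.inFbar_horizontal (hR : R.IsRun L U P K) (hS : S.IsRecursion W γ₀ f H K)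
    (hRS : RunProjects L U R S K) (hL : AlmostRegular L U (N 1)) (hγ : IsPrimary L U P W γ₀ f)
    {k : ℕ} (hk : 1 ≤ k) (hkK : k ≤ K) (a : Fin D) (c : Fin (N k) → Phase D → ℝ)
    (hc : ∀ m, InFbar L U (c m)) :
    InFbar L U fun u => (R.X k u + ∑ m, c m u • R.P k m u).1 a := by
  -- The free fields project on all of `U`, so their horizontal components are
  -- $\partial\varphi/\partial p_a$ composed with $\mathcal L$.
  have hPa : ∀ k, 1 ≤ k → k ≤ K → ∀ m, ∀ u ∈ U,
      (R.P k m u).1 a = dSnd (S.φ k m) a (legendre L u) := by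
    intro k hk hkK m u hu
    have h := congrArg Prod.fst ((hRS k hk hkK).2.1 m u hu)
    rw [fderiv_legendre hL.isOpen hL.smooth hu] at h
    exact congrFun h a
  -- Projection of $X^{[k]}$ is known only along the first-order surface, so its horizontal part is
  -- followed through the recursion, from the bracket condition on $X^{[1]}$.
  have hX : ∃ x : Phase D → ℝ, ContDiffOn ℝ ∞ x W ∧ ∀ u ∈ U, x (legendre L u) = (R.X k u).1 a := by
    clear hc c
    induction k, hk using Nat.le_induction with
    | base => exact (hγ.inFbar_iff hL _).1 ((hL.bracketVertical_iff.1 hR.X_one.1).2 a)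
    | succ k hk ih =>
      obtain ⟨x, hx, hxX⟩ := ih (by omega)
      obtain ⟨-, -, -, A, B, w, -, -, hw, -, -, hXk, -⟩ := hR.step k hk (by omega)
      choose w' hw' hw'w using fun m => (hγ.inFbar_iff hL _).1 (hw m)
      refine ⟨fun s => x s + ∑ m, w' m s * dSnd (S.φ k m) a s, hx.add (ContDiffOn.sum fun m _ =>
        (hw' m).mul (contDiffOn_dSnd hγ.isOpen (hS.φ_smooth hγ hk (by omega) m) a)),
        fun u hu => ?_⟩
      have h := congrFun (hXk u hu).1 a
      rw [Prod.fst_sub, Pi.sub_apply, Pi.zero_apply, sub_eq_zero] at h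
      rw [h]
      simp [Prod.fst_sum, hPa k hk (by omega) _ u hu, hw'w _ u hu, hxX u hu]
  obtain ⟨x, hx, hxX⟩ := hX
  choose c' hc' hc'c using fun m => (hγ.inFbar_iff hL _).1 (hc m)
  refine hγ.inFbar_of_comp hL (h := fun s => x s + ∑ m, c' m s * dSnd (S.φ k m) a s)
    (hx.add (ContDiffOn.sum fun m _ =>
      (hc' m).mul (contDiffOn_dSnd hγ.isOpen (hS.φ_smooth hγ hk hkK m) a))) fun u hu => ?_
  simp [Prod.fst_sum, hPa k hk hkK _ u hu, hc'c _ u hu, hxX u hu]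

/-- The general field of order `k` projects to the general Hamiltonian of the corresponding
stage. -/
theorem RunProjects.projectsTo_general (hRS : RunProjects L U R S K)
    (hS : S.IsRecursion W γ₀ f H K) (hγ : IsPrimary L U P W γ₀ f) (hH : IsCanonicalHam L U W H)
    {k : ℕ} (hk : 1 ≤ k) (hkK : k ≤ K) {c : Fin (N k) → Phase D → ℝ}
    (hc : ∀ m, ContDiffOn ℝ ∞ (c m) W) :
    ProjectsTo L (R.surface U 1) (fun u => R.X k u + ∑ m, c m (legendre L u) • R.P k m u)
      (fun s => S.H k s + ∑ m, c m s * S.φ k m s) := by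
  intro u hu
  rw [hS.hamField_eq hγ hH hk hkK hc (fun s _ => rfl) (hγ.legendre_mem hu.1)
    (hγ.apply_legendre hu.1), map_add, map_sum, (hRS k hk hkK).2.2 u hu]
  congr 1
  exact Finset.sum_congr rfl fun m _ => by rw [map_smul, (hRS k hk hkK).2.1 m u hu.1]

theorem LagData.IsRun.isSOELVF_general (hR : R.IsRun L U P K) (hS : S.IsRecursion W γ₀ f H K)
    (hRS : RunProjects L U R S K) (hL : AlmostRegular L U (N 1)) (hP : IsKernelBasis L U P)
    (hγ : IsPrimary L U P W γ₀ f) (hH : IsCanonicalHam L U W H)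
    {k : ℕ} (hk : 1 ≤ k) (hkK : k ≤ K) {c : Fin (N k) → Phase D → ℝ}
    (hc : ∀ m, ContDiffOn ℝ ∞ (c m) W) :
    IsSOELVF L U P fun u => R.X k u + ∑ m, c m (legendre L u) • R.P k m u := by
  have hcF : ∀ m, InFbar L U fun u => c m (legendre L u) := fun m =>
    hγ.inFbar_of_comp hL (hc m) fun u _ => rfl
  refine ⟨hL.bracketVertical_iff.2 ⟨?_, fun a =>
    hR.inFbar_horizontal hS hRS hL hγ hk hkK a _ hcF⟩, fun u hu Y => ?_⟩
  · exact (hR.contDiffOn_X hk hkK).add (ContDiffOn.sum fun m _ =>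
      (hcF m).1.smul (hR.contDiffOn_P hP hk hkK m))
  · have hp := hRS.projectsTo_general hS hγ hH hk hkK hc
    rw [hR.surface_one_eq] at hp
    exact hγ.lagrangeForm_eq_of_projectsTo hL (hS.isCanonicalHam hγ hH hk hkK hc)
      (fun u hu => hu.1) hp hu Y

/-- The constraints of the earlier levels are stable under the Hamiltonians of a later stage. -/
theorem HamData.IsRun.poisson_eq_zero_of_lt (hS : S.IsRun W γ₀ f H K)
    (hγ : IsPrimary L U P W γ₀ f) (hH : IsCanonicalHam L U W H) {j k : ℕ} (hj : 1 ≤ j)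
    (hjk : j < k) (hkK : k ≤ K) {c : Fin (N k) → Phase D → ℝ}
    (hc : ∀ m, ContDiffOn ℝ ∞ (c m) W) {s : Phase D} (hs : s ∈ S.surface W γ₀ k)
    (n : Fin (N j)) :
    poisson (S.γ j n) (fun s => S.H k s + ∑ m, c m s * S.φ k m s) s = 0 := by
  have hrec := hS.isRecursion
  -- Seen from order `j + 1`, the Hamiltonian is $H^{[j]}+\sum w^m\varphi^{[j]}_m$ plus free terms:
  -- `w` solves the stability condition for $\gamma_H^{[j]}$, and the free terms lie in the kernel
  -- of the matrix.
  obtain ⟨c', hc', hHT⟩ := hrec.exists_eq_of_le (j := j + 1) (by omega) hjk hkK c hc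
  obtain ⟨-, A, B, w, -, hB, hw, h1, h2, hH', hφ⟩ := hS.step j hj (by omega)
  have hsj := h1 s (S.surface_anti hjk.le hs)
  have hsw := h2 s (S.surface_anti hjk hs) n
  have hj1 := hrec.hamField_eq hγ hH hj (by omega) hw hH' hs.1 hs.2.1
  have hφ0 : ∀ i, fderiv ℝ (S.γ j n) s (hamField (S.φ (j + 1) i) s) = 0 := by
    intro i
    rw [hrec.hamField_φ_eq hγ hj (by omega) (hB i) (hφ i) hs.1 hs.2.1, map_sum,
      ← hsj.2.2.2.2.1 i n]
    refine Finset.sum_congr rfl fun m _ => ?_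
    rw [map_smul, ← poisson_eq_fderiv, smul_eq_mul, mul_comm]
    rfl
  rw [poisson_eq_fderiv, hrec.hamField_eq hγ hH (k := j + 1) (by omega) (by omega) hc' hHT hs.1
    hs.2.1, map_add, map_sum, hj1, map_add, map_sum]
  simp only [map_smul, hφ0, smul_zero, Finset.sum_const_zero, add_zero]
  rw [← poisson_eq_fderiv, ← neg_eq_iff_add_eq_zero, ← hsw]
  refine Finset.sum_congr rfl fun m _ => ?_
  rw [← poisson_eq_fderiv, smul_eq_mul, mul_comm]
  rfl

/-- If there are no new independent constraints at level `k + 1`, then a field that annihilates all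
constraints of lower level annihilates those of level `k + 1` as well. -/
theorem HamData.Stops.fderiv_eq_zero {k : ℕ} (hst : S.Stops W γ₀ k) {s : Phase D}
    (hs : s ∈ S.surface W γ₀ k) {Y : Phase D} (h0 : ∀ n, fderiv ℝ (γ₀ n) s Y = 0)
    (hY : ∀ j, 1 ≤ j → j < k → ∀ n, fderiv ℝ (S.γ j n) s Y = 0) (n : Fin (N k)) :
    fderiv ℝ (S.γ k n) s Y = 0 := by
  have h2k := hst.1
  let A : ℕ → Set (Phase D →L[ℝ] ℝ) := fun k => {α | (∃ n, α = fderiv ℝ (γ₀ n) s) ∨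
    ∃ j, 1 ≤ j ∧ j ≤ k ∧ ∃ n, α = fderiv ℝ (S.γ j n) s}
  have hle : Submodule.span ℝ (A (k - 1)) ≤ Submodule.span ℝ (A k) := by
    refine Submodule.span_mono ?_
    rintro α (h | ⟨j, hj, hjk, h⟩)
    · exact Or.inl h
    · exact Or.inr ⟨j, hj, by omega, h⟩
  -- Equal rank of nested spans means equality, so $d\gamma_H^{[k]}$ is a combination of
  -- differentials that already annihilate `Y`.
  have heq := Submodule.eq_of_le_of_finrank_eq hle (hst.2 s hs).symm
  have hmem : fderiv ℝ (S.γ k n) s ∈ Submodule.span ℝ (A (k - 1)) := by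
    rw [heq]
    exact Submodule.subset_span (Or.inr ⟨k, by omega, le_rfl, n, rfl⟩)
  refine Submodule.span_induction (p := fun α _ => α Y = 0) ?_ (by simp) ?_ ?_ hmem
  · rintro _ (⟨n, rfl⟩ | ⟨j, hj, hjk, n, rfl⟩)
    · exact h0 n
    · exact hY j hj (by omega) n
  · intro α β _ _ hα hβ
    simp [hα, hβ]
  · intro c α _ hα
    simp [hα]

/-- If the number of independent constraints is locally constant, the integral curves of a
Hamiltonian vector field that annihilates all constraints stay on the constraint submanifold. -/
theorem RunProjects.integralCurve_mem_surface (hRS : RunProjects L U R S K)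
    (hL : AlmostRegular L U (N 1)) (hP : IsKernelBasis L U P) (hγ : IsPrimary L U P W γ₀ f)
    (hS : ∀ j, 1 ≤ j → j ≤ K → ∀ n, ContDiffOn ℝ ∞ (S.γ j n) W) {k : ℕ} (hkK : k ≤ K)
    {h : Phase D → ℝ} (hh : ContDiffOn ℝ ∞ h W)
    (h0 : ∀ s ∈ S.surface W γ₀ k, ∀ n, poisson (γ₀ n) h s = 0)
    (hst : ∀ s ∈ S.surface W γ₀ k, ∀ j, 1 ≤ j → j ≤ k → ∀ n, poisson (S.γ j n) h s = 0)
    (hrank : ∀ u ∈ R.surface U k, ∀ᶠ x in 𝓝 u, R.indepRank k x = R.indepRank k u)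
    {a b : ℝ} {x : ℝ → Phase D}
    (hx : ∀ t ∈ Set.Ioo a b, x t ∈ W ∧ HasDerivAt x (hamField h (x t)) t)
    (hx0 : ∃ t ∈ Set.Ioo a b, x t ∈ S.surface W γ₀ k) :
    ∀ t ∈ Set.Ioo a b, x t ∈ S.surface W γ₀ k := by
  let ι := Fin (N 1) ⊕ Σ j : Fin k, Fin (N (j + 1))
  -- The shift by one skips the unused family of index zero.
  let g : ι → Phase D → ℝ := Sum.elim γ₀ fun p => S.γ (p.1 + 1) p.2
  have hmem : ∀ s, s ∈ S.surface W γ₀ k ↔ s ∈ W ∧ ∀ i, g i s = 0 := by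
    intro s
    refine and_congr_right fun _ => ⟨?_, fun h => ⟨fun n => h (Sum.inl n), fun j hj hjk n => ?_⟩⟩
    · rintro ⟨h1, h2⟩ (n | ⟨j, n⟩)
      · exact h1 n
      · exact h2 (j + 1) (by omega) (by omega) n
    · obtain ⟨i, rfl⟩ := Nat.exists_eq_add_of_le' hj
      exact h (Sum.inr ⟨⟨i, by omega⟩, n⟩)
  have hspan : ∀ s, Module.finrank ℝ (Submodule.span ℝ (Set.range fun i => fderiv ℝ (g i) s)) =
      S.indepRank γ₀ k s := by
    intro s
    have h : (Set.range fun i => fderiv ℝ (g i) s) =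
        {α : Phase D →L[ℝ] ℝ | (∃ n, α = fderiv ℝ (γ₀ n) s) ∨
          ∃ j, 1 ≤ j ∧ j ≤ k ∧ ∃ n, α = fderiv ℝ (S.γ j n) s} := by
      ext α
      constructor
      · rintro ⟨n | ⟨j, n⟩, rfl⟩
        · exact Or.inl ⟨n, rfl⟩
        · exact Or.inr ⟨j + 1, by omega, by omega, n, rfl⟩
      · rintro (⟨n, rfl⟩ | ⟨j, hj, hjk, n, rfl⟩)
        · exact ⟨Sum.inl n, rfl⟩
        · obtain ⟨i, rfl⟩ := Nat.exists_eq_add_of_le' hj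
          exact ⟨Sum.inr ⟨⟨i, by omega⟩, n⟩, rfl⟩
    rw [h]
    rfl
  have hu : ∀ s ∈ W, (∀ i, g i s = 0) → ∃ u ∈ R.surface U k, legendre L u = s :=
    fun s hs hz => hRS.exists_of_mem_surface hγ hkK ((hmem s).2 ⟨hs, hz⟩)
  have hres := integralCurve_mem_of_tangent hγ.isOpen (g := g) (Y := hamField h) (a := a) (b := b)
    (x := x) ?_ (contDiffOn_hamField hγ.isOpen hh) (Set.range Sum.inl) ?_ ?_ ?_ hx ?_
  · exact fun t ht => (hmem _).2 ⟨(hx t ht).1, hres t ht⟩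
  · rintro (n | ⟨j, n⟩)
    · exact hγ.smooth n
    · exact hS (j + 1) (by omega) (by omega) n
  · intro s hs hz
    obtain ⟨u, hu, rfl⟩ := hu s hs hz
    rw [linearIndepOn_range_iff Sum.inl_injective]
    exact hγ.linearIndependent hL hP hu.1
  · intro s hs hz
    obtain ⟨u, hu, rfl⟩ := hu s hs hz
    -- Local constancy of the rank is assumed on `U`. The section `σ` carries it to nearby points of
    -- the image only, which is why the invariance lemma asks for it just where the primary
    -- constraints vanish.
    obtain ⟨V, hV, huV, σ, hσ, hσU, hσu, hσL⟩ := hL.submersive u hu.1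
    have hσc : Filter.Tendsto σ (𝓝 (legendre L u)) (𝓝 u) := by
      have := (differentiableAt_of_contDiffOn hV hσ huV).continuousAt
      rwa [ContinuousAt, hσu] at this
    filter_upwards [hσc.eventually (hrank u hu), hV.mem_nhds huV, hγ.isOpen.mem_nhds hs]
      with s h1 h2 h3 h4
    have h5 : s ∈ legendre L '' U := by
      rw [hγ.image]
      exact ⟨h3, fun n => h4 (Sum.inl n) ⟨n, rfl⟩⟩
    have h6 := hσL s ⟨h2, h5⟩
    rw [hspan, hspan, hRS.indepRank_eq hL hP hγ hS hkK hu.1, ← h1,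
      ← hRS.indepRank_eq hL hP hγ hS hkK (hσU h2), h6]
  · intro s hs hz i
    have hss := (hmem s).2 ⟨hs, hz⟩
    rw [← poisson_eq_fderiv]
    rcases i with n | ⟨j, n⟩
    · exact h0 s hss n
    · exact hst s hss (j + 1) (by omega) (by omega) n
  · obtain ⟨t, ht, hxt⟩ := hx0
    exact ⟨t, ht, ((hmem _).1 hxt).2⟩

end Comparison

end ConstrainedDynamics

/-! ### Equivalence of the two constraint algorithms. -/

open ConstrainedDynamics in
theorem mainTheorem1 {D : ℕ} (N : ℕ → ℕ) (L : Phase D → ℝ) (U W : Set (Phase D))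
    (P : Fin (N 1) → Phase D → Phase D) (γ₀ f : Fin (N 1) → Phase D → ℝ)
    (hL : AlmostRegular L U (N 1)) (hP : IsKernelBasis L U P)
    (hγ : IsPrimary L U P W γ₀ f) :
    -- projectability of functions, of the energy and of the constraint functions
    (∀ g : Phase D → ℝ, InFbar L U g ↔
      ∃ h : Phase D → ℝ, ContDiffOn ℝ ∞ h W ∧ ∀ u ∈ U, h (legendre L u) = g u) ∧
    InFbar L U (energy L) ∧ (∃ H, IsCanonicalHam L U W H) ∧
    (∀ n, InFbar L U (firstOrder L (P n))) ∧
    (∀ X, IsSOELVF L U P X → ∀ g, InFbar L U g →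
      ∃ g', InFbar L U g' ∧ ∀ u ∈ firstSurface L U P, g' u = fderiv ℝ g u (X u)) ∧
    -- no multiplier is fixed by the primary constraints
    (∀ n m, ∀ s ∈ W, (∀ l, γ₀ l s = 0) → poisson (γ₀ n) (γ₀ m) s = 0) ∧
    ∀ H, IsCanonicalHam L U W H →
      -- `f_n dγ₀_n/dt = -γ^[1]_n` under every total Hamiltonian
      (∀ w : Fin (N 1) → Phase D → ℝ, (∀ m, ContDiffOn ℝ ∞ (w m) W) → ∀ n, ∀ u ∈ U,
        f n (legendre L u) * poisson (γ₀ n) (totalHam H γ₀ f w) (legendre L u) =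
          -firstOrder L (P n) u) ∧
      -- SOELVFs project to the Hamiltonian vector fields of the total Hamiltonians
      (∀ X, IsSOELVF L U P X → ∃ w : Fin (N 1) → Phase D → ℝ, (∀ m, ContDiffOn ℝ ∞ (w m) W) ∧
        ProjectsTo L (firstSurface L U P) X (totalHam H γ₀ f w)) ∧
      (∀ w : Fin (N 1) → Phase D → ℝ, (∀ m, ContDiffOn ℝ ∞ (w m) W) → ∃ X, IsSOELVF L U P X ∧
        ProjectsTo L (firstSurface L U P) X (totalHam H γ₀ f w)) ∧
      -- each run of one algorithm corresponds, step by step, to a run of the other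
      (∀ K, ∀ R : LagData D N, R.IsRun L U P K →
        ∃ S : HamData D N, S.IsRun W γ₀ f H K ∧ RunProjects L U R S K) ∧
      (∀ K, ∀ S : HamData D N, S.IsRun W γ₀ f H K →
        ∃ R : LagData D N, R.IsRun L U P K ∧ RunProjects L U R S K) ∧
      -- what corresponding runs have in common
      ∀ K, ∀ R : LagData D N, ∀ S : HamData D N, R.IsRun L U P K → S.IsRun W γ₀ f H K →
        RunProjects L U R S K → ∀ k, 1 ≤ k → k ≤ K →
          -- the constraint submanifolds correspond, and the algorithms stop together
          legendre L '' R.surface U k = S.surface W γ₀ k ∧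
          (R.Stops U k ↔ S.Stops W γ₀ k) ∧
          -- the general field of order `k` is a SOELVF and projects to the Hamiltonian vector
          -- field of the total Hamiltonian of the corresponding stage
          ∀ c : Fin (N k) → Phase D → ℝ, (∀ m, ContDiffOn ℝ ∞ (c m) W) →
            ∀ (X : Phase D → Phase D) (HT : Phase D → ℝ),
              X = (fun u => R.X k u + ∑ m, c m (legendre L u) • R.P k m u) →
              HT = (fun s => S.H k s + ∑ m, c m s * S.φ k m s) →
              IsSOELVF L U P X ∧
              (∃ w : Fin (N 1) → Phase D → ℝ, (∀ m, ContDiffOn ℝ ∞ (w m) W) ∧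
                ∀ s ∈ W, HT s = totalHam H γ₀ f w s) ∧
              ProjectsTo L (R.surface U 1) X HT ∧
              -- the constraints of the previous levels are stable
              (∀ s ∈ S.surface W γ₀ k, (∀ n, poisson (γ₀ n) HT s = 0) ∧
                ∀ j, 1 ≤ j → j < k → ∀ n, poisson (S.γ j n) HT s = 0) ∧
              -- at the final stage all constraints are stable, and, if the number of independent
              -- constraint functions is locally constant, the flow stays on the final submanifold
              (R.Stops U k →
                (∀ s ∈ S.surface W γ₀ k, ∀ n, poisson (S.γ k n) HT s = 0) ∧
                ((∀ u ∈ R.surface U k, ∀ᶠ x in 𝓝 u, R.indepRank k x = R.indepRank k u) →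
                  ∀ (a b : ℝ) (x : ℝ → Phase D),
                    (∀ t ∈ Set.Ioo a b, x t ∈ W ∧ HasDerivAt x (hamField HT (x t)) t) →
                    (∃ t ∈ Set.Ioo a b, x t ∈ S.surface W γ₀ k) →
                    ∀ t ∈ Set.Ioo a b, x t ∈ S.surface W γ₀ k)) := by
  have hcan : ∃ H, IsCanonicalHam L U W H :=
    (hγ.inFbar_iff hL _).1 (inFbar_energy hL.isOpen hL.smooth)
  obtain ⟨H₀, hH₀⟩ := hcan
  refine ⟨hγ.inFbar_iff hL, inFbar_energy hL.isOpen hL.smooth, ⟨H₀, hH₀⟩,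
    hγ.inFbar_firstOrder hL hP hH₀, fun X hX g hg => hγ.exists_inFbar_fderiv hL hP hH₀ hX hg,
    fun n m s hs h => hγ.poisson_eq_zero hL hP hs h n m, fun H hH => ⟨fun w hw n u hu =>
      hγ.factor_mul_poisson hL hP (hγ.isCanonicalHam_totalHam hH hw) hu n,
    fun X hX => hγ.exists_projectsTo_totalHam hL hP hH hX,
    fun w hw => hγ.exists_isSOELVF hL hP (hγ.isCanonicalHam_totalHam hH hw),
    fun K R hR => hR.exists_hamRun hL hP hγ hH, fun K S hS => hS.exists_lagRun hL hP hγ hH, ?_⟩⟩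
  intro K R S hR hS hRS k hk hkK
  have hrec := hS.isRecursion
  have hSγ : ∀ j, 1 ≤ j → j ≤ K → ∀ n, ContDiffOn ℝ ∞ (S.γ j n) W :=
    fun j hj hjK => hS.contDiffOn_γ hj hjK
  refine ⟨hRS.image_surface hγ hkK, hRS.stops_iff hL hP hγ hSγ hkK, ?_⟩
  rintro c hc X HT rfl rfl
  -- Since this Hamiltonian restricts to the energy, the first-order formula applies to it, and over
  -- $\mathbb P_L^{[k]}\subset\mathbb P_L^{[1]}$ it makes the primary constraints stable.
  have hT := hrec.isCanonicalHam hγ hH hk hkK hc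
  have h0 : ∀ s ∈ S.surface W γ₀ k, ∀ n,
      poisson (γ₀ n) (fun s => S.H k s + ∑ m, c m s * S.φ k m s) s = 0 := by
    intro s hs n
    obtain ⟨u, hu, rfl⟩ := hRS.exists_of_mem_surface hγ hkK hs
    refine hγ.poisson_eq_zero_of_mem_firstSurface hL hP hT ?_ n
    rw [← hR.surface_one_eq]
    exact R.surface_anti hk hu
  have hlt : ∀ s ∈ S.surface W γ₀ k, ∀ j, 1 ≤ j → j < k → ∀ n,
      poisson (S.γ j n) (fun s => S.H k s + ∑ m, c m s * S.φ k m s) s = 0 :=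
    fun s hs j hj hjk n => hS.poisson_eq_zero_of_lt hγ hH hj hjk hkK hc hs n
  refine ⟨hR.isSOELVF_general hrec hRS hL hP hγ hH hk hkK hc, hrec.exists_eq_totalHam hk hkK c hc,
    hRS.projectsTo_general hrec hγ hH hk hkK hc, fun s hs => ⟨h0 s hs, hlt s hs⟩, fun hst => ?_⟩
  have hk0 : ∀ s ∈ S.surface W γ₀ k, ∀ n,
      poisson (S.γ k n) (fun s => S.H k s + ∑ m, c m s * S.φ k m s) s = 0 := by
    intro s hs n
    rw [poisson_eq_fderiv]
    refine ((hRS.stops_iff hL hP hγ hSγ hkK).1 hst).fderiv_eq_zero hs (fun n => ?_)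
      (fun j hj hjk n => ?_) n
    · rw [← poisson_eq_fderiv]
      exact h0 s hs n
    · rw [← poisson_eq_fderiv]
      exact hlt s hs j hj hjk n
  refine ⟨hk0, fun hrank a b x hx hx0 => ?_⟩
  refine hRS.integralCurve_mem_surface hL hP hγ hSγ hkK hT.1 h0 (fun s hs j hj hjk n => ?_) hrank
    hx hx0
  obtain rfl | hlt' := hjk.eq_or_lt
  · exact hk0 s hs n
  · exact hlt s hs j hj hlt' n
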